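/- Let $M$ be a smooth manifold and let $(A,[\cdot,\cdot],\rho)$ be a Lie algebroid over $M$ with differential $d$ and Lie derivative $\mathcal L$. For $\pi\in\Gamma(\bigwedge^2A)$ write $\pi^\sharp\alpha=\pi(\alpha,\cdot)$ for $\alpha\in\Gamma(A^*)$, and $$[\alpha,\beta]_\pi=\mathcal L_{\pi^\sharp\alpha}\beta-\mathcal L_{\pi^\sharp\beta}\alpha-d(\pi(\alpha,\beta)),\qquad \rho_\pi=\rho\circ\pi^\sharp ;$$ write $A^*_\pi$ for $A^*$ with this bracket and anchor. For $N\in\Gamma(A\otimes A^*)=\mathrm{End}(A)$ put $$[X,Y]_N=[NX,Y]+[X,NY]-N[X,Y],\qquad \rho_N=\rho\circ N,\qquad T_N(X,Y)=[NX,NY]-N[X,Y]_N,$$ let $d_N$ be the degree one derivation of $\Gamma(\bigwedge^\bullet A^*)$ given by the Koszul formula for $([\cdot,\cdot]_N,\rho_N)$, and let $C_{\pi,N}=([\cdot,\cdot]_N)_\pi-([\cdot,\cdot]_\pi)_{{}^tN}$. For a $3$-form $H$ let $i_{X\wedge Y}H=H(X,Y,\cdot)$, $(i_NH)(X,Y,Z)=H(NX,Y,Z)+H(X,NY,Z)+H(X,Y,NZ)$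 and $\mathcal H(X,Y,Z)=H(NX,NY,Z)+H(NY,NZ,X)+H(NZ,NX,Y)$. A Poisson quasi-Nijenhuis structure with background on $A$ is a quadruple $(\pi,N,\psi,H)$ with $\pi\in\Gamma(\bigwedge^2A)$, $N\in\Gamma(A\otimes A^*)$, $\psi,H\in\Gamma(\bigwedge^3A^*)$ such that $N\circ\pi^\sharp=\pi^\sharp\circ{}^tN$, $d\psi=0$, $dH=0$, $\pi$ is Poisson (its Schouten–Nijenhuis bracket $[\pi,\pi]$ vanishes), and for all $X,Y\in\Gamma(A)$, $\alpha,\beta\in\Gamma(A^*)$ $$C_{\pi,N}(\alpha,\beta)=-2\,i_{\pi^\sharp\alpha\wedge\pi^\sharp\beta}H,\qquad T_N(X,Y)=\pi^\sharp\bigl(i_{NX\wedge Y}H-i_{NY\wedge X}H+i_{X\wedge Y}\psi\bigr),\qquad d_N\psi=d\mathcal H .$$ A Lie quasi-bialgebroid is a triple $(B,\delta,\varphi)$ where $B$ is a Lie algebroid, $\delta$ is a degree one derivation of the Gerstenhaber algebra $(\Gamma(\bigwedge^\bullet B),\wedge,[\cdot,\cdot])$, that is, $\delta(P\wedge Q)=\delta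 P\wedge Q+(-1)^pP\wedge\delta Q$ and $\delta[P,Q]=[\delta P,Q]+(-1)^{p-1}[P,\delta Q]$ for $P$ of degree $p$, and $\varphi\in\Gamma(\bigwedge^3B)$ satisfies $\delta^2=[\varphi,\cdot]$ and $\delta\varphi=0$. **Theorem.** If $(\pi,N,\psi,H)$ is a Poisson quasi-Nijenhuis structure with background on $A$, then $(A^*_\pi,\;d_N^H,\;\psi+i_NH)$ is a Lie quasi-bialgebroid, where $d_N^H$ is the degree one derivation of $(\Gamma(\bigwedge^\bullet A^*),\wedge)$ with $d_N^Hf=d_Nf$ for $f\in C^\infty(M)$ and $d_N^H\alpha=d_N\alpha-i_{\pi^\sharp\alpha}H$ for $\alpha\in\Gamma(A^*)$. -/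

import Mathlib

open scoped Manifold ContDiff DirectSum

noncomputable section

/-! ### Sections of a smooth vector bundle as a module over the smooth functions -/

section Sections

variable {EM : Type*} [NormedAddCommGroup EM] [NormedSpace ℝ EM]
  {M : Type*} [TopologicalSpace M] [ChartedSpace EM M]
  {F : Type*} [NormedAddCommGroup F] [NormedSpace ℝ F]
  {E : M → Type*} [TopologicalSpace (Bundle.TotalSpace F E)]
  [∀ x, AddCommGroup (E x)] [∀ x, Module ℝ (E x)] [∀ x, TopologicalSpace (E x)]
  [FiberBundle F E] [VectorBundle ℝ F E]

instance sectionSMul :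
    SMul C^∞⟮𝓘(ℝ, EM), M; 𝓘(ℝ), ℝ⟯ Cₛ^∞⟮𝓘(ℝ, EM); F, E⟯ where
  smul f s := ⟨fun x => f x • s x, f.contMDiff.smul_section s.contMDiff⟩

theorem section_smul_apply (f : C^∞⟮𝓘(ℝ, EM), M; 𝓘(ℝ), ℝ⟯)
    (s : Cₛ^∞⟮𝓘(ℝ, EM); F, E⟯) (x : M) : (f • s) x = f x • s x := rfl

instance sectionModule :
    Module C^∞⟮𝓘(ℝ, EM), M; 𝓘(ℝ), ℝ⟯ Cₛ^∞⟮𝓘(ℝ, EM); F, E⟯ where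
  one_smul s := by ext x; exact one_smul ℝ (s x)
  mul_smul f g s := by ext x; exact mul_smul (f x) (g x) (s x)
  smul_zero f := by ext x; exact smul_zero (f x)
  smul_add f s t := by ext x; exact smul_add (f x) (s x) (t x)
  add_smul f g s := by ext x; exact add_smul (f x) (g x) (s x)
  zero_smul s := by ext x; exact zero_smul ℝ (s x)

instance sectionScalarTower :
    IsScalarTower ℝ C^∞⟮𝓘(ℝ, EM), M; 𝓘(ℝ), ℝ⟯ Cₛ^∞⟮𝓘(ℝ, EM); F, E⟯ where
  smul_assoc c f s := by ext x; exact smul_assoc c (f x) (s x)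

end Sections

/-! ### The exterior algebra

`R` stands for `C^∞(M)` and `V` for the module `Γ(B)` of sections of a vector bundle `B`.  Sections
of `B*` are the `R`-linear maps `V → R`, and sections of `⋀^k B*` are the alternating `R`-multilinear
maps `V^k → R`.  Sections of `⋀^k B` are obtained by using `Γ(B*) = Module.Dual R V` instead of `V`.
-/

section Exterior

variable (R V : Type*) [CommRing R] [AddCommGroup V] [Module R V]

/-- Sections of `⋀^• B*`, where `V = Γ(B)`. -/
abbrev ExtForms : Type _ := ⨁ k : ℕ, V [⋀^Fin k]→ₗ[R] R

variable {R V}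

/-- A homogeneous element of degree `k`. -/
abbrev homog (k : ℕ) (η : V [⋀^Fin k]→ₗ[R] R) : ExtForms R V :=
  DirectSum.lof R ℕ (fun k => V [⋀^Fin k]→ₗ[R] R) k η

/-- A function, as an element of degree `0`. -/
def fn0 (f : R) : ExtForms R V := homog 0 (AlternatingMap.constOfIsEmpty R V (Fin 0) f)

/-- A section of `B*`, as an element of degree `1`. -/
def form1 (α : Module.Dual R V) : ExtForms R V :=
  homog 1 (AlternatingMap.ofSubsingleton R V R (0 : Fin 1) α)

/-- The wedge product of homogeneous elements (sum over shuffles). -/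
def wedgeHom (p q : ℕ) :
    (V [⋀^Fin p]→ₗ[R] R) →ₗ[R] (V [⋀^Fin q]→ₗ[R] R) →ₗ[R] (V [⋀^Fin (p + q)]→ₗ[R] R) :=
  TensorProduct.curry
    ((AlternatingMap.domDomCongrₗ R (finSumFinEquiv (m := p) (n := q))).toLinearMap ∘ₗ
      LinearMap.compAlternatingMapₗ R (LinearMap.mul' R R) ∘ₗ
      AlternatingMap.domCoprod')

/-- The wedge product. -/
def wedge : ExtForms R V →ₗ[R] ExtForms R V →ₗ[R] ExtForms R V :=
  DirectSum.toModule R ℕ _ fun p =>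
    (DirectSum.toModule R ℕ _ fun q =>
      ((wedgeHom p q).compr₂ (DirectSum.lof R ℕ (fun k => V [⋀^Fin k]→ₗ[R] R) (p + q))).flip).flip

/-- `i_N η`, that is `(X₁, …, X_k) ↦ ∑ᵢ η(X₁, …, N Xᵢ, …, X_k)`. -/
def insertEnd {k : ℕ} (N : V →ₗ[R] V) (η : V [⋀^Fin k]→ₗ[R] R) : V [⋀^Fin k]→ₗ[R] R where
  toMultilinearMap := ∑ i : Fin k,
    η.toMultilinearMap.compLinearMap fun j => if j = i then N else LinearMap.id
  map_eq_zero_of_eq' v i j hv hij := by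
    simp only [MultilinearMap.toFun_eq_coe, sum_apply,
      MultilinearMap.compLinearMap_apply, AlternatingMap.coe_multilinearMap]
    rw [Finset.sum_eq_add i j hij]
    · rw [← η.map_swap_add _ hij, add_comm]
      congr 2
      funext m
      by_cases h1 : m = i
      · subst h1; simp [hv, hij, hij.symm, Equiv.swap_apply_left]
      · by_cases h2 : m = j
        · subst h2; simp [hv, Equiv.swap_apply_right]
        · simp [Equiv.swap_apply_of_ne_of_ne h1 h2, h1, h2]
    · rintro c - ⟨h1, h2⟩
      exact η.map_eq_zero_of_eq _ (by simp [h1.symm, h2.symm, hv]) hij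
    · simp
    · simp

theorem insertEnd_apply {k : ℕ} (N : V →ₗ[R] V) (η : V [⋀^Fin k]→ₗ[R] R) (X : Fin k → V) :
    insertEnd N η X = ∑ i, η (Function.update X i (N (X i))) := by
  change (∑ i : Fin k, η.toMultilinearMap.compLinearMap
    fun j => if j = i then N else LinearMap.id) X = _
  simp only [sum_apply, MultilinearMap.compLinearMap_apply,
    AlternatingMap.coe_multilinearMap]
  refine Finset.sum_congr rfl fun i _ => congrArg η (funext fun j => ?_)
  by_cases h : j = i
  · subst h; simp
  · simp [h]

/-- `i_{X∧Y} η = η(X, Y, ·)` for a `3`-form `η`. -/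
def contract2 (η : V [⋀^Fin 3]→ₗ[R] R) (X Y : V) : Module.Dual R V where
  toFun Z := η ![X, Y, Z]
  map_add' Z Z' := by
    have h := η.map_update_add ![X, Y, 0] 2 Z Z'
    have e : ∀ W, Function.update ![X, Y, 0] 2 W = ![X, Y, W] := fun W => by
      ext i; fin_cases i <;> rfl
    simpa only [e] using h
  map_smul' c Z := by
    have h := η.map_update_smul ![X, Y, 0] 2 c Z
    have e : ∀ W, Function.update ![X, Y, 0] 2 W = ![X, Y, W] := fun W => by
      ext i; fin_cases i <;> rfl
    simpa only [e, RingHom.id_apply] using h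

variable (R V)

/-- A section `π` of `⋀² A`, where `V = Γ(A)`: an alternating bilinear map on `Γ(A*)`, together with
the (uniquely determined) map `π♯ : Γ(A*) → Γ(A)`, `π♯ α = π(α, ·)`. -/
structure Bivector where
  toForm : Module.Dual R V [⋀^Fin 2]→ₗ[R] R
  sharp : Module.Dual R V →ₗ[R] V
  apply_sharp : ∀ α β : Module.Dual R V, β (sharp α) = toForm ![α, β]

variable {R V}

theorem Bivector.apply_sharp_self (π : Bivector R V) (α : Module.Dual R V) :
    α (π.sharp α) = 0 := by
  rw [π.apply_sharp]
  exact π.toForm.map_eq_zero_of_eq _ (i := 0) (j := 1) rfl (by decide)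

theorem Bivector.apply_sharp_swap (π : Bivector R V) (α β : Module.Dual R V) :
    α (π.sharp β) = - β (π.sharp α) := by
  have h := π.apply_sharp_self (α + β)
  simp only [map_add, LinearMap.add_apply, π.apply_sharp_self] at h
  linear_combination h

end Exterior

/-! ### Lie algebroids -/

/-- A skew-symmetric bracket on `Γ(B)` together with an anchor `Γ(B) → 𝔛(M) = Der C^∞(M)`, related by
the Leibniz rule.  It is a Lie algebroid structure if `AlmostLieAlgebroid.IsLie` holds. -/
structure AlmostLieAlgebroid (R B : Type*) [CommRing R] [Algebra ℝ R] [AddCommGroup B] [Module R B]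
    [Module ℝ B] [IsScalarTower ℝ R B] where
  bracket : B →ₗ[ℝ] B →ₗ[ℝ] B
  anchor : B →ₗ[R] Derivation ℝ R R
  bracket_self : ∀ X, bracket X X = 0
  leibniz : ∀ (X Y : B) (f : R), bracket X (f • Y) = f • bracket X Y + anchor X f • Y

namespace AlmostLieAlgebroid

variable {R B : Type*} [CommRing R] [Algebra ℝ R] [AddCommGroup B] [Module R B]
  [Module ℝ B] [IsScalarTower ℝ R B]

/-- The Lie algebroid axioms: the Jacobi identity, and the anchor preserves brackets. -/
structure IsLie (A : AlmostLieAlgebroid R B) : Prop where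
  jacobi : ∀ X Y Z, A.bracket X (A.bracket Y Z) =
    A.bracket (A.bracket X Y) Z + A.bracket Y (A.bracket X Z)
  anchor_bracket : ∀ X Y, A.anchor (A.bracket X Y) = ⁅A.anchor X, A.anchor Y⁆

theorem bracket_swap (A : AlmostLieAlgebroid R B) (X Y : B) :
    A.bracket X Y = - A.bracket Y X := by
  have h := A.bracket_self (X + Y)
  simp only [map_add, LinearMap.add_apply, A.bracket_self, zero_add, add_zero] at h
  exact eq_neg_of_add_eq_zero_right h

/-- The differential of a `k`-form `η`, evaluated on `k + 1` sections:
`∑ᵢ (-1)ⁱ ρ(Xᵢ) η(…, X̂ᵢ, …) + ∑_{i<j} (-1)^(i+j) η([Xᵢ, Xⱼ], …, X̂ᵢ, …, X̂ⱼ, …)`.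
In the code `[Xᵢ, Xⱼ]` stands at the place of `Xⱼ`, which changes `(-1)^(i+j)` to `-(-1)ⁱ`. -/
def diff (A : AlmostLieAlgebroid R B) {k : ℕ} (η : (Fin k → B) → R) (X : Fin (k + 1) → B) : R :=
  ∑ i : Fin (k + 1), (-1 : R) ^ (i : ℕ) *
    (A.anchor (X i) (η (i.removeNth X)) -
      ∑ j ∈ Finset.Ioi i, η (i.removeNth (Function.update X j (A.bracket (X i) (X j)))))

/-- The differential of a function, `df(X) = ρ(X) f`. -/
def diffFn (A : AlmostLieAlgebroid R B) (f : R) : Module.Dual R B where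
  toFun X := A.anchor X f
  map_add' X Y := by simp
  map_smul' c X := by simp

/-- The Lie derivative of a `1`-form, `(L_X β)(Y) = ρ(X)(β(Y)) - β([X, Y])`. -/
def lieDer (A : AlmostLieAlgebroid R B) (X : B) (β : Module.Dual R B) : Module.Dual R B where
  toFun Y := A.anchor X (β Y) - β (A.bracket X Y)
  map_add' Y Z := by simp only [map_add]; ring
  map_smul' c Y := by
    simp only [map_smul, smul_eq_mul, Derivation.leibniz, A.leibniz, map_add, RingHom.id_apply]
    ring

/-- The structure `[X, Y]_N = [NX, Y] + [X, NY] - N[X, Y]`, `ρ_N = ρ ∘ N`. -/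
def deform (A : AlmostLieAlgebroid R B) (N : B →ₗ[R] B) : AlmostLieAlgebroid R B where
  bracket := LinearMap.mk₂ ℝ
    (fun X Y => A.bracket (N X) Y + A.bracket X (N Y) - N (A.bracket X Y))
    (fun X X' Y => by simp only [map_add, LinearMap.add_apply]; abel)
    (fun c X Y => by
      simp only [LinearMap.map_smul_of_tower, map_smul, LinearMap.smul_apply, smul_add, smul_sub])
    (fun X Y Y' => by simp only [map_add]; abel)
    (fun c X Y => by
      simp only [LinearMap.map_smul_of_tower, map_smul, smul_add, smul_sub])
  anchor := A.anchor ∘ₗ N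
  bracket_self X := by
    rw [LinearMap.mk₂_apply, A.bracket_self, A.bracket_swap X (N X)]; simp
  leibniz X Y f := by
    simp only [LinearMap.mk₂_apply, A.leibniz, map_smul, map_add, LinearMap.comp_apply, smul_sub,
      smul_add]
    abel

/-- The Nijenhuis torsion `T_N(X, Y) = [NX, NY] - N([NX, Y] + [X, NY] - N[X, Y])`. -/
def torsion (A : AlmostLieAlgebroid R B) (N : B →ₗ[R] B) (X Y : B) : B :=
  A.bracket (N X) (N Y) - N (A.bracket (N X) Y + A.bracket X (N Y) - N (A.bracket X Y))

/-- The structure on the dual bundle `A*` given by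
`[α, β]_π = L_{π♯α} β - L_{π♯β} α - d(π(α, β))`, `ρ_π = ρ ∘ π♯`. -/
def cotangent (A : AlmostLieAlgebroid R B) (π : Bivector R B) :
    AlmostLieAlgebroid R (Module.Dual R B) where
  bracket := LinearMap.mk₂ ℝ
    (fun α β => A.lieDer (π.sharp α) β - A.lieDer (π.sharp β) α - A.diffFn (π.toForm ![α, β]))
    (fun α α' β => by
      ext Y
      simp only [← π.apply_sharp, lieDer, diffFn, LinearMap.sub_apply, LinearMap.coe_mk,
        AddHom.coe_mk, map_add, LinearMap.add_apply, Derivation.add_apply]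
      ring)
    (fun c α β => by
      ext Y
      simp only [← π.apply_sharp, lieDer, diffFn, LinearMap.sub_apply, LinearMap.coe_mk,
        AddHom.coe_mk, LinearMap.map_smul_of_tower, LinearMap.smul_apply, Derivation.smul_apply,
        Derivation.map_smul, smul_sub])
    (fun α β β' => by
      ext Y
      simp only [← π.apply_sharp, lieDer, diffFn, LinearMap.sub_apply, LinearMap.coe_mk,
        AddHom.coe_mk, map_add, LinearMap.add_apply, Derivation.add_apply]
      ring)
    (fun c α β => by
      ext Y
      simp only [← π.apply_sharp, lieDer, diffFn, LinearMap.sub_apply, LinearMap.coe_mk,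
        AddHom.coe_mk, LinearMap.map_smul_of_tower, LinearMap.smul_apply, Derivation.smul_apply,
        Derivation.map_smul, smul_sub])
  anchor := A.anchor ∘ₗ π.sharp
  bracket_self α := by
    ext Y
    simp [LinearMap.mk₂_apply, ← π.apply_sharp, π.apply_sharp_self, diffFn]
  leibniz α β f := by
    ext Y
    simp only [LinearMap.mk₂_apply, ← π.apply_sharp, lieDer, diffFn, LinearMap.sub_apply,
      LinearMap.coe_mk, AddHom.coe_mk, LinearMap.smul_apply, LinearMap.add_apply, map_smul,
      smul_eq_mul, Derivation.smul_apply, Derivation.leibniz, LinearMap.comp_apply]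
    rw [A.bracket_swap (f • π.sharp β) Y, A.leibniz, A.bracket_swap Y (π.sharp β)]
    simp only [map_neg, map_add, map_smul, smul_eq_mul, smul_neg, π.apply_sharp_swap α β]
    ring

/-- `C_{π,N} = ([·,·]_N)_π - ([·,·]_π)_{ᵗN}`. -/
def concomitant (A : AlmostLieAlgebroid R B) (π : Bivector R B) (N : B →ₗ[R] B)
    (α β : Module.Dual R B) : Module.Dual R B :=
  ((A.deform N).cotangent π).bracket α β - ((A.cotangent π).deform N.dualMap).bracket α β

end AlmostLieAlgebroid

/-! ### Schouten brackets, Poisson bivectors and Lie quasi-bialgebroids -/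

section Schouten

variable {R B C : Type*} [CommRing R] [Algebra ℝ R] [AddCommGroup B] [Module R B]
  [Module ℝ B] [IsScalarTower ℝ R B] [AddCommGroup C] [Module R C]

/-- `br` is the Schouten bracket of the algebroid `A` with sections `B`, that is, the bracket of the
Gerstenhaber algebra `Γ(⋀^• A)`.  Here `C` is the module of sections of the dual bundle, and `pair`
is the pairing, so that `Γ(⋀^• A) = ExtForms R C`.  The Schouten bracket is the unique graded
skew-symmetric `ℝ`-bilinear operation of degree `-1` which is a graded derivation of the wedge
product in each argument and extends the bracket of sections and the anchor; it satisfies the graded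
Jacobi identity when `A` is a Lie algebroid. -/
structure IsSchoutenBracket (A : AlmostLieAlgebroid R B) (pair : B →ₗ[R] Module.Dual R C)
    (br : ExtForms R C →ₗ[ℝ] ExtForms R C →ₗ[ℝ] ExtForms R C) : Prop where
  degree : ∀ (p q : ℕ) (P : C [⋀^Fin p]→ₗ[R] R) (Q : C [⋀^Fin q]→ₗ[R] R) (n : ℕ),
    n + 1 ≠ p + q → br (homog p P) (homog q Q) n = 0
  skew : ∀ (p q : ℕ) (P : C [⋀^Fin p]→ₗ[R] R) (Q : C [⋀^Fin q]→ₗ[R] R),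
    br (homog p P) (homog q Q) =
      -((-1 : ℝ) ^ ((p + 1) * (q + 1)) • br (homog q Q) (homog p P))
  leibniz : ∀ (p q : ℕ) (P : C [⋀^Fin p]→ₗ[R] R) (Q : C [⋀^Fin q]→ₗ[R] R) (S : ExtForms R C),
    br (homog p P) (wedge (homog q Q) S) =
      wedge (br (homog p P) (homog q Q)) S +
        (-1 : ℝ) ^ ((p + 1) * q) • wedge (homog q Q) (br (homog p P) S)
  sections : ∀ X Y : B,
    br (form1 (pair X)) (form1 (pair Y)) = form1 (pair (A.bracket X Y))
  function : ∀ (X : B) (f : R), br (form1 (pair X)) (fn0 f) = fn0 (A.anchor X f)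

/-- `π` is a Poisson bivector: `[π, π] = 0` for the Schouten-Nijenhuis bracket on `Γ(⋀^• A)`. -/
def IsPoisson (A : AlmostLieAlgebroid R B) (π : Bivector R B) : Prop :=
  ∃ br : ExtForms R (Module.Dual R B) →ₗ[ℝ] ExtForms R (Module.Dual R B) →ₗ[ℝ]
      ExtForms R (Module.Dual R B),
    IsSchoutenBracket A (Module.Dual.eval R B) br ∧ br (homog 2 π.toForm) (homog 2 π.toForm) = 0

/-- `δ` is a degree one derivation of the wedge product. -/
structure IsDegreeOneDerivation (δ : ExtForms R C →ₗ[ℝ] ExtForms R C) : Prop where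
  degree : ∀ (p : ℕ) (P : C [⋀^Fin p]→ₗ[R] R) (n : ℕ), n ≠ p + 1 → δ (homog p P) n = 0
  leibniz : ∀ (p : ℕ) (P : C [⋀^Fin p]→ₗ[R] R) (S : ExtForms R C),
    δ (wedge (homog p P) S) =
      wedge (δ (homog p P)) S + (-1 : ℝ) ^ p • wedge (homog p P) (δ S)

/-- `(A, δ, φ)` is a Lie quasi-bialgebroid: `A` is a Lie algebroid, `δ` is a degree one derivation of
the Gerstenhaber algebra `(Γ(⋀^• A), ∧, [·,·])`, `δ² = [φ, ·]` and `δ φ = 0`. -/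
structure IsLieQuasiBialgebroid (A : AlmostLieAlgebroid R B) (pair : B →ₗ[R] Module.Dual R C)
    (δ : ExtForms R C →ₗ[ℝ] ExtForms R C) (φ : C [⋀^Fin 3]→ₗ[R] R) : Prop where
  isLie : A.IsLie
  derivation : IsDegreeOneDerivation δ
  bracket : ∃ br : ExtForms R C →ₗ[ℝ] ExtForms R C →ₗ[ℝ] ExtForms R C,
    IsSchoutenBracket A pair br ∧
    (∀ (p : ℕ) (P : C [⋀^Fin p]→ₗ[R] R) (S : ExtForms R C),
      δ (br (homog p P) S) =
        br (δ (homog p P)) S + (-1 : ℝ) ^ (p + 1) • br (homog p P) (δ S)) ∧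
    ∀ S : ExtForms R C, δ (δ S) = br (homog 3 φ) S
  closed : δ (homog 3 φ) = 0

/-- `(π, N, ψ, H)` is a Poisson quasi-Nijenhuis structure with background on `A`. -/
structure IsPoissonQuasiNijenhuis (A : AlmostLieAlgebroid R B) (π : Bivector R B)
    (N : B →ₗ[R] B) (ψ H : B [⋀^Fin 3]→ₗ[R] R) : Prop where
  comm : N ∘ₗ π.sharp = π.sharp ∘ₗ N.dualMap
  closed_psi : ∀ X, A.diff ψ X = 0
  closed_H : ∀ X, A.diff H X = 0
  poisson : IsPoisson A π
  concomitant : ∀ α β : Module.Dual R B,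
    A.concomitant π N α β = -(2 : R) • contract2 H (π.sharp α) (π.sharp β)
  torsion : ∀ X Y : B, A.torsion N X Y =
    π.sharp (contract2 H (N X) Y - contract2 H (N Y) X + contract2 ψ X Y)
  diff_psi : ∀ X, (A.deform N).diff ψ X =
    A.diff (fun Y : Fin 3 → B =>
      H ![N (Y 0), N (Y 1), Y 2] + H ![N (Y 1), N (Y 2), Y 0] + H ![N (Y 2), N (Y 0), Y 1]) X

/-- `δ = d_N^H`: the degree one derivation of `Γ(⋀^• A*)` with `δ f = d_N f` on functions and
`δ α = d_N α - i_{π♯α} H` on sections `α` of `A*`. -/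
structure IsTwistedDifferential (A : AlmostLieAlgebroid R B) (π : Bivector R B)
    (N : B →ₗ[R] B) (H : B [⋀^Fin 3]→ₗ[R] R) (δ : ExtForms R B →ₗ[ℝ] ExtForms R B) : Prop where
  derivation : IsDegreeOneDerivation δ
  function : ∀ f : R, δ (fn0 f) = form1 ((A.deform N).diffFn f)
  one_form : ∀ (α : Module.Dual R B) (X Y : B),
    δ (form1 α) 2 ![X, Y] =
      (A.deform N).diff (fun Z : Fin 1 → B => α (Z 0)) ![X, Y] - H ![π.sharp α, X, Y]

end Schouten

end

noncomputable section

/-! Everything is derived from two operations on `Γ(⋀^• A*)`. The first is the Koszul differential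
of a skew bracket with anchor satisfying the Leibniz rule; it is a degree one derivation of the
wedge product whether or not the Jacobi identity holds. The second is the pairing `π(P, Q)` of
degree `-2`, a graded derivation in each argument that extends `π` from `1`-forms. The graded
commutator `d π(P,Q) + π(dP,Q) - (-1)^p π(P,dQ)` has the properties of the Schouten bracket of
`A*_π` (`isSchoutenBracket_schouten`). The operator `d_N^H` is itself the Koszul differential,
written `δ` below, of the bracket `[X,Y]_N - π♯H(X,Y,·)` with anchor `ρ ∘ N` (`twist`,
`isTwistedDifferential_koszul`).

Hence both the failure of `δ` to be a derivation of the Schouten bracket and the difference `δ² -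
[φ,·]`, with `φ = ψ + i_N H`, are derivations of the wedge product, and it is enough that they
vanish on functions and `1`-forms (`derivation_eq_zero`). Forms are alternating maps on a module
that need not be free, so reduction to generators uses functions `χ` with `χX = ∑ ε_i(X) e_i`: on
`k`-forms, `∑ ε_i ∧ ι_{e_i}` is multiplication by `kχ`. Bump functions supported in trivialising
sets provide enough such `χ`.

On generators the structure equations enter one by one. The relation `Nπ♯ = π♯ᵗN`, the concomitant
equation and `dH = 0` make `δ` a derivation of the bracket (`twist_dOne_bracket`). The torsion
equation says exactly that `N` maps the twisted bracket to `[NX,NY] - π♯φ(X,Y,·)`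
(`map_twist_bracket`). This is `δ² = [φ,·]` on functions; together with the concomitant equation,
`dψ = 0` and `dH = 0` it computes the Jacobiator of the twisted bracket, which gives `δ² = [φ,·]` on
`1`-forms (`apply_twist_jacobi`). Finally `d_Nψ = dℋ` and `dH = 0` reduce `δφ = 0` to an identity
quadratic in the `3`-forms, which follows from skew-symmetry (`sharp_tri_add`).

That `A*_π` is a Lie algebroid is the classical fact that `[π,π] = 0` makes `π♯` bracket-preserving
(`sharp_bracket`). Since the given Schouten bracket is known only through its axioms, it is first
shown that `[π,·]` agrees with the Koszul differential of `A*_π` on functions and sections. -/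

namespace ExtForms

/-! ### Interior product and grading involution. -/

section Contract

variable {R V : Type*} [CommRing R] [AddCommGroup V] [Module R V]

theorem homog_self (k : ℕ) (η : V [⋀^Fin k]→ₗ[R] R) : homog k η k = η :=
  DirectSum.lof_apply (M := fun k => V [⋀^Fin k]→ₗ[R] R) R k η

theorem homog_ne {k n : ℕ} (h : k ≠ n) (η : V [⋀^Fin k]→ₗ[R] R) : homog k η n = 0 := by
  rw [DirectSum.apply_eq_component R, DirectSum.component.of, dif_neg h]

theorem induction_homog {p : ExtForms R V → Prop} (θ : ExtForms R V)
    (homog : ∀ k η, p (homog k η)) (add : ∀ θ η, p θ → p η → p (θ + η)) : p θ := by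
  induction θ using DirectSum.induction_on with
  | zero => simpa using homog 0 0
  | of k η => exact homog k η
  | add θ η hθ hη => exact add θ η hθ hη

/-- The interior product with values in the whole exterior algebra, on forms of degree `k`. -/
def contractHom : (k : ℕ) → V →ₗ[R] (V [⋀^Fin k]→ₗ[R] R) →ₗ[R] ExtForms R V
  | 0 => 0
  | k + 1 => (AlternatingMap.curryLeftLinearMap (R := R) (M := V) (N := R)).flip.compr₂
      (DirectSum.lof R ℕ (fun k => V [⋀^Fin k]→ₗ[R] R) k)

/-- The interior product `ι_X`. -/
def contract : V →ₗ[R] ExtForms R V →ₗ[R] ExtForms R V :=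
  (DirectSum.toModule R ℕ _ fun k => (contractHom k).flip).flip

theorem contract_homog_zero (X : V) (η : V [⋀^Fin 0]→ₗ[R] R) :
    contract X (homog 0 η) = 0 := by
  simp [contract, contractHom]

theorem contract_homog_succ (X : V) {k : ℕ} (η : V [⋀^Fin (k + 1)]→ₗ[R] R) :
    contract X (homog (k + 1) η) = homog k (η.curryLeft X) := by
  simp [contract, contractHom]

theorem contract_apply (X : V) (θ : ExtForms R V) (n : ℕ) :
    contract X θ n = (θ (n + 1)).curryLeft X := by
  induction θ using induction_homog with
  | homog k η =>
    cases k with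
    | zero => rw [contract_homog_zero, homog_ne (Nat.succ_ne_zero n).symm]; rfl
    | succ k =>
      rw [contract_homog_succ]
      by_cases h : k = n
      · subst h; rw [homog_self, homog_self]
      · rw [homog_ne h, homog_ne (by omega)]; rfl
  | add θ η h h' => simp only [map_add, DirectSum.add_apply, h, h']; rfl

theorem contract_apply_apply (X : V) (θ : ExtForms R V) (n : ℕ) (v : Fin n → V) :
    contract X θ n v = θ (n + 1) (Matrix.vecCons X v) := by
  rw [contract_apply]; rfl

theorem apply_succ_apply (θ : ExtForms R V) (n : ℕ) (v : Fin (n + 1) → V) :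
    θ (n + 1) v = contract (v 0) θ n (Fin.tail v) := by
  rw [contract_apply_apply]
  exact congrArg _ (Fin.cons_self_tail v).symm

/-- A component of positive degree is determined by its contractions. Most identities between forms
below are proved by induction on the degree through this lemma. -/
theorem component_succ_ext {θ η : ExtForms R V} {n : ℕ}
    (h : ∀ X, contract X θ n = contract X η n) : θ (n + 1) = η (n + 1) := by
  ext v
  rw [apply_succ_apply, apply_succ_apply, h]

theorem contract_contract_self (X : V) (θ : ExtForms R V) : contract X (contract X θ) = 0 := by
  refine DFinsupp.ext fun n => ?_
  rw [contract_apply, contract_apply]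
  exact AlternatingMap.curryLeft_same _ _

theorem contract_contract (X Y : V) (θ : ExtForms R V) :
    contract X (contract Y θ) = -contract Y (contract X θ) := by
  have h := contract_contract_self (X + Y) θ
  simp only [map_add, LinearMap.add_apply, contract_contract_self, zero_add, add_zero] at h
  exact eq_neg_of_add_eq_zero_right h

theorem contract_apply_of_mem (X : V) (θ : ExtForms R V) {n : ℕ} (v : Fin n → V) {j : Fin n}
    (h : v j = X) : contract X θ n v = 0 := by
  rw [contract_apply_apply]
  exact (θ (n + 1)).map_eq_zero_of_eq _ (i := 0) (j := j.succ) (by simpa using h.symm)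
    (Fin.succ_ne_zero j).symm

/-- The grading involution. -/
def parity : ExtForms R V →ₗ[R] ExtForms R V :=
  DirectSum.lmap fun k => ((-1 : R) ^ k) • LinearMap.id

theorem parity_apply (θ : ExtForms R V) (n : ℕ) : parity θ n = (-1 : R) ^ n • θ n := rfl

theorem parity_parity (θ : ExtForms R V) : parity (parity θ) = θ := by
  refine DFinsupp.ext fun n => ?_
  rw [parity_apply, parity_apply, smul_smul, ← mul_pow]; simp

theorem contract_parity (X : V) (θ : ExtForms R V) :
    contract X (parity θ) = -parity (contract X θ) := by
  refine DFinsupp.ext fun n => ?_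
  change _ = -(parity (contract X θ) n)
  rw [contract_apply, parity_apply, parity_apply, contract_apply, AlternatingMap.curryLeft_smul,
    LinearMap.smul_apply, pow_succ]
  simp

theorem parity_homog (k : ℕ) (η : V [⋀^Fin k]→ₗ[R] R) :
    parity (homog k η) = (-1 : R) ^ k • homog k η := by
  refine DFinsupp.ext fun n => ?_
  rw [parity_apply, DirectSum.smul_apply]
  by_cases h : k = n
  · subst h; rfl
  · rw [homog_ne h, smul_zero, smul_zero]

end Contract

/-! ### The interior product is an antiderivation of the wedge product. -/

section AltSum

open Equiv

variable {R V : Type*} [CommRing R]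

/-- The signed sum of `m (v ∘ σ)` over all permutations `σ`. -/
def altSum (n : ℕ) (m : (Fin n → V) → R) (v : Fin n → V) : R :=
  ∑ σ : Perm (Fin n), ((Perm.sign σ : ℤ) : R) * m (v ∘ σ)

/-- The permutation of `Fin (n + 1)` that sends `i` to `0` and acts as `e` between the
complements. -/
def consPerm {n : ℕ} (x : Fin (n + 1) × Perm (Fin n)) : Perm (Fin (n + 1)) :=
  Perm.decomposeFin.symm (0, x.2) * x.1.cycleRange

theorem consPerm_self {n : ℕ} (i : Fin (n + 1)) (e : Perm (Fin n)) : consPerm (i, e) i = 0 := by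
  simp [consPerm]

theorem consPerm_succAbove {n : ℕ} (i : Fin (n + 1)) (e : Perm (Fin n)) (j : Fin n) :
    consPerm (i, e) (i.succAbove j) = (e j).succ := by
  simp [consPerm]

theorem sign_consPerm {n : ℕ} (i : Fin (n + 1)) (e : Perm (Fin n)) :
    Perm.sign (consPerm (i, e)) = (-1) ^ (i : ℕ) * Perm.sign e := by
  simp [consPerm, mul_comm]

theorem consPerm_bijective (n : ℕ) : Function.Bijective (consPerm (n := n)) := by
  rw [Fintype.bijective_iff_injective_and_card]
  refine ⟨?_, ?_⟩
  · rintro ⟨i, e⟩ ⟨i', e'⟩ h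
    have hi : i = i' := by
      apply (consPerm (i, e)).injective
      rw [consPerm_self, h, consPerm_self]
    subst hi
    refine Prod.ext rfl (Equiv.ext fun j => Fin.succ_injective _ ?_)
    rw [← consPerm_succAbove i, h, consPerm_succAbove]
  · simp [Fintype.card_perm, Nat.factorial_succ]

/-- Expansion by the slot `i` that receives `X`: a permutation is determined by the index sent to
`0` and the permutation induced on the complements, and the cycle bringing `i` to the front has sign
`(-1)^i`. -/
theorem altSum_succ (n : ℕ) (m : (Fin (n + 1) → V) → R) (X : V) (w : Fin n → V) :
    altSum (n + 1) m (Matrix.vecCons X w) =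
      ∑ i : Fin (n + 1), (-1 : R) ^ (i : ℕ) * altSum n (fun u => m (i.insertNth X u)) w := by
  rw [altSum, ← (consPerm_bijective n).sum_comp, Fintype.sum_prod_type]
  refine Finset.sum_congr rfl fun i _ => ?_
  rw [altSum, Finset.mul_sum]
  refine Finset.sum_congr rfl fun e _ => ?_
  have : Matrix.vecCons X w ∘ consPerm (i, e) = i.insertNth X (w ∘ e) := by
    funext k
    rcases Fin.eq_self_or_eq_succAbove i k with rfl | ⟨j, rfl⟩
    · simp [consPerm_self]
    · simp [consPerm_succAbove]
  rw [this, sign_consPerm]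
  push_cast
  ring

end AltSum

section WedgeFormula

open Equiv

variable {R V : Type*} [CommRing R] [AddCommGroup V] [Module R V]

theorem wedge_homog (p q : ℕ) (P : V [⋀^Fin p]→ₗ[R] R) (Q : V [⋀^Fin q]→ₗ[R] R) :
    wedge (homog p P) (homog q Q) = homog (p + q) (wedgeHom p q P Q) := by
  simp [wedge]

/-- Each shuffle is counted `p! q!` times by the sum over all permutations. The full sum is easier
to expand than the sum over shuffles. -/
theorem factorial_smul_wedgeHom (p q : ℕ) (P : V [⋀^Fin p]→ₗ[R] R) (Q : V [⋀^Fin q]→ₗ[R] R)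
    (v : Fin (p + q) → V) :
    ((p.factorial * q.factorial : ℕ) : R) * wedgeHom p q P Q v =
      altSum (p + q) (fun u => P (u ∘ Fin.castAdd q) * Q (u ∘ Fin.natAdd p)) v := by
  have h := congrArg (fun m => LinearMap.mul' R R (m (v ∘ finSumFinEquiv)))
    (MultilinearMap.domCoprod_alternization_eq P Q)
  simp only [Fintype.card_fin, AlternatingMap.smul_apply, map_nsmul] at h
  have h1 : wedgeHom p q P Q v = LinearMap.mul' R R (P.domCoprod Q (v ∘ finSumFinEquiv)) := rfl
  rw [h1, ← nsmul_eq_mul, ← h, MultilinearMap.alternatization_apply, map_sum, altSum,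
    ← (finSumFinEquiv (m := p) (n := q)).permCongr.sum_comp]
  refine Finset.sum_congr rfl fun σ _ => ?_
  have h2 : ∀ x, (v ∘ finSumFinEquiv) (σ x) =
      (v ∘ (finSumFinEquiv (m := p) (n := q)).permCongr σ) (finSumFinEquiv x) := by
    intro x; simp [Equiv.permCongr_apply]
  rw [Units.smul_def, map_zsmul]
  simp only [Perm.sign_permCongr, MultilinearMap.domDomCongr_apply,
    MultilinearMap.domCoprod_apply, LinearMap.mul'_apply, zsmul_eq_mul, h2,
    AlternatingMap.coe_multilinearMap, finSumFinEquiv_apply_left, finSumFinEquiv_apply_right]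
  rfl

theorem factorial_smul_wedge (p q n : ℕ) (h : p + q = n) (P : V [⋀^Fin p]→ₗ[R] R)
    (Q : V [⋀^Fin q]→ₗ[R] R) (v : Fin n → V) :
    ((p.factorial * q.factorial : ℕ) : R) * wedge (homog p P) (homog q Q) n v =
      altSum n (fun u => P (fun i => u ⟨i, by omega⟩) * Q (fun j => u ⟨p + j, by omega⟩)) v := by
  subst h
  rw [wedge_homog, homog_self, factorial_smul_wedgeHom]
  rfl

theorem wedge_homog_ne {p q n : ℕ} (h : p + q ≠ n) (P : V [⋀^Fin p]→ₗ[R] R)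
    (Q : V [⋀^Fin q]→ₗ[R] R) : wedge (homog p P) (homog q Q) n = 0 := by
  rw [wedge_homog, homog_ne h]

/-- The terms with `X` in a slot of `P`. Moving `X` to the front of `P` cancels the sign `(-1)^i`,
so the `p` terms are equal and turn `(p-1)!` into `p!`. -/
theorem sum_neg_one_pow_altSum_left (p q n : ℕ) (h : p + q = n + 1) (P : V [⋀^Fin p]→ₗ[R] R)
    (Q : V [⋀^Fin q]→ₗ[R] R) (X : V) (w : Fin n → V) :
    ∑ i : Fin p, (-1 : R) ^ (i : ℕ) * altSum n (fun u =>
      P (fun k => (⟨i, by omega⟩ : Fin (n + 1)).insertNth (α := fun _ => V) X u ⟨k, by omega⟩) *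
      Q (fun k => (⟨i, by omega⟩ : Fin (n + 1)).insertNth (α := fun _ => V) X u ⟨p + k, by
        omega⟩)) w =
    ((p.factorial * q.factorial : ℕ) : R) *
      wedge (contract X (homog p P)) (homog q Q) n w := by
  cases p with
  | zero => simp [contract_homog_zero]
  | succ p =>
    have hn : p + q = n := by omega
    rw [contract_homog_succ, Nat.factorial_succ, mul_assoc, Nat.cast_mul, mul_assoc,
      factorial_smul_wedge p q n hn, ← nsmul_eq_mul]
    conv_rhs => rw [← Fintype.card_fin (p + 1), ← Finset.card_univ, ← Finset.sum_const]
    refine Finset.sum_congr rfl fun i _ => ?_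
    rw [altSum, altSum, Finset.mul_sum]
    refine Finset.sum_congr rfl fun e _ => ?_
    set u := w ∘ e
    have hP : (fun k : Fin (p + 1) =>
        (⟨i, by omega⟩ : Fin (n + 1)).insertNth (α := fun _ => V) X u ⟨k, by omega⟩) =
        i.insertNth X (fun k => u ⟨k, by omega⟩) := by
      funext k
      rcases Fin.eq_self_or_eq_succAbove i k with rfl | ⟨j, rfl⟩
      · simp
      · rw [Fin.insertNth_apply_succAbove]
        convert Fin.insertNth_apply_succAbove (α := fun _ => V) (⟨i, by omega⟩ : Fin (n + 1)) X u
          ⟨j, by omega⟩ using 2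
        simp only [Fin.succAbove, Fin.lt_def, Fin.ext_iff, Fin.val_castSucc]
        split_ifs <;> simp
    have hQ : (fun k : Fin q =>
        (⟨i, by omega⟩ : Fin (n + 1)).insertNth (α := fun _ => V) X u ⟨p + 1 + k, by omega⟩) =
        fun k : Fin q => u ⟨p + k, by omega⟩ := by
      funext k
      convert Fin.insertNth_apply_succAbove (α := fun _ => V) (⟨i, by omega⟩ : Fin (n + 1)) X u
          ⟨p + k, by omega⟩ using 2
      simp only [Fin.succAbove, Fin.lt_def, Fin.ext_iff, Fin.val_castSucc]
      split_ifs <;> simp <;> omega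
    rw [hP, hQ, P.map_insertNth, AlternatingMap.curryLeft_apply_apply]
    have h1 : (-1 : R) ^ (i : ℕ) * (-1 : R) ^ (i : ℕ) = 1 := by rw [← mul_pow]; simp
    simp only [zsmul_eq_mul]
    push_cast
    linear_combination (((Perm.sign e : ℤ) : R) * (P (Matrix.vecCons X fun k => u ⟨k, by omega⟩) *
      Q fun k => u ⟨p + k, by omega⟩)) * h1

/-- The terms with `X` in a slot of `Q`. Here the sign `(-1)^p` from passing over `P` survives, and
becomes `parity`. -/
theorem sum_neg_one_pow_altSum_right (p q n : ℕ) (h : p + q = n + 1) (P : V [⋀^Fin p]→ₗ[R] R)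
    (Q : V [⋀^Fin q]→ₗ[R] R) (X : V) (w : Fin n → V) :
    ∑ i : Fin q, (-1 : R) ^ (p + i : ℕ) * altSum n (fun u =>
      P (fun k => (⟨p + i, by omega⟩ : Fin (n + 1)).insertNth (α := fun _ => V) X u ⟨k, by omega⟩) *
      Q (fun k => (⟨p + i, by omega⟩ : Fin (n + 1)).insertNth (α := fun _ => V) X u
        ⟨p + k, by omega⟩)) w =
    ((p.factorial * q.factorial : ℕ) : R) *
      wedge (parity (homog p P)) (contract X (homog q Q)) n w := by
  cases q with
  | zero => simp [contract_homog_zero]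
  | succ q =>
    have hn : p + q = n := by omega
    rw [contract_homog_succ, Nat.factorial_succ, mul_left_comm, Nat.cast_mul, mul_assoc,
      parity_homog, map_smul, LinearMap.smul_apply, DirectSum.smul_apply, AlternatingMap.smul_apply,
      smul_eq_mul, mul_left_comm _ ((-1 : R) ^ p), factorial_smul_wedge p q n hn, ← nsmul_eq_mul]
    conv_rhs => rw [← Fintype.card_fin (q + 1), ← Finset.card_univ, ← Finset.sum_const]
    refine Finset.sum_congr rfl fun i _ => ?_
    rw [altSum, altSum, Finset.mul_sum, Finset.mul_sum]
    refine Finset.sum_congr rfl fun e _ => ?_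
    set u := w ∘ e
    have hQ : (fun k : Fin (q + 1) =>
        (⟨p + i, by omega⟩ : Fin (n + 1)).insertNth (α := fun _ => V) X u ⟨p + k, by omega⟩) =
        i.insertNth X (fun k => u ⟨p + k, by omega⟩) := by
      funext k
      rcases Fin.eq_self_or_eq_succAbove i k with rfl | ⟨j, rfl⟩
      · simp
      · rw [Fin.insertNth_apply_succAbove]
        convert Fin.insertNth_apply_succAbove (α := fun _ => V) (⟨p + i, by omega⟩ : Fin (n + 1))
          X u
          ⟨p + j, by omega⟩ using 2
        simp only [Fin.succAbove, Fin.lt_def, Fin.ext_iff, Fin.val_castSucc]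
        split_ifs <;> simp_all <;> omega
    have hP : (fun k : Fin p =>
        (⟨p + i, by omega⟩ : Fin (n + 1)).insertNth (α := fun _ => V) X u ⟨k, by omega⟩) =
        fun k : Fin p => u ⟨k, by omega⟩ := by
      funext k
      convert Fin.insertNth_apply_succAbove (α := fun _ => V) (⟨p + i, by omega⟩ : Fin (n + 1)) X u
          ⟨k, by omega⟩ using 2
      simp only [Fin.succAbove, Fin.lt_def, Fin.ext_iff, Fin.val_castSucc]
      split_ifs <;> simp_all
      omega
    rw [hP, hQ, Q.map_insertNth, AlternatingMap.curryLeft_apply_apply]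
    have h1 : (-1 : R) ^ (i : ℕ) * (-1 : R) ^ (i : ℕ) = 1 := by rw [← mul_pow]; simp
    simp only [zsmul_eq_mul, pow_add]
    push_cast
    linear_combination (-1) ^ p * (((Perm.sign e : ℤ) : R) * (P (fun k => u ⟨k, by omega⟩) *
      Q (Matrix.vecCons X fun k => u ⟨p + k, by omega⟩))) * h1

end WedgeFormula

section WedgeContract

variable {R V : Type*} [CommRing R] [Algebra ℝ R] [AddCommGroup V] [Module R V]

/-- Nonzero integers are invertible in an `ℝ`-algebra. This removes the factorials, the degrees in
the Euler identity and the factors `2` that occur below. -/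
theorem natCast_mul_left_cancel {m : ℕ} (hm : m ≠ 0) {a b : R} (h : (m : R) * a = m * b) :
    a = b := by
  have hm' : (m : ℝ) ≠ 0 := Nat.cast_ne_zero.2 hm
  have h1 : algebraMap ℝ R (m : ℝ)⁻¹ * (m : R) = 1 := by
    rw [← map_natCast (algebraMap ℝ R), ← map_mul, inv_mul_cancel₀ hm', map_one]
  calc a = algebraMap ℝ R (m : ℝ)⁻¹ * (m * a) := by rw [← mul_assoc, h1, one_mul]
    _ = b := by rw [h, ← mul_assoc, h1, one_mul]

/-- The interior product is an antiderivation of the wedge product. -/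
theorem contract_wedge (X : V) (P Q : ExtForms R V) :
    contract X (wedge P Q) = wedge (contract X P) Q + wedge (parity P) (contract X Q) := by
  induction P using induction_homog with
  | add P P' h h' =>
    simp only [map_add, LinearMap.add_apply, h, h']; abel
  | homog p P =>
  induction Q using induction_homog with
  | add Q Q' h h' =>
    simp only [map_add, h, h']; abel
  | homog q Q =>
  refine DFinsupp.ext fun n => ?_
  rw [contract_apply]
  by_cases h : p + q = n + 1
  · ext w
    have hf : p.factorial * q.factorial ≠ 0 :=
      mul_ne_zero (Nat.factorial_ne_zero p) (Nat.factorial_ne_zero q)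
    apply natCast_mul_left_cancel hf
    rw [AlternatingMap.curryLeft_apply_apply, factorial_smul_wedge p q (n + 1) h, altSum_succ]
    change _ = _ * ((wedge (contract X (homog p P)) (homog q Q)) n w +
      (wedge (parity (homog p P)) (contract X (homog q Q))) n w)
    -- The `p + q` positions of `X` split into the slots of `P` and those of `Q`.
    rw [mul_add, ← sum_neg_one_pow_altSum_left p q n h, ← sum_neg_one_pow_altSum_right p q n h,
      ← (finCongr h).sum_comp, ← finSumFinEquiv.sum_comp, Fintype.sum_sum_type]
    simp only [finSumFinEquiv_apply_left, finSumFinEquiv_apply_right, finCongr_apply]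
    rfl
  · change _ = (wedge (contract X (homog p P)) (homog q Q)) n +
      (wedge (parity (homog p P)) (contract X (homog q Q))) n
    rw [wedge_homog_ne h, parity_homog, map_smul, LinearMap.smul_apply, DirectSum.smul_apply]
    have h1 : wedge (contract X (homog p P)) (homog q Q) n = 0 := by
      cases p with
      | zero => simp [contract_homog_zero]
      | succ p => rw [contract_homog_succ, wedge_homog_ne (by omega)]
    have h2 : wedge (homog p P) (contract X (homog q Q)) n = 0 := by
      cases q with
      | zero => simp [contract_homog_zero]
      | succ q => rw [contract_homog_succ, wedge_homog_ne (by omega)]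
    rw [h1, h2]
    simp

end WedgeContract

end ExtForms

/-! ### Functions and `1`-forms in the exterior algebra, and assembling forms from components. -/

namespace ExtForms

section Generators

variable {R V : Type*} [CommRing R] [AddCommGroup V] [Module R V]

theorem fn0_zero (f : R) (v : Fin 0 → V) : fn0 f 0 v = f := by
  rw [fn0, homog_self]; rfl

theorem contract_fn0 (X : V) (f : R) : contract X (fn0 f) = 0 := contract_homog_zero X _

theorem form1_zero (α : Module.Dual R V) : form1 α 0 = 0 := homog_ne one_ne_zero _

theorem form1_one (α : Module.Dual R V) (v : Fin 1 → V) : form1 α 1 v = α (v 0) := by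
  rw [form1, homog_self]; rfl

theorem contract_form1 (X : V) (α : Module.Dual R V) : contract X (form1 α) = fn0 (α X) := by
  rw [form1, contract_homog_succ, fn0]; congr 1

theorem parity_fn0 (f : R) : parity (fn0 f : ExtForms R V) = fn0 f := by
  rw [fn0, parity_homog, pow_zero, one_smul]

theorem neg_component (θ : ExtForms R V) (n : ℕ) : (-θ) n = -θ n := rfl

theorem neg_one_smul_eq (θ : ExtForms R V) : (-1 : R) • θ = -θ := by
  refine DFinsupp.ext fun n => ?_
  rw [DirectSum.smul_apply, neg_component, neg_one_smul]

theorem wedge_neg_left (P Q : ExtForms R V) : wedge (-P) Q = -wedge P Q := by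
  rw [← neg_one_smul_eq, map_smul, LinearMap.smul_apply, neg_one_smul_eq]

theorem wedge_sub_left (P P' Q : ExtForms R V) : wedge (P - P') Q = wedge P Q - wedge P' Q := by
  rw [sub_eq_add_neg, map_add, LinearMap.add_apply, wedge_neg_left, sub_eq_add_neg]

theorem contract_neg_left (X : V) (P : ExtForms R V) : contract (-X) P = -contract X P := by
  rw [← neg_one_smul R, map_smul, LinearMap.smul_apply, neg_one_smul_eq]

theorem contract_sub_left (X Y : V) (P : ExtForms R V) :
    contract (X - Y) P = contract X P - contract Y P := by
  rw [sub_eq_add_neg, map_add, LinearMap.add_apply, contract_neg_left, sub_eq_add_neg]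

theorem parity_form1 (α : Module.Dual R V) : parity (form1 α) = -form1 α := by
  rw [form1, parity_homog, pow_one, neg_one_smul_eq]

theorem form1_add (α β : Module.Dual R V) : form1 (α + β) = form1 α + form1 β := by
  rw [form1, form1, form1, ← map_add]; rfl

theorem form1_smul (f : R) (α : Module.Dual R V) : form1 (f • α) = f • form1 α := by
  rw [form1, form1, ← map_smul]; rfl

theorem fn0_add (f g : R) : (fn0 (f + g) : ExtForms R V) = fn0 f + fn0 g := by
  rw [fn0, fn0, fn0, ← map_add]; rfl

theorem fn0_smul (f g : R) : (fn0 (f * g) : ExtForms R V) = f • fn0 g := by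
  rw [fn0, fn0, ← map_smul]; rfl

theorem form1_neg (α : Module.Dual R V) : form1 (-α) = -form1 α := by
  rw [← neg_one_smul R, form1_smul, neg_one_smul_eq]

theorem fn0_neg (f : R) : (fn0 (-f) : ExtForms R V) = -fn0 f := by
  rw [← neg_one_mul, fn0_smul, neg_one_smul_eq]

theorem form1_sub (α β : Module.Dual R V) : form1 (α - β) = form1 α - form1 β := by
  rw [sub_eq_add_neg, form1_add, form1_neg, sub_eq_add_neg]

theorem homog_zero_eq (η : V [⋀^Fin 0]→ₗ[R] R) : homog 0 η = fn0 (η ![]) := by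
  rw [fn0]; congr 1; ext v; simp [Subsingleton.elim v ![]]

theorem ext_contract {θ η : ExtForms R V} (h0 : θ 0 = η 0)
    (h : ∀ X, contract X θ = contract X η) : θ = η := by
  refine DFinsupp.ext fun n => ?_
  cases n with
  | zero => exact h0
  | succ n => exact component_succ_ext fun X => by rw [h X]

theorem wedge_zero_apply (P Q : ExtForms R V) (v : Fin 0 → V) :
    wedge P Q 0 v = P 0 v * Q 0 v := by
  induction P using induction_homog with
  | add P P' h h' =>
    simp only [map_add, LinearMap.add_apply, DirectSum.add_apply, AlternatingMap.add_apply, h, h',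
      add_mul]
  | homog p P =>
  induction Q using induction_homog with
  | add Q Q' h h' =>
    simp only [map_add, DirectSum.add_apply, AlternatingMap.add_apply, h, h', mul_add]
  | homog q Q =>
  by_cases h : p + q = 0
  · obtain ⟨rfl, rfl⟩ : p = 0 ∧ q = 0 := by omega
    have := factorial_smul_wedge 0 0 0 rfl P Q v
    rw [Nat.factorial_zero, mul_one, Nat.cast_one, one_mul] at this
    rw [this, homog_self, homog_self]
    simp only [altSum, Finset.univ_unique, Finset.sum_singleton, Equiv.Perm.default_eq,
      Equiv.Perm.sign_one]
    rw [Units.val_one, Int.cast_one, one_mul]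
    congr 2
    exact Subsingleton.elim _ _
  · rw [wedge_homog_ne h]
    rcases Nat.eq_zero_or_pos p with rfl | hp
    · rw [homog_ne (k := q) (by omega)]; simp
    · rw [homog_ne (k := p) (by omega)]; simp

theorem form1_wedge_zero (α : Module.Dual R V) (Q : ExtForms R V) :
    wedge (form1 α) Q 0 = 0 := by
  ext v
  rw [wedge_zero_apply, form1_zero]; simp

end Generators

section Products

variable {R V : Type*} [CommRing R] [Algebra ℝ R] [AddCommGroup V] [Module R V]

theorem fn0_wedge (f : R) (Q : ExtForms R V) : wedge (fn0 f) Q = f • Q := by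
  refine DFinsupp.ext fun n => ?_
  induction n generalizing Q with
  | zero =>
    ext v
    rw [wedge_zero_apply, fn0_zero]; rfl
  | succ n ih =>
    refine component_succ_ext fun X => ?_
    rw [contract_wedge, contract_fn0, parity_fn0, map_zero, LinearMap.zero_apply, zero_add, ih,
      map_smul]

theorem contract_form1_wedge (X : V) (α : Module.Dual R V) (Q : ExtForms R V) :
    contract X (wedge (form1 α) Q) = α X • Q - wedge (form1 α) (contract X Q) := by
  rw [contract_wedge, contract_form1, fn0_wedge, parity_form1, wedge_neg_left,
    sub_eq_add_neg]

instance : IsScalarTower ℝ R (ExtForms R V) where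
  smul_assoc c f θ := by
    refine DFinsupp.ext fun n => ?_
    exact AlternatingMap.ext fun v => smul_assoc c f (θ n v)

theorem neg_one_pow_real_smul (p : ℕ) (θ : ExtForms R V) :
    (-1 : ℝ) ^ p • θ = (-1 : R) ^ p • θ := by
  rcases Nat.even_or_odd p with h | h
  · rw [h.neg_one_pow, h.neg_one_pow, one_smul, one_smul]
  · rw [h.neg_one_pow, h.neg_one_pow, neg_one_smul_eq]
    refine DFinsupp.ext fun n => ?_
    exact neg_one_smul ℝ (θ n)

end Products

section Assembly

variable {R V : Type*} [CommRing R] [AddCommGroup V] [Module R V]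

/-- The element of the exterior algebra with given components, finitely many of them nonzero. -/
def ofComponents (f : ∀ n, V [⋀^Fin n]→ₗ[R] R) (h : ∃ m, ∀ n, m ≤ n → f n = 0) : ExtForms R V :=
  DirectSum.mk (fun n => V [⋀^Fin n]→ₗ[R] R) (Finset.range h.choose) fun i => f i

theorem ofComponents_apply (f : ∀ n, V [⋀^Fin n]→ₗ[R] R) (h : ∃ m, ∀ n, m ≤ n → f n = 0) (n : ℕ) :
    ofComponents f h n = f n := by
  by_cases hn : n ∈ Finset.range h.choose
  · exact DirectSum.mk_apply_of_mem hn
  · rw [h.choose_spec n (by simpa using hn)]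
    exact DirectSum.mk_apply_of_notMem hn

/-- The alternating map in `n + 1` variables with given contractions. -/
def consAlt {n : ℕ} (F : V →ₗ[R] V [⋀^Fin n]→ₗ[R] R)
    (hF : ∀ (Y : V) (v : Fin n → V) (j : Fin n), v j = Y → F Y v = 0) :
    V [⋀^Fin (n + 1)]→ₗ[R] R where
  toMultilinearMap := LinearMap.uncurryLeft (AlternatingMap.toMultilinearMapLM (R := R) (S := R)
    ∘ₗ F)
  map_eq_zero_of_eq' v i j hv hij := by
    change F (v 0) (Fin.tail v) = 0
    induction i using Fin.cases with
    | zero =>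
      induction j using Fin.cases with
      | zero => exact absurd rfl hij
      | succ j => exact hF _ _ j hv.symm
    | succ i =>
      induction j using Fin.cases with
      | zero => exact hF _ _ i hv
      | succ j => exact (F (v 0)).map_eq_zero_of_eq _ hv (fun h => hij (h ▸ rfl))

theorem consAlt_apply {n : ℕ} (F : V →ₗ[R] V [⋀^Fin n]→ₗ[R] R)
    (hF : ∀ (Y : V) (v : Fin n → V) (j : Fin n), v j = Y → F Y v = 0) (v : Fin (n + 1) → V) :
    consAlt F hF v = F (v 0) (Fin.tail v) := rfl

end Assembly

end ExtForms

/-! ### Lie derivative and Koszul differential of a skew bracket. -/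

namespace AlmostLieAlgebroid

open ExtForms

variable {R B : Type*} [CommRing R] [Algebra ℝ R] [AddCommGroup B] [Module R B]
  [Module ℝ B] [IsScalarTower ℝ R B] (A : AlmostLieAlgebroid R B)

theorem bracket_smul_left (f : R) (X Y : B) :
    A.bracket (f • X) Y = f • A.bracket X Y - A.anchor Y f • X := by
  rw [A.bracket_swap, A.leibniz, A.bracket_swap Y X, smul_neg]; abel

theorem sum_update_bracket_update (X : B) {k : ℕ} (η : B [⋀^Fin k]→ₗ[R] R) (v : Fin k → B)
    (i : Fin k) (z : B) :
    ∑ j, η (Function.update (Function.update v i z) j (A.bracket X (Function.update v i z j))) =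
      η (Function.update v i (A.bracket X z)) + ∑ j ∈ Finset.univ.erase i,
        η (Function.update (Function.update v j (A.bracket X (v j))) i z) := by
  rw [← Finset.add_sum_erase _ _ (Finset.mem_univ i)]
  congr 1
  · simp
  · refine Finset.sum_congr rfl fun j hj => ?_
    have hj := Finset.ne_of_mem_erase hj
    rw [Function.update_of_ne hj, Function.update_comm hj]

/-- The Lie derivative of a `k`-form. -/
def lieForm (X : B) {k : ℕ} (η : B [⋀^Fin k]→ₗ[R] R) : B [⋀^Fin k]→ₗ[R] R where
  toFun v := A.anchor X (η v) - ∑ i, η (Function.update v i (A.bracket X (v i)))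
  map_update_add' := by
    intro inst v i x y
    rw [Subsingleton.elim inst (instDecidableEqFin k)]
    simp only [A.sum_update_bracket_update, η.map_update_add, map_add, Finset.sum_add_distrib]
    ring
  map_update_smul' := by
    intro inst v i c x
    rw [Subsingleton.elim inst (instDecidableEqFin k)]
    simp only [A.sum_update_bracket_update, η.map_update_add, η.map_update_smul, A.leibniz,
      smul_eq_mul, Derivation.leibniz,
      ← Finset.mul_sum]
    ring
  map_eq_zero_of_eq' v i j hv hij := by
    change A.anchor X (η v) - ∑ i, η (Function.update v i (A.bracket X (v i))) = 0
    rw [η.map_eq_zero_of_eq v hv hij, map_zero, Finset.sum_eq_add i j hij, zero_sub, neg_eq_zero]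
    · rw [← η.map_swap_add _ hij, add_comm]
      congr 2
      funext m
      by_cases h1 : m = i
      · subst h1; simp [hv, hij, hij.symm, Equiv.swap_apply_left]
      · by_cases h2 : m = j
        · subst h2; simp [hv, Equiv.swap_apply_right]
        · simp [Equiv.swap_apply_of_ne_of_ne h1 h2, h1, h2]
    · rintro c - ⟨h1, h2⟩
      exact η.map_eq_zero_of_eq _ (by simp [h1.symm, h2.symm, hv]) hij
    · simp
    · simp

theorem lieForm_apply (X : B) {k : ℕ} (η : B [⋀^Fin k]→ₗ[R] R) (v : Fin k → B) :
    A.lieForm X η v = A.anchor X (η v) - ∑ i, η (Function.update v i (A.bracket X (v i))) := rfl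

/-- The Lie derivative on the exterior algebra. -/
def lie (X : B) : ExtForms R B →ₗ[ℝ] ExtForms R B :=
  DirectSum.lmap fun _ =>
    { toFun := A.lieForm X
      map_add' := fun η η' => by
        ext v
        simp only [lieForm_apply, AlternatingMap.add_apply, map_add, Finset.sum_add_distrib]
        ring
      map_smul' := fun c η => by
        ext v
        simp only [lieForm_apply, AlternatingMap.smul_apply, Derivation.map_smul, RingHom.id_apply,
          smul_sub, Finset.smul_sum] }

theorem lie_apply (X : B) (θ : ExtForms R B) (n : ℕ) (v : Fin n → B) :
    A.lie X θ n v = A.anchor X (θ n v) - ∑ i, θ n (Function.update v i (A.bracket X (v i))) := rfl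

theorem lie_zero_apply (X : B) (θ : ExtForms R B) (v : Fin 0 → B) :
    A.lie X θ 0 v = A.anchor X (θ 0 v) := by
  simp [lie_apply]

theorem contract_lie (X Y : B) (θ : ExtForms R B) :
    contract Y (A.lie X θ) = A.lie X (contract Y θ) - contract (A.bracket X Y) θ := by
  refine DFinsupp.ext fun n => ?_
  rw [DirectSum.sub_apply]
  ext v
  rw [AlternatingMap.sub_apply, contract_apply_apply, lie_apply, lie_apply, contract_apply_apply,
    contract_apply_apply, Fin.sum_univ_succ]
  have h0 : Function.update (Matrix.vecCons Y v) 0 (A.bracket X (Matrix.vecCons Y v 0)) =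
      Matrix.vecCons (A.bracket X Y) v := Fin.update_cons_zero (α := fun _ => B) Y v _
  have h1 : ∀ i : Fin n, Function.update (Matrix.vecCons Y v) i.succ
      (A.bracket X (Matrix.vecCons Y v i.succ)) =
      Matrix.vecCons Y (Function.update v i (A.bracket X (v i))) := fun i =>
    (Fin.cons_update (α := fun _ => B) Y v i _).symm
  simp only [h0, h1, contract_apply_apply]
  ring

theorem lie_smul (X : B) (f : R) (θ : ExtForms R B) :
    A.lie X (f • θ) = A.anchor X f • θ + f • A.lie X θ := by
  refine DFinsupp.ext fun n => ?_
  rw [DirectSum.add_apply]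
  ext v
  rw [AlternatingMap.add_apply, lie_apply]
  simp only [DirectSum.smul_apply, AlternatingMap.smul_apply, lie_apply, smul_eq_mul,
    Derivation.leibniz, ← Finset.mul_sum]
  ring

theorem lie_add_left (X Y : B) (θ : ExtForms R B) :
    A.lie (X + Y) θ = A.lie X θ + A.lie Y θ := by
  refine DFinsupp.ext fun n => ?_
  rw [DirectSum.add_apply]
  ext v
  simp only [AlternatingMap.add_apply, lie_apply, map_add, LinearMap.add_apply,
    Derivation.add_apply, (θ n).map_update_add, Finset.sum_add_distrib]
  ring

theorem lie_smul_left (f : R) (X : B) (θ : ExtForms R B) :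
    A.lie (f • X) θ = f • A.lie X θ + wedge (form1 (A.diffFn f)) (contract X θ) := by
  refine DFinsupp.ext fun n => ?_
  induction n generalizing θ with
  | zero =>
    rw [DirectSum.add_apply, form1_wedge_zero, add_zero, DirectSum.smul_apply]
    ext v
    rw [AlternatingMap.smul_apply, lie_zero_apply, lie_zero_apply]
    simp
  | succ n ih =>
    refine component_succ_ext fun Y => ?_
    have e : A.diffFn f Y = A.anchor Y f := rfl
    rw [contract_lie, DirectSum.sub_apply, bracket_smul_left, ih, map_add, map_smul (contract Y),
      contract_lie, contract_form1_wedge, contract_contract Y X]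
    simp only [contract_sub_left, map_smul, LinearMap.smul_apply, DirectSum.add_apply,
      DirectSum.sub_apply, DirectSum.smul_apply, smul_sub, map_neg, neg_component, e]
    abel

theorem parity_lie (X : B) (θ : ExtForms R B) : parity (A.lie X θ) = A.lie X (parity θ) := by
  refine DFinsupp.ext fun n => ?_
  ext v
  rcases neg_one_pow_eq_or R n with h | h <;>
    simp [parity_apply, lie_apply, h]
  ring

theorem lie_wedge (X : B) (P Q : ExtForms R B) :
    A.lie X (wedge P Q) = wedge (A.lie X P) Q + wedge P (A.lie X Q) := by
  refine DFinsupp.ext fun n => ?_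
  induction n generalizing P Q with
  | zero =>
    ext v
    rw [DirectSum.add_apply, AlternatingMap.add_apply, lie_zero_apply, wedge_zero_apply,
      wedge_zero_apply, wedge_zero_apply, lie_zero_apply, lie_zero_apply, Derivation.leibniz,
      smul_eq_mul, smul_eq_mul]
    ring
  | succ n ih =>
    refine component_succ_ext fun Y => ?_
    simp only [contract_lie, contract_wedge, map_add, DirectSum.add_apply, DirectSum.sub_apply, ih,
      wedge_sub_left, map_sub, parity_lie]
    abel

/-- The component of degree `n` of the Koszul differential, with the properties that are needed for
the construction of the next component. -/
structure KoszulComponent (n : ℕ) where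
  toMap : ExtForms R B →ₗ[ℝ] B [⋀^Fin n]→ₗ[R] R
  map_smul : ∀ f θ, toMap (f • θ) = f • toMap θ + wedge (form1 (A.diffFn f)) θ n
  alt : ∀ Y θ (v : Fin n → B) j, v j = Y → toMap (contract Y θ) v = A.lie Y θ n v

/-- The Koszul differential vanishes in degree `0`. -/
def koszulComponentZero : KoszulComponent A 0 where
  toMap := 0
  map_smul f θ := by simp [form1_wedge_zero]
  alt Y θ v j := j.elim0

variable {A} in
/-- The recursion `ι_Y d = L_Y - d ι_Y`. -/
def KoszulComponent.succ {n : ℕ} (D : KoszulComponent A n) : KoszulComponent A (n + 1) where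
  toMap :=
    { toFun := fun θ => consAlt
        { toFun := fun Y => A.lie Y θ n - D.toMap (contract Y θ)
          map_add' := fun Y Z => by
            rw [A.lie_add_left, map_add, LinearMap.add_apply, map_add, DirectSum.add_apply]; abel
          map_smul' := fun f Y => by
            rw [A.lie_smul_left, _root_.map_smul, LinearMap.smul_apply, D.map_smul,
              DirectSum.add_apply,
              DirectSum.smul_apply, RingHom.id_apply, smul_sub]; abel }
        (fun Y v j h => by
          change A.lie Y θ n v - D.toMap (contract Y θ) v = 0
          rw [D.alt Y θ v j h, sub_self])
      map_add' := fun θ η => by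
        ext v
        change A.lie (v 0) (θ + η) n (Fin.tail v) - D.toMap (contract (v 0) (θ + η)) (Fin.tail v) =
          (A.lie (v 0) θ n (Fin.tail v) - D.toMap (contract (v 0) θ) (Fin.tail v)) +
          (A.lie (v 0) η n (Fin.tail v) - D.toMap (contract (v 0) η) (Fin.tail v))
        simp only [map_add, DirectSum.add_apply, AlternatingMap.add_apply]
        ring
      map_smul' := fun c θ => by
        ext v
        change A.lie (v 0) (c • θ) n (Fin.tail v) - D.toMap (contract (v 0) (c • θ)) (Fin.tail v) =
          c • (A.lie (v 0) θ n (Fin.tail v) - D.toMap (contract (v 0) θ) (Fin.tail v))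
        rw [_root_.map_smul, LinearMap.map_smul_of_tower, _root_.map_smul, smul_sub]
        rfl }
  map_smul f θ := by
    ext v
    change A.lie (v 0) (f • θ) n (Fin.tail v) - D.toMap (contract (v 0) (f • θ)) (Fin.tail v) =
      f • (A.lie (v 0) θ n (Fin.tail v) - D.toMap (contract (v 0) θ) (Fin.tail v)) +
      wedge (form1 (A.diffFn f)) θ (n + 1) v
    have e : A.diffFn f (v 0) = A.anchor (v 0) f := rfl
    rw [apply_succ_apply, contract_form1_wedge, A.lie_smul, _root_.map_smul, D.map_smul, e]
    simp only [DirectSum.add_apply, DirectSum.sub_apply, DirectSum.smul_apply,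
      AlternatingMap.add_apply, AlternatingMap.sub_apply, AlternatingMap.smul_apply, smul_eq_mul]
    ring
  alt Y θ v j h := by
    change A.lie (v 0) (contract Y θ) n (Fin.tail v) -
      D.toMap (contract (v 0) (contract Y θ)) (Fin.tail v) = _
    rw [apply_succ_apply, contract_lie, DirectSum.sub_apply, AlternatingMap.sub_apply]
    induction j using Fin.cases with
    | zero => rw [h, contract_contract_self, map_zero, A.bracket_self, map_zero]; rfl
    | succ j =>
      have hj : Fin.tail v j = Y := h
      -- After the two contractions are exchanged, `Y` still occurs among the remaining arguments,
      -- so the property in degree `n` applies; what is left is `[L, ι]` evaluated where `Y` is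
      -- repeated.
      rw [contract_contract, map_neg, AlternatingMap.neg_apply, D.alt Y _ _ j hj,
        A.bracket_swap Y (v 0), contract_neg_left, neg_component, AlternatingMap.neg_apply]
      have h1 := congrArg (fun θ => θ n (Fin.tail v)) (A.contract_lie (v 0) Y θ)
      simp only [DirectSum.sub_apply, AlternatingMap.sub_apply] at h1
      rw [contract_apply_of_mem Y _ _ hj] at h1
      linear_combination -h1

/-- The components of the Koszul differential. -/
def koszulComponent : (n : ℕ) → KoszulComponent A n
  | 0 => A.koszulComponentZero
  | n + 1 => (koszulComponent n).succ

theorem koszulComponent_succ_apply (n : ℕ) (θ : ExtForms R B) (v : Fin (n + 1) → B) :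
    (A.koszulComponent (n + 1)).toMap θ v =
      A.lie (v 0) θ n (Fin.tail v) -
        (A.koszulComponent n).toMap (contract (v 0) θ) (Fin.tail v) := rfl

/-- The component of degree `n + 1` of the differential depends only on the component of degree `n`.
This gives both finite support and degree one. -/
theorem koszulComponent_succ_eq_zero (n : ℕ) (θ : ExtForms R B) (h : θ n = 0) :
    (A.koszulComponent (n + 1)).toMap θ = 0 := by
  induction n generalizing θ with
  | zero =>
    ext v
    rw [koszulComponent_succ_apply, lie_zero_apply, h]
    simp [koszulComponent, koszulComponentZero]
  | succ n ih =>
    ext v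
    rw [koszulComponent_succ_apply, ih _ (by rw [contract_apply, h]; rfl), lie_apply, h]
    simp

/-- The Koszul differential on the exterior algebra. -/
def koszul : ExtForms R B →ₗ[ℝ] ExtForms R B :=
  have hfin : ∀ θ : ExtForms R B, ∃ m, ∀ n, m ≤ n → (A.koszulComponent n).toMap θ = 0 := fun θ => by
    classical
    refine ⟨(DFinsupp.support θ).sup id + 2, fun n hn => ?_⟩
    obtain ⟨n, rfl⟩ : ∃ k, n = k + 1 := ⟨n - 1, by omega⟩
    refine A.koszulComponent_succ_eq_zero n θ (by_contra fun h => ?_)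
    have := Finset.le_sup (f := id) (DFinsupp.mem_support_iff.2 h)
    simp only [id] at this
    omega
  { toFun := fun θ => ofComponents (fun n => (A.koszulComponent n).toMap θ) (hfin θ)
    map_add' := fun θ η => by
      refine DFinsupp.ext fun n => ?_
      rw [DirectSum.add_apply, ofComponents_apply, ofComponents_apply, ofComponents_apply, map_add]
    map_smul' := fun c θ => by
      refine DFinsupp.ext fun n => ?_
      rw [RingHom.id_apply, DirectSum.smul_apply, ofComponents_apply, ofComponents_apply,
        map_smul] }

theorem koszul_apply (θ : ExtForms R B) (n : ℕ) :
    A.koszul θ n = (A.koszulComponent n).toMap θ := ofComponents_apply _ _ n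

theorem koszul_zero (θ : ExtForms R B) : A.koszul θ 0 = 0 := by
  rw [koszul_apply]; rfl

/-- Cartan's formula. -/
theorem contract_koszul (Y : B) (θ : ExtForms R B) :
    contract Y (A.koszul θ) = A.lie Y θ - A.koszul (contract Y θ) := by
  refine DFinsupp.ext fun n => ?_
  ext v
  rw [contract_apply_apply, koszul_apply, koszulComponent_succ_apply, DirectSum.sub_apply,
    AlternatingMap.sub_apply, koszul_apply]
  rfl

theorem koszul_homog_ne {p n : ℕ} (h : n ≠ p + 1) (η : B [⋀^Fin p]→ₗ[R] R) :
    A.koszul (homog p η) n = 0 := by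
  cases n with
  | zero => exact A.koszul_zero _
  | succ n => rw [koszul_apply, koszulComponent_succ_eq_zero _ _ _ (homog_ne (by omega) _)]

theorem koszul_smul (f : R) (θ : ExtForms R B) :
    A.koszul (f • θ) = f • A.koszul θ + wedge (form1 (A.diffFn f)) θ := by
  refine DFinsupp.ext fun n => ?_
  rw [koszul_apply, (A.koszulComponent n).map_smul, DirectSum.add_apply, DirectSum.smul_apply,
    koszul_apply]

theorem parity_koszul (θ : ExtForms R B) : parity (A.koszul θ) = -A.koszul (parity θ) := by
  refine DFinsupp.ext fun n => ?_
  induction n generalizing θ with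
  | zero => rw [parity_apply, neg_component, koszul_zero, koszul_zero]; simp
  | succ n ih =>
    refine component_succ_ext fun X => ?_
    rw [contract_parity, contract_koszul, map_neg, contract_koszul, neg_component, neg_component,
      map_sub, DirectSum.sub_apply, DirectSum.sub_apply, ih, contract_parity, map_neg, parity_lie]

theorem koszul_wedge (P Q : ExtForms R B) :
    A.koszul (wedge P Q) = wedge (A.koszul P) Q + wedge (parity P) (A.koszul Q) := by
  refine DFinsupp.ext fun n => ?_
  induction n generalizing P Q with
  | zero =>
    ext v
    rw [DirectSum.add_apply, AlternatingMap.add_apply, wedge_zero_apply, wedge_zero_apply,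
      koszul_zero, koszul_zero, koszul_zero]
    simp
  | succ n ih =>
    refine component_succ_ext fun Y => ?_
    simp only [contract_koszul, contract_wedge, map_add, DirectSum.add_apply, DirectSum.sub_apply,
      ih, wedge_sub_left, wedge_neg_left, map_sub, lie_wedge, parity_parity, parity_koszul,
        contract_parity,
      neg_component]
    abel

theorem koszul_fn0 (f : R) : A.koszul (fn0 f) = form1 (A.diffFn f) := by
  refine ext_contract ?_ fun X => ?_
  · rw [koszul_zero, form1_zero]
  · rw [contract_koszul, contract_fn0, map_zero, sub_zero, contract_form1]
    refine ext_contract ?_ fun Y => ?_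
    · ext v
      rw [lie_zero_apply, fn0_zero, fn0_zero]; rfl
    · rw [contract_lie, contract_fn0, contract_fn0, contract_fn0, map_zero, sub_zero]

theorem isDegreeOneDerivation_koszul : IsDegreeOneDerivation A.koszul where
  degree p P n h := A.koszul_homog_ne h P
  leibniz p P S := by
    rw [koszul_wedge, parity_homog, map_smul, LinearMap.smul_apply]
    congr 1
    exact (neg_one_pow_real_smul p _).symm

end AlmostLieAlgebroid

/-! ### The pairing of forms induced by a bivector. -/

namespace ExtForms

section Dual

variable {R V : Type*} [CommRing R] [AddCommGroup V] [Module R V]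

/-- The component of degree `1`, as an element of the dual module. -/
def deg1 : ExtForms R V →ₗ[R] Module.Dual R V :=
  LinearMap.mk₂ R (fun θ X => contract X θ 0 ![])
    (fun θ η X => by rw [map_add]; rfl) (fun c θ X => by rw [map_smul]; rfl)
    (fun θ X Y => by rw [map_add]; rfl) (fun c θ X => by rw [map_smul]; rfl)

theorem deg1_apply (θ : ExtForms R V) (X : V) : deg1 θ X = contract X θ 0 ![] := rfl

theorem deg1_form1 (α : Module.Dual R V) : deg1 (form1 α) = α := by
  ext X
  rw [deg1_apply, contract_form1, fn0_zero]

theorem deg1_homog_ne {p : ℕ} (h : p ≠ 1) (η : V [⋀^Fin p]→ₗ[R] R) : deg1 (homog p η) = 0 := by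
  ext X
  rw [deg1_apply, contract_apply, homog_ne h]; rfl

theorem deg1_fn0 (f : R) : deg1 (fn0 f : ExtForms R V) = 0 := deg1_homog_ne zero_ne_one _

theorem deg1_parity (θ : ExtForms R V) : deg1 (parity θ) = -deg1 θ := by
  ext X
  rw [LinearMap.neg_apply, deg1_apply, deg1_apply, contract_parity, neg_component, parity_apply,
    pow_zero, one_smul]; rfl

theorem map_neg_left {W : Type*} [AddCommGroup W] [Module R W]
    (b : ExtForms R V →ₗ[R] ExtForms R V →ₗ[R] W) (P Q : ExtForms R V) :
    b (-P) Q = -b P Q := by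
  rw [← neg_one_smul_eq, map_smul, LinearMap.smul_apply, neg_one_smul]

end Dual

end ExtForms

namespace Bivector

open ExtForms

section Pairing

variable {R V : Type*} [CommRing R] [AddCommGroup V] [Module R V] (π : Bivector R V)

/-- The component of degree `n` of the pairing of forms induced by a bivector, with the property
that
is needed for the construction of the next component. -/
structure PairingComponent (R V : Type*) [CommRing R] [AddCommGroup V] [Module R V] (n : ℕ) where
  toMap : ExtForms R V →ₗ[R] ExtForms R V →ₗ[R] V [⋀^Fin n]→ₗ[R] R
  alt : ∀ P Q Y (v : Fin n → V) j, v j = Y →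
    toMap (parity P) (contract Y Q) v = toMap (contract Y P) Q v

/-- The pairing of the components of degree `1`. -/
def pairingComponentZero : PairingComponent R V 0 where
  toMap := LinearMap.mk₂ R
    (fun P Q => AlternatingMap.constOfIsEmpty R V (Fin 0) (deg1 Q (π.sharp (deg1 P))))
    (fun P P' Q => by ext; simp) (fun c P Q => by ext; simp)
    (fun P Q Q' => by ext; simp) (fun c P Q => by ext; simp)
  alt P Q Y v j := j.elim0

/-- The recursion `ι_Y (P, Q) = -(ι_Y P, Q) + (-1)^p (P, ι_Y Q)`. -/
def PairingComponent.succ {n : ℕ} (b : PairingComponent R V n) : PairingComponent R V (n + 1) where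
  toMap := LinearMap.mk₂ R
    (fun P Q => consAlt
      { toFun := fun Y => b.toMap (parity P) (contract Y Q) - b.toMap (contract Y P) Q
        map_add' := fun Y Z => by
          simp only [map_add, LinearMap.add_apply]; abel
        map_smul' := fun f Y => by
          simp only [map_smul, LinearMap.smul_apply, RingHom.id_apply, smul_sub] }
      (fun Y v j h => sub_eq_zero.2 (b.alt P Q Y v j h)))
    (fun P P' Q => AlternatingMap.ext fun v => by
      rw [AlternatingMap.add_apply, consAlt_apply, consAlt_apply, consAlt_apply]
      simp only [LinearMap.coe_mk, AddHom.coe_mk, map_add, LinearMap.add_apply,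
        AlternatingMap.sub_apply, AlternatingMap.add_apply]
      ring)
    (fun c P Q => AlternatingMap.ext fun v => by
      rw [AlternatingMap.smul_apply, consAlt_apply, consAlt_apply]
      simp only [LinearMap.coe_mk, AddHom.coe_mk, map_smul, LinearMap.smul_apply,
        AlternatingMap.sub_apply, AlternatingMap.smul_apply, smul_sub])
    (fun P Q Q' => AlternatingMap.ext fun v => by
      rw [AlternatingMap.add_apply, consAlt_apply, consAlt_apply, consAlt_apply]
      simp only [LinearMap.coe_mk, AddHom.coe_mk, map_add,
        AlternatingMap.sub_apply, AlternatingMap.add_apply]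
      ring)
    (fun c P Q => AlternatingMap.ext fun v => by
      rw [AlternatingMap.smul_apply, consAlt_apply, consAlt_apply]
      simp only [LinearMap.coe_mk, AddHom.coe_mk, map_smul,
        AlternatingMap.sub_apply, AlternatingMap.smul_apply, smul_sub])
  alt P Q Y v j h := by
    change b.toMap (parity (parity P)) (contract (v 0) (contract Y Q)) (Fin.tail v) -
        b.toMap (contract (v 0) (parity P)) (contract Y Q) (Fin.tail v) =
      b.toMap (parity (contract Y P)) (contract (v 0) Q) (Fin.tail v) -
        b.toMap (contract (v 0) (contract Y P)) Q (Fin.tail v)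
    induction j using Fin.cases with
    | zero =>
      rw [h, contract_contract_self, contract_contract_self, contract_parity]
      simp
    | succ j =>
      have hj : Fin.tail v j = Y := h
      rw [contract_contract (v 0) Y P, contract_contract (v 0) Y Q, map_neg, map_neg_left,
        AlternatingMap.neg_apply, AlternatingMap.neg_apply, b.alt (parity P) _ Y _ j hj,
        ← b.alt (contract (v 0) P) Q Y _ j hj, contract_parity, contract_parity, map_neg_left,
        map_neg_left, AlternatingMap.neg_apply, AlternatingMap.neg_apply]
      ring

/-- The components of the pairing. -/
def pairingComponent : (n : ℕ) → PairingComponent R V n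
  | 0 => π.pairingComponentZero
  | n + 1 => (pairingComponent n).succ

theorem pairingComponent_zero_apply (P Q : ExtForms R V) (v : Fin 0 → V) :
    (π.pairingComponent 0).toMap P Q v = deg1 Q (π.sharp (deg1 P)) := rfl

theorem pairingComponent_succ_apply (n : ℕ) (P Q : ExtForms R V) (v : Fin (n + 1) → V) :
    (π.pairingComponent (n + 1)).toMap P Q v =
      (π.pairingComponent n).toMap (parity P) (contract (v 0) Q) (Fin.tail v) -
        (π.pairingComponent n).toMap (contract (v 0) P) Q (Fin.tail v) := rfl

theorem pairingComponent_homog_eq_zero {p q n : ℕ} (h : n + 2 ≠ p + q) (P : V [⋀^Fin p]→ₗ[R] R)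
    (Q : V [⋀^Fin q]→ₗ[R] R) : (π.pairingComponent n).toMap (homog p P) (homog q Q) = 0 := by
  induction n generalizing p q with
  | zero =>
    ext v
    rw [pairingComponent_zero_apply]
    by_cases hp : p = 1
    · rw [deg1_homog_ne (p := q) (by omega)]; rfl
    · rw [deg1_homog_ne hp]; simp
  | succ n ih =>
    ext v
    rw [pairingComponent_succ_apply, parity_homog, map_smul, LinearMap.smul_apply]
    have h1 : (π.pairingComponent n).toMap (homog p P) (contract (v 0) (homog q Q)) = 0 := by
      cases q with
      | zero => rw [contract_homog_zero, map_zero]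
      | succ q => rw [contract_homog_succ, ih (by omega)]
    have h2 : (π.pairingComponent n).toMap (contract (v 0) (homog p P)) (homog q Q) = 0 := by
      cases p with
      | zero => rw [contract_homog_zero, map_zero, LinearMap.zero_apply]
      | succ p => rw [contract_homog_succ, ih (by omega)]
    rw [h1, h2]; simp

theorem pairingComponent_eventually_zero (P Q : ExtForms R V) :
    ∃ m, ∀ n, m ≤ n → (π.pairingComponent n).toMap P Q = 0 := by
  induction P using induction_homog with
  | add P P' h h' =>
    obtain ⟨m, hm⟩ := h
    obtain ⟨m', hm'⟩ := h'
    refine ⟨max m m', fun n hn => ?_⟩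
    rw [map_add, LinearMap.add_apply, hm n (le_trans (le_max_left _ _) hn),
      hm' n (le_trans (le_max_right _ _) hn), add_zero]
  | homog p P =>
  induction Q using induction_homog with
  | add P P' h h' =>
    obtain ⟨m, hm⟩ := h
    obtain ⟨m', hm'⟩ := h'
    refine ⟨max m m', fun n hn => ?_⟩
    rw [map_add, hm n (le_trans (le_max_left _ _) hn),
      hm' n (le_trans (le_max_right _ _) hn), add_zero]
  | homog q Q =>
  exact ⟨p + q, fun n hn => π.pairingComponent_homog_eq_zero (by omega) P Q⟩

/-- The `R`-bilinear pairing of degree `-2` on forms induced by a bivector. It is a graded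
derivation
in each argument, and its value on `1`-forms is the bivector. -/
def pairing : ExtForms R V →ₗ[R] ExtForms R V →ₗ[R] ExtForms R V :=
  LinearMap.mk₂ R (fun P Q => ofComponents (fun n => (π.pairingComponent n).toMap P Q)
      (π.pairingComponent_eventually_zero P Q))
    (fun P P' Q => DFinsupp.ext fun n => by
      rw [DirectSum.add_apply, ofComponents_apply, ofComponents_apply, ofComponents_apply, map_add,
        LinearMap.add_apply])
    (fun c P Q => DFinsupp.ext fun n => by
      rw [DirectSum.smul_apply, ofComponents_apply, ofComponents_apply, map_smul,
        LinearMap.smul_apply])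
    (fun P Q Q' => DFinsupp.ext fun n => by
      rw [DirectSum.add_apply, ofComponents_apply, ofComponents_apply, ofComponents_apply, map_add])
    (fun c P Q => DFinsupp.ext fun n => by
      rw [DirectSum.smul_apply, ofComponents_apply, ofComponents_apply, map_smul])

theorem pairing_apply (P Q : ExtForms R V) (n : ℕ) :
    π.pairing P Q n = (π.pairingComponent n).toMap P Q := ofComponents_apply _ _ n

theorem pairing_zero_apply (P Q : ExtForms R V) (v : Fin 0 → V) :
    π.pairing P Q 0 v = deg1 Q (π.sharp (deg1 P)) := by
  rw [pairing_apply]; rfl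

theorem pairing_homog_ne {p q n : ℕ} (h : n + 2 ≠ p + q) (P : V [⋀^Fin p]→ₗ[R] R)
    (Q : V [⋀^Fin q]→ₗ[R] R) : π.pairing (homog p P) (homog q Q) n = 0 := by
  rw [pairing_apply, pairingComponent_homog_eq_zero _ h]

theorem contract_pairing (Y : V) (P Q : ExtForms R V) :
    contract Y (π.pairing P Q) =
      π.pairing (parity P) (contract Y Q) - π.pairing (contract Y P) Q := by
  refine DFinsupp.ext fun n => ?_
  ext v
  rw [contract_apply_apply, pairing_apply, pairingComponent_succ_apply, DirectSum.sub_apply,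
    AlternatingMap.sub_apply, pairing_apply, pairing_apply]
  rfl

theorem pairing_neg_left (P Q : ExtForms R V) : π.pairing (-P) Q = -π.pairing P Q := by
  rw [← neg_one_smul_eq, map_smul, LinearMap.smul_apply, neg_one_smul_eq]

theorem parity_pairing (P Q : ExtForms R V) :
    parity (π.pairing P Q) = π.pairing (parity P) (parity Q) := by
  refine DFinsupp.ext fun n => ?_
  induction n generalizing P Q with
  | zero =>
    ext v
    rw [parity_apply, pow_zero, one_smul, pairing_zero_apply, pairing_zero_apply, deg1_parity,
      deg1_parity]
    simp
  | succ n ih =>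
    refine component_succ_ext fun Y => ?_
    rw [contract_parity, contract_pairing, contract_pairing, contract_parity, contract_parity,
      map_sub, neg_component, DirectSum.sub_apply, DirectSum.sub_apply, ih, ih, parity_parity,
      map_neg, pairing_neg_left, neg_component, neg_component]
    abel

theorem pairing_fn0 (f : R) (Q : ExtForms R V) : π.pairing (fn0 f) Q = 0 := by
  refine DFinsupp.ext fun n => ?_
  induction n generalizing Q with
  | zero =>
    ext v
    rw [pairing_zero_apply, deg1_fn0]; simp
  | succ n ih =>
    refine component_succ_ext fun Y => ?_
    rw [contract_pairing, contract_fn0, parity_fn0, map_zero, LinearMap.zero_apply, map_zero,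
      DirectSum.sub_apply, ih, sub_self]
    rfl

/-- Together with `contract_pairing` this evaluates every pairing that is needed later. -/
theorem pairing_form1 (α : Module.Dual R V) (Q : ExtForms R V) :
    π.pairing (form1 α) Q = contract (π.sharp α) Q := by
  refine DFinsupp.ext fun n => ?_
  induction n generalizing Q with
  | zero =>
    ext v
    rw [pairing_zero_apply, deg1_form1, deg1_apply, Subsingleton.elim v ![]]
  | succ n ih =>
    refine component_succ_ext fun Y => ?_
    rw [contract_pairing, contract_form1, parity_form1, pairing_fn0, sub_zero, pairing_neg_left,
      neg_component, ih, contract_contract Y, neg_component]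

theorem contract_odd {P : ExtForms R V} (hP : parity P = P) (Y : V) :
    parity (contract Y P) = -contract Y P := by
  have := contract_parity Y P
  rw [hP] at this
  calc parity (contract Y P) = - -parity (contract Y P) := by abel
    _ = -contract Y P := by rw [← this]

theorem contract_even {P : ExtForms R V} (hP : parity P = -P) (Y : V) :
    parity (contract Y P) = contract Y P := by
  have := contract_parity Y P
  rw [hP, map_neg] at this
  exact (neg_injective this).symm

end Pairing

section Symmetry

variable {R V : Type*} [CommRing R] [Algebra ℝ R] [AddCommGroup V] [Module R V] (π : Bivector R V)

/-- The degree one part equals its own negative, and `2` is invertible. -/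
theorem deg1_eq_zero_of_even {P : ExtForms R V} (hP : parity P = P) : deg1 P = 0 := by
  have h := deg1_parity P
  rw [hP] at h
  ext X
  have h' := LinearMap.congr_fun h X
  refine natCast_mul_left_cancel (m := 2) two_ne_zero ?_
  simp only [LinearMap.neg_apply] at h'
  simp only [LinearMap.zero_apply]
  push_cast
  linear_combination h'

/-- The two cases are proved by one induction because contraction by `Y` exchanges even and odd `P`.
Only the parity of `P` is prescribed, and `Q` is arbitrary, so no bookkeeping of degrees is
required. -/
theorem pairing_symm (P Q : ExtForms R V) :
    (parity P = P → π.pairing P Q = π.pairing (parity Q) P) ∧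
    (parity P = -P → π.pairing P Q = -π.pairing Q P) := by
  suffices h : ∀ n, (parity P = P → π.pairing P Q n = π.pairing (parity Q) P n) ∧
      (parity P = -P → π.pairing P Q n = (-π.pairing Q P) n) from
    ⟨fun hP => DFinsupp.ext fun n => (h n).1 hP, fun hP => DFinsupp.ext fun n => (h n).2 hP⟩
  intro n
  induction n generalizing P Q with
  | zero =>
    refine ⟨fun hP => ?_, fun _ => ?_⟩
    · ext v
      rw [pairing_zero_apply, pairing_zero_apply, deg1_eq_zero_of_even hP]
      simp
    · ext v
      rw [neg_component, AlternatingMap.neg_apply, pairing_zero_apply, pairing_zero_apply,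
        π.apply_sharp_swap]
  | succ n ih =>
    refine ⟨fun hP => component_succ_ext fun Y => ?_, fun hP => component_succ_ext fun Y => ?_⟩
    · rw [contract_pairing, contract_pairing, hP, parity_parity, DirectSum.sub_apply,
        DirectSum.sub_apply, (ih _ _).1 hP, (ih _ _).2 (contract_odd hP Y), neg_component,
        contract_parity, pairing_neg_left, neg_component]
      abel
    · rw [contract_pairing, map_neg, contract_pairing, hP, pairing_neg_left, DirectSum.sub_apply,
        neg_component, neg_component, DirectSum.sub_apply, (ih _ _).2 hP,
        (ih _ _).1 (contract_even hP Y), neg_component]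
      abel

theorem pairing_of_even {P : ExtForms R V} (hP : parity P = P) (Q : ExtForms R V) :
    π.pairing P Q = π.pairing (parity Q) P := (π.pairing_symm P Q).1 hP

theorem pairing_of_odd {P : ExtForms R V} (hP : parity P = -P) (Q : ExtForms R V) :
    π.pairing P Q = -π.pairing Q P := (π.pairing_symm P Q).2 hP

/-- The same joint induction: `ι_Y` is an antiderivation and changes the parity of `P`. -/
theorem pairing_wedge (P Q S : ExtForms R V) :
    (parity P = P →
      π.pairing P (wedge Q S) = wedge (π.pairing P Q) S + wedge Q (π.pairing P S)) ∧
    (parity P = -P →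
      π.pairing P (wedge Q S) = wedge (π.pairing P Q) S + wedge (parity Q) (π.pairing P S)) := by
  suffices h : ∀ n, (parity P = P →
      π.pairing P (wedge Q S) n = (wedge (π.pairing P Q) S + wedge Q (π.pairing P S)) n) ∧
    (parity P = -P → π.pairing P (wedge Q S) n =
      (wedge (π.pairing P Q) S + wedge (parity Q) (π.pairing P S)) n) from
    ⟨fun hP => DFinsupp.ext fun n => (h n).1 hP, fun hP => DFinsupp.ext fun n => (h n).2 hP⟩
  intro n
  induction n generalizing P Q S with
  | zero =>
    have key : ∀ v : Fin 0 → V, π.pairing P (wedge Q S) 0 v =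
        (wedge (π.pairing P Q) S + wedge Q (π.pairing P S)) 0 v := by
      intro v
      rw [DirectSum.add_apply, AlternatingMap.add_apply, wedge_zero_apply, wedge_zero_apply,
        pairing_zero_apply, pairing_zero_apply, pairing_zero_apply, deg1_apply, contract_wedge,
        DirectSum.add_apply, AlternatingMap.add_apply, wedge_zero_apply, wedge_zero_apply,
        parity_apply, pow_zero, one_smul, Subsingleton.elim v ![]]
      rfl
    refine ⟨fun _ => AlternatingMap.ext key, fun _ => AlternatingMap.ext fun v => ?_⟩
    rw [key, DirectSum.add_apply, DirectSum.add_apply, AlternatingMap.add_apply,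
      AlternatingMap.add_apply, wedge_zero_apply Q, wedge_zero_apply (parity Q), parity_apply,
      pow_zero, one_smul]
  | succ n ih =>
    refine ⟨fun hP => component_succ_ext fun Y => ?_, fun hP => component_succ_ext fun Y => ?_⟩
    · simp only [contract_pairing, contract_wedge, map_add, DirectSum.sub_apply,
        DirectSum.add_apply, hP, (ih P _ _).1 hP, (ih (contract Y P) _ _).2 (contract_odd hP Y),
        parity_pairing, wedge_sub_left, map_sub]
      abel
    · simp only [contract_pairing, contract_wedge, map_add, DirectSum.sub_apply,
        DirectSum.add_apply, hP, (ih P _ _).2 hP, (ih (contract Y P) _ _).1 (contract_even hP Y),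
        parity_pairing, wedge_sub_left, map_sub, pairing_neg_left, neg_component, parity_parity,
        wedge_neg_left, map_neg, contract_parity]
      abel

end Symmetry

end Bivector

/-! ### The Schouten bracket of the cotangent structure. -/

namespace AlmostLieAlgebroid

open ExtForms

section Schouten

variable {R B : Type*} [CommRing R] [Algebra ℝ R] [AddCommGroup B] [Module R B]
  [Module ℝ B] [IsScalarTower ℝ R B] (A : AlmostLieAlgebroid R B) (π : Bivector R B)

theorem koszul_even {P : ExtForms R B} (hP : parity P = -P) :
    parity (A.koszul P) = A.koszul P := by
  rw [parity_koszul, hP, map_neg]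
  abel

theorem koszul_odd {P : ExtForms R B} (hP : parity P = P) :
    parity (A.koszul P) = -A.koszul P := by
  rw [parity_koszul, hP]

theorem koszul_homog (p : ℕ) (P : B [⋀^Fin p]→ₗ[R] R) :
    A.koszul (homog p P) = homog (p + 1) (A.koszul (homog p P) (p + 1)) := by
  refine DFinsupp.ext fun n => ?_
  by_cases h : n = p + 1
  · subst h; rw [homog_self]
  · rw [koszul_homog_ne _ h, homog_ne (Ne.symm h)]

/-- The graded commutator of the Koszul differential with the pairing induced by a bivector; it is
the Schouten bracket of the dual algebroid. -/
def schouten : ExtForms R B →ₗ[ℝ] ExtForms R B →ₗ[ℝ] ExtForms R B :=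
  LinearMap.mk₂ ℝ (fun P Q => A.koszul (π.pairing P Q) + π.pairing (A.koszul P) Q -
      π.pairing (parity P) (A.koszul Q))
    (fun P P' Q => by simp only [map_add, LinearMap.add_apply]; abel)
    (fun c P Q => by
      simp only [LinearMap.map_smul_of_tower, map_smul, LinearMap.smul_apply, smul_add, smul_sub])
    (fun P Q Q' => by simp only [map_add]; abel)
    (fun c P Q => by
      simp only [LinearMap.map_smul_of_tower, map_smul, smul_add, smul_sub])

theorem schouten_apply (P Q : ExtForms R B) :
    A.schouten π P Q = A.koszul (π.pairing P Q) + π.pairing (A.koszul P) Q -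
      π.pairing (parity P) (A.koszul Q) := rfl

theorem schouten_neg_left (P Q : ExtForms R B) : A.schouten π (-P) Q = -A.schouten π P Q := by
  simp only [schouten_apply, map_neg, π.pairing_neg_left]
  abel

theorem schouten_of_odd {P : ExtForms R B} (hP : parity P = -P) (Q : ExtForms R B) :
    A.schouten π P Q = -A.schouten π Q P := by
  rw [schouten_apply, schouten_apply, hP, π.pairing_neg_left, π.pairing_of_odd hP,
    π.pairing_of_odd hP, π.pairing_of_even (A.koszul_even hP), map_neg]
  abel

theorem schouten_of_even {P : ExtForms R B} (hP : parity P = P) (Q : ExtForms R B) :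
    A.schouten π P Q = A.schouten π (parity Q) P := by
  rw [schouten_apply, schouten_apply, hP, parity_parity, π.pairing_of_even hP,
    π.pairing_of_even hP, π.pairing_of_odd (A.koszul_odd hP), parity_koszul, π.pairing_neg_left]
  abel

/-- For fixed `P` the bracket is the graded commutator of the derivations `d` and `π(P,·)`, plus the
derivation `π(dP,·)`; hence it is a derivation, and of even degree when `P` is odd. -/
theorem schouten_wedge_of_odd {P : ExtForms R B} (hP : parity P = -P) (Q S : ExtForms R B) :
    A.schouten π P (wedge Q S) = wedge (A.schouten π P Q) S + wedge Q (A.schouten π P S) := by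
  simp only [schouten_apply, hP, π.pairing_neg_left, (π.pairing_wedge P _ _).2 hP, koszul_wedge,
    map_add, (π.pairing_wedge (A.koszul P) _ _).1 (A.koszul_even hP), π.parity_pairing,
    parity_parity, wedge_neg_left, wedge_sub_left, parity_koszul, map_neg, map_sub,
    LinearMap.add_apply]
  abel

theorem schouten_wedge_of_even {P : ExtForms R B} (hP : parity P = P) (Q S : ExtForms R B) :
    A.schouten π P (wedge Q S) =
      wedge (A.schouten π P Q) S + wedge (parity Q) (A.schouten π P S) := by
  simp only [schouten_apply, hP, (π.pairing_wedge P _ _).1 hP, koszul_wedge,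
    map_add, (π.pairing_wedge (A.koszul P) _ _).2 (A.koszul_odd hP), π.parity_pairing,
    wedge_sub_left, map_sub, LinearMap.add_apply]
  abel

theorem schouten_fn0 (f : R) (Q : ExtForms R B) :
    A.schouten π (fn0 f) Q = contract (π.sharp (A.diffFn f)) Q := by
  rw [schouten_apply, parity_fn0, π.pairing_fn0, π.pairing_fn0, koszul_fn0, π.pairing_form1,
    map_zero]
  simp

theorem schouten_form1 (α : Module.Dual R B) (Q : ExtForms R B) :
    A.schouten π (form1 α) Q = A.lie (π.sharp α) Q + π.pairing (A.koszul (form1 α)) Q := by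
  rw [schouten_apply, parity_form1, π.pairing_neg_left, π.pairing_form1, π.pairing_form1,
    contract_koszul]
  abel

theorem lie_form1 (X : B) (α : Module.Dual R B) :
    A.lie X (form1 α) = form1 (A.lieDer X α) := by
  refine ext_contract ?_ fun Y => ?_
  · ext v
    rw [lie_zero_apply, form1_zero, form1_zero]; simp
  · rw [contract_lie, contract_form1, contract_form1, contract_form1]
    refine ext_contract ?_ fun Z => ?_
    · ext v
      rw [DirectSum.sub_apply, AlternatingMap.sub_apply, lie_zero_apply, fn0_zero, fn0_zero,
        fn0_zero]; rfl
    · rw [map_sub, contract_lie, contract_fn0, contract_fn0, contract_fn0, contract_fn0, map_zero]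
      simp

theorem lie_fn0 (X : B) (f : R) : A.lie X (fn0 f) = fn0 (A.anchor X f) := by
  refine ext_contract ?_ fun Y => ?_
  · ext v
    rw [lie_zero_apply, fn0_zero, fn0_zero]
  · rw [contract_lie, contract_fn0, contract_fn0, contract_fn0, map_zero, sub_zero]

theorem schouten_form1_fn0 (α : Module.Dual R B) (f : R) :
    A.schouten π (form1 α) (fn0 f) = fn0 ((A.cotangent π).anchor α f) := by
  rw [schouten_form1, lie_fn0, π.pairing_of_even (A.koszul_even (parity_form1 α)), parity_fn0,
    π.pairing_fn0, add_zero]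
  rfl

theorem schouten_form1_form1 (α β : Module.Dual R B) :
    A.schouten π (form1 α) (form1 β) = form1 ((A.cotangent π).bracket α β) := by
  rw [schouten_form1, lie_form1, π.pairing_of_even (A.koszul_even (parity_form1 α)), parity_form1,
    π.pairing_neg_left, π.pairing_form1, contract_koszul, contract_form1, lie_form1, koszul_fn0,
    ← form1_sub, ← form1_neg, ← form1_add]
  congr 1
  have e : (A.cotangent π).bracket α β =
    A.lieDer (π.sharp α) β - A.lieDer (π.sharp β) α - A.diffFn (π.toForm ![α, β]) := rfl
  have h : A.diffFn (α (π.sharp β)) = -A.diffFn (π.toForm ![α, β]) := by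
    rw [← π.apply_sharp, π.apply_sharp_swap α β]
    ext X
    simp [diffFn]
  rw [e, h]
  abel

/-- No Jacobi identity enters: the axioms follow from the symmetry and derivation rules of `d` and
of the pairing, with the bracket and anchor recovered on generators. -/
theorem isSchoutenBracket_schouten :
    IsSchoutenBracket (A.cotangent π) LinearMap.id (A.schouten π) where
  degree p q P Q n h := by
    rw [schouten_apply, DirectSum.sub_apply, DirectSum.add_apply, parity_homog, map_smul,
      LinearMap.smul_apply, DirectSum.smul_apply, koszul_homog A p P, koszul_homog A q Q,
      π.pairing_homog_ne (by omega), π.pairing_homog_ne (by omega)]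
    have h1 : A.koszul (π.pairing (homog p P) (homog q Q)) n = 0 := by
      cases n with
      | zero => exact A.koszul_zero _
      | succ n =>
        rw [koszul_apply]
        exact A.koszulComponent_succ_eq_zero n _ (π.pairing_homog_ne (by omega) P Q)
    rw [h1]
    simp
  skew p q P Q := by
    rw [neg_one_pow_real_smul]
    rcases Nat.even_or_odd p with hp | hp
    · have e : parity (homog p P) = homog p P := by rw [parity_homog, hp.neg_one_pow, one_smul]
      rw [schouten_of_even _ _ e, parity_homog]
      rcases Nat.even_or_odd q with hq | hq
      · rw [hq.neg_one_pow, (hp.add_one.mul hq.add_one).neg_one_pow, neg_one_smul_eq, one_smul]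
        abel
      · rw [hq.neg_one_pow, (hq.add_one.mul_left _).neg_one_pow, neg_one_smul_eq, one_smul,
          schouten_neg_left]
    · have e : parity (homog p P) = -homog p P := by
        rw [parity_homog, hp.neg_one_pow, neg_one_smul_eq]
      rw [schouten_of_odd _ _ e, (hp.add_one.mul_right _).neg_one_pow, one_smul]
  leibniz p q P Q S := by
    rw [neg_one_pow_real_smul]
    rcases Nat.even_or_odd p with hp | hp
    · have e : parity (homog p P) = homog p P := by rw [parity_homog, hp.neg_one_pow, one_smul]
      rw [schouten_wedge_of_even _ _ e, parity_homog, map_smul, LinearMap.smul_apply, pow_mul,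
        hp.add_one.neg_one_pow]
    · have e : parity (homog p P) = -homog p P := by
        rw [parity_homog, hp.neg_one_pow, neg_one_smul_eq]
      rw [schouten_wedge_of_odd _ _ e, (hp.add_one.mul_right _).neg_one_pow, one_smul]
  sections α β := A.schouten_form1_form1 π α β
  function α f := A.schouten_form1_fn0 π α f

end Schouten

end AlmostLieAlgebroid

/-! ### Local frames, and derivations determined by their values on generators. -/

section Frames

variable (R V : Type*) [CommRing R] [AddCommGroup V] [Module R V]

/-- The multiplication by `χ` has finite rank. For sections of a vector bundle, this holds when
`χ` is
supported in the domain of a local frame. -/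
def IsFrameFunction (χ : R) : Prop :=
  ∃ (n : ℕ) (e : Fin n → V) (ε : Fin n → Module.Dual R V), ∀ X, χ • X = ∑ i, ε i X • e i

/-- There are enough functions for which multiplication has finite rank. -/
structure HasLocalFrames : Prop where
  eq_zero_of_mul : ∀ r : R, (∀ χ, IsFrameFunction R V χ → χ * r = 0) → r = 0
  eq_zero_of_smul : ∀ X : V, (∀ χ, IsFrameFunction R V χ → χ • X = 0) → X = 0

variable {R V}

/-- Dual sections separate sections, since `χ • X` depends only on the coefficients `ε i X`. -/
theorem HasLocalFrames.ext_dual (hV : HasLocalFrames R V) {X Y : V}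
    (h : ∀ α : Module.Dual R V, α X = α Y) : X = Y := by
  refine sub_eq_zero.1 (hV.eq_zero_of_smul _ ?_)
  rintro χ ⟨n, e, ε, hχ⟩
  rw [hχ]
  simp [h]

end Frames

namespace ExtForms

variable {R V : Type*} [CommRing R] [Algebra ℝ R] [AddCommGroup V] [Module R V]

/-- The Euler identity: for a frame with dual frame, `∑ ε_i ∧ ι_{e_i}` counts the degree; localising
the frame inserts the factor `χ`. -/
theorem sum_form1_wedge_contract {χ : R} {m : ℕ} {e : Fin m → V} {ε : Fin m → Module.Dual R V}
    (h : ∀ X, χ • X = ∑ i, ε i X • e i) (θ : ExtForms R V) (n : ℕ) :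
    (∑ i, wedge (form1 (ε i)) (contract (e i) θ)) n = ((n : R) * χ) • θ n := by
  induction n generalizing θ with
  | zero =>
    rw [DirectSum.sum_apply]
    simp [form1_wedge_zero]
  | succ n ih =>
    have key : ∀ X, contract X (∑ i, wedge (form1 (ε i)) (contract (e i) θ)) =
        χ • contract X θ + ∑ i, wedge (form1 (ε i)) (contract (e i) (contract X θ)) := by
      intro X
      have h1 : χ • contract X θ = ∑ i, ε i X • contract (e i) θ := by
        rw [← LinearMap.smul_apply, ← map_smul, h X, map_sum, LinearMap.sum_apply]
        exact Finset.sum_congr rfl fun i _ => by rw [map_smul, LinearMap.smul_apply]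
      rw [map_sum, h1, ← Finset.sum_add_distrib]
      refine Finset.sum_congr rfl fun i _ => ?_
      rw [contract_form1_wedge, contract_contract X, map_neg]
      abel
    ext v
    rw [apply_succ_apply, key, DirectSum.add_apply, ih, AlternatingMap.smul_apply,
      apply_succ_apply θ, DirectSum.smul_apply, AlternatingMap.add_apply, AlternatingMap.smul_apply,
      AlternatingMap.smul_apply]
    simp only [smul_eq_mul]
    push_cast
    ring

/-- A (graded) derivation that vanishes on functions and on `1`-forms is zero. -/
theorem derivation_eq_zero (hV : HasLocalFrames R V) (D : ExtForms R V → ExtForms R V)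
    (hadd : ∀ Q S, D (Q + S) = D Q + D S) (τ : ExtForms R V → ExtForms R V) (hτ : ∀ f, τ (fn0 f) =
      fn0 f)
    (hD : ∀ Q S, D (wedge Q S) = wedge (D Q) S + wedge (τ Q) (D S))
    (h0 : ∀ f, D (fn0 f) = 0) (h1 : ∀ α, D (form1 α) = 0) (θ : ExtForms R V) : D θ = 0 := by
  -- A derivation that kills functions is linear over them. In the applications `τ` is `id` or
  -- `parity`, for derivations of even or odd degree.
  have hsmul : ∀ (f : R) (S : ExtForms R V), D (f • S) = f • D S := fun f S => by
    rw [← fn0_wedge, hD, h0, hτ, fn0_wedge, map_zero, LinearMap.zero_apply, zero_add]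
  have hzero : D 0 = 0 := by
    have h := hsmul 0 0
    rwa [zero_smul, zero_smul] at h
  let D' : ExtForms R V →+ ExtForms R V := ⟨⟨D, hzero⟩, hadd⟩
  have hsum : ∀ {m : ℕ} (S : Fin m → ExtForms R V), D (∑ i, S i) = ∑ i, D (S i) := fun S =>
    map_sum D' S Finset.univ
  induction θ using induction_homog with
  | add θ η h h' => rw [hadd, h, h', add_zero]
  | homog k η =>
  induction k with
  | zero => rw [homog_zero_eq, h0]
  | succ k ih =>
    refine DFinsupp.ext fun n => AlternatingMap.ext fun v => hV.eq_zero_of_mul _ ?_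
    rintro χ ⟨m, e, ε, h⟩
    -- The Euler identity writes `(k+1)χ • η` as a sum of products of `1`-forms with forms of degree
    -- `k`, on which `D` vanishes by induction. Then `k + 1` is invertible, and `χ` is removed by
    -- `eq_zero_of_mul`.
    have hE : ∑ i, wedge (form1 (ε i)) (contract (e i) (homog (k + 1) η)) =
        (((k + 1 : ℕ) : R) * χ) • homog (k + 1) η := by
      refine DFinsupp.ext fun n => ?_
      rw [sum_form1_wedge_contract h, DirectSum.smul_apply]
      by_cases hn : k + 1 = n
      · subst hn; rfl
      · rw [homog_ne hn, smul_zero, smul_zero]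
    have h2 : (((k + 1 : ℕ) : R) * χ) • D (homog (k + 1) η) = 0 := by
      rw [← hsmul, ← hE, hsum]
      refine Finset.sum_eq_zero fun i _ => ?_
      rw [hD, h1, contract_homog_succ, ih, map_zero, map_zero, LinearMap.zero_apply, zero_add]
    have h3 := congrArg (fun θ => θ n v) h2
    refine natCast_mul_left_cancel (m := k + 1) (Nat.succ_ne_zero k) ?_
    rw [mul_zero, ← mul_assoc]
    exact h3

end ExtForms

/-! ### Reduction of the derivation property and of `δ² = [φ,·]` to generators; the Koszul formula.
-/

namespace AlmostLieAlgebroid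

open ExtForms

variable {R B : Type*} [CommRing R] [Algebra ℝ R] [AddCommGroup B] [Module R B]
  [Module ℝ B] [IsScalarTower ℝ R B]

section Defect

variable (A A' : AlmostLieAlgebroid R B) (π : Bivector R B)

/-- The failure of the Koszul differential of `A'` to be a derivation of the Schouten bracket. -/
def schoutenDefect (P Q : ExtForms R B) : ExtForms R B :=
  A'.koszul (A.schouten π P Q) - A.schouten π (A'.koszul P) Q +
    A.schouten π (parity P) (A'.koszul Q)

theorem schoutenDefect_apply (P Q : ExtForms R B) :
    schoutenDefect A A' π P Q = A'.koszul (A.schouten π P Q) - A.schouten π (A'.koszul P) Q +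
      A.schouten π (parity P) (A'.koszul Q) := rfl

theorem parity_schouten (P Q : ExtForms R B) :
    parity (A.schouten π P Q) = -A.schouten π (parity P) (parity Q) := by
  simp only [schouten_apply, map_add, map_sub, parity_koszul, π.parity_pairing, π.pairing_neg_left,
    map_neg]
  abel

theorem schoutenDefect_add (P Q S : ExtForms R B) :
    schoutenDefect A A' π P (Q + S) = schoutenDefect A A' π P Q + schoutenDefect A A' π P S := by
  simp only [schoutenDefect_apply, map_add]; abel

theorem schoutenDefect_of_odd {P : ExtForms R B} (hP : parity P = -P) (Q : ExtForms R B) :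
    schoutenDefect A A' π P Q = -schoutenDefect A A' π Q P := by
  rw [schoutenDefect_apply, schoutenDefect_apply, hP, schouten_neg_left,
    schouten_of_odd A π hP, schouten_of_odd A π hP,
    schouten_of_even A π (A'.koszul_even hP), map_neg]
  abel

theorem schoutenDefect_of_even {P : ExtForms R B} (hP : parity P = P) (Q : ExtForms R B) :
    schoutenDefect A A' π P Q = schoutenDefect A A' π (parity Q) P := by
  rw [schoutenDefect_apply, schoutenDefect_apply, hP, parity_parity,
    schouten_of_even A π hP, schouten_of_even A π hP,
    schouten_of_odd A π (A'.koszul_odd hP), parity_koszul, schouten_neg_left]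
  abel

/-- For fixed `P` the defect combines the graded commutator of `δ` and `[P,·]` with `[δP,·]`, so it
is again a derivation in `Q`. -/
theorem schoutenDefect_wedge_of_odd {P : ExtForms R B} (hP : parity P = -P) (Q S : ExtForms R B) :
    schoutenDefect A A' π P (wedge Q S) =
      wedge (schoutenDefect A A' π P Q) S + wedge (parity Q) (schoutenDefect A A' π P S) := by
  simp only [schoutenDefect_apply, hP, schouten_neg_left, schouten_wedge_of_odd A π hP,
    koszul_wedge, map_add, schouten_wedge_of_even A π (A'.koszul_even hP), wedge_sub_left,
    map_sub, LinearMap.add_apply, wedge_neg_left, map_neg, parity_schouten]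
  abel

theorem schoutenDefect_wedge_of_even {P : ExtForms R B} (hP : parity P = P) (Q S : ExtForms R B) :
    schoutenDefect A A' π P (wedge Q S) =
      wedge (schoutenDefect A A' π P Q) S + wedge Q (schoutenDefect A A' π P S) := by
  simp only [schoutenDefect_apply, hP, schouten_wedge_of_even A π hP,
    koszul_wedge, map_add, schouten_wedge_of_odd A π (A'.koszul_odd hP), wedge_sub_left,
    map_sub, LinearMap.add_apply, wedge_neg_left, parity_schouten, parity_koszul,
    parity_parity]
  abel

variable {A A' π} in
/-- A derivation of the wedge product is a derivation of the Schouten bracket if it is one on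
generators. -/
theorem schoutenDefect_eq_zero (hV : HasLocalFrames R B)
    (hff : ∀ f g, schoutenDefect A A' π (fn0 f) (fn0 g) = 0)
    (hαf : ∀ α f, schoutenDefect A A' π (form1 α) (fn0 f) = 0)
    (hαβ : ∀ α β, schoutenDefect A A' π (form1 α) (form1 β) = 0) (P Q : ExtForms R B) :
    schoutenDefect A A' π P Q = 0 := by
  -- A generator is fixed in the first argument and the second is extended to all forms; the
  -- symmetry of the defect moves the generator to the second argument, where the extension is
  -- repeated for arbitrary `P`.
  have hα : ∀ α Q, schoutenDefect A A' π (form1 α) Q = 0 := fun α =>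
    derivation_eq_zero hV _ (schoutenDefect_add A A' π _) parity parity_fn0
      (schoutenDefect_wedge_of_odd A A' π (parity_form1 α)) (hαf α) (hαβ α)
  have hf : ∀ f Q, schoutenDefect A A' π (fn0 f) Q = 0 := fun f =>
    derivation_eq_zero hV _ (schoutenDefect_add A A' π _) id (fun _ => rfl)
      (schoutenDefect_wedge_of_even A A' π (parity_fn0 f)) (hff f) (fun α => by
        have h : schoutenDefect A A' π (-form1 α) (fn0 f) =
            -schoutenDefect A A' π (form1 α) (fn0 f) := by
          simp only [schoutenDefect_apply, schouten_neg_left, map_neg]; abel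
        rw [schoutenDefect_of_even A A' π (parity_fn0 f), parity_form1, h, hαf]
        simp)
  have hP0 : ∀ P f, schoutenDefect A A' π P (fn0 f) = 0 := fun P f => by
    have h := schoutenDefect_of_even A A' π (parity_fn0 f) (parity P)
    rw [parity_parity, hf] at h
    exact h.symm
  have hP1 : ∀ P α, schoutenDefect A A' π P (form1 α) = 0 := fun P α => by
    have h := schoutenDefect_of_odd A A' π (parity_form1 α) P
    rw [hα] at h
    exact neg_eq_zero.1 h.symm
  induction P using induction_homog with
  | add P P' h h' =>
    have : schoutenDefect A A' π (P + P') Q =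
        schoutenDefect A A' π P Q + schoutenDefect A A' π P' Q := by
      simp only [schoutenDefect_apply, map_add, LinearMap.add_apply]; abel
    rw [this, h, h', add_zero]
  | homog p P =>
    rcases Nat.even_or_odd p with hp | hp
    · have e : parity (homog p P) = homog p P := by rw [parity_homog, hp.neg_one_pow, one_smul]
      exact derivation_eq_zero hV _ (schoutenDefect_add A A' π _) id (fun _ => rfl)
        (schoutenDefect_wedge_of_even A A' π e) (hP0 _) (hP1 _) Q
    · have e : parity (homog p P) = -homog p P := by
        rw [parity_homog, hp.neg_one_pow, neg_one_smul_eq]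
      exact derivation_eq_zero hV _ (schoutenDefect_add A A' π _) parity parity_fn0
        (schoutenDefect_wedge_of_odd A A' π e) (hP0 _) (hP1 _) Q

variable {A A' π} in
-- The square of an odd derivation is an ordinary derivation, and so is the bracket with the odd
-- element `φ`.
theorem koszul_koszul_eq_schouten (hV : HasLocalFrames R B) (φ : B [⋀^Fin 3]→ₗ[R] R)
    (hf : ∀ f, A'.koszul (A'.koszul (fn0 f)) = A.schouten π (homog 3 φ) (fn0 f))
    (hα : ∀ α, A'.koszul (A'.koszul (form1 α)) = A.schouten π (homog 3 φ) (form1 α))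
    (S : ExtForms R B) : A'.koszul (A'.koszul S) = A.schouten π (homog 3 φ) S := by
  have e : parity (homog 3 φ) = -homog 3 φ := by
    rw [parity_homog, ← neg_one_smul_eq]; norm_num
  refine sub_eq_zero.1 (derivation_eq_zero hV
    (fun S => A'.koszul (A'.koszul S) - A.schouten π (homog 3 φ) S)
    (fun Q S => by simp only [map_add]; abel) id (fun _ => rfl) (fun Q S => ?_)
    (fun f => sub_eq_zero.2 (hf f)) (fun α => sub_eq_zero.2 (hα α)) S)
  simp only [koszul_wedge, map_add,
    schouten_wedge_of_odd A π e, wedge_sub_left, map_sub, parity_koszul, parity_parity,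
    wedge_neg_left, id]
  abel

end Defect

section Diff

variable (A : AlmostLieAlgebroid R B)

/-- The Koszul differential is given by the Koszul formula. -/
theorem koszul_homog_apply (k : ℕ) (η : B [⋀^Fin k]→ₗ[R] R) (X : Fin (k + 1) → B) :
    A.koszul (homog k η) (k + 1) X = A.diff η X := by
  induction k with
  | zero =>
    rw [homog_zero_eq, koszul_fn0, form1_one, diff, Fin.sum_univ_succ, Finset.univ_eq_empty,
      Finset.sum_empty, add_zero, Fin.val_zero, pow_zero, one_mul]
    have h0 : Finset.Ioi (0 : Fin (0 + 1)) = ∅ := rfl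
    rw [h0, Finset.sum_empty, sub_zero, Subsingleton.elim (Fin.removeNth 0 X) ![]]
    rfl
  | succ k ih =>
    rw [apply_succ_apply, contract_koszul, DirectSum.sub_apply, AlternatingMap.sub_apply,
      contract_homog_succ, ih, lie_apply, homog_self, sub_eq_add_neg]
    conv_rhs => rw [diff, Fin.sum_univ_succ]
    congr 1
    -- The term `i = 0` of the Koszul formula is the Lie derivative along `X 0`, and the terms `i >
    -- 0` are the differential of the contraction: this is Cartan's formula.
    · have h0 : Finset.Ioi (0 : Fin (k + 2)) = Finset.univ.map (Fin.succEmb (k + 1)) :=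
        Fin.Ioi_zero_eq_map
      rw [h0, Finset.sum_map]
      simp only [Fin.val_zero, pow_zero, one_mul]
      have e : ∀ Z : Fin (k + 2) → B, Fin.removeNth 0 Z = Fin.tail Z := fun Z => by
        funext i; simp [Fin.removeNth, Fin.tail]
      simp only [e, Fin.coe_succEmb, Fin.tail_update_succ]
      rfl
    · rw [diff, ← Finset.sum_neg_distrib]
      refine Finset.sum_congr rfl fun i _ => ?_
      have e : ∀ Z : Fin (k + 2) → B, i.succ.removeNth Z =
          Matrix.vecCons (Z 0) (i.removeNth (Fin.tail Z)) := fun Z => by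
        funext j
        induction j using Fin.cases with
        | zero => simp [Fin.removeNth]
        | succ j => simp [Fin.removeNth, Fin.tail]
      have h0 : Finset.Ioi i.succ = (Finset.Ioi i).map (Fin.succEmb (k + 1)) := by
        simp
      rw [h0, Finset.sum_map]
      simp only [e, Fin.coe_succEmb, Fin.tail_update_succ, AlternatingMap.curryLeft_apply_apply,
        Fin.val_succ, pow_succ]
      have h1 : ∀ (j : Fin (k + 1)) (z : B), Function.update X j.succ z 0 = X 0 := fun j z =>
        Function.update_of_ne (Fin.succ_ne_zero j).symm _ _
      simp only [h1, Fin.tail]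
      ring

end Diff

end AlmostLieAlgebroid

/-! ### Explicit formulas in low degree. -/

namespace ExtForms

variable {R V : Type*} [CommRing R] [AddCommGroup V] [Module R V]

theorem fn0_sub (f g : R) : (fn0 (f - g) : ExtForms R V) = fn0 f - fn0 g := by
  rw [sub_eq_add_neg, fn0_add, fn0_neg, sub_eq_add_neg]

theorem fn0_sum {n : ℕ} (g : Fin n → R) :
    (fn0 (∑ i, g i) : ExtForms R V) = ∑ i, fn0 (g i) := by
  have hz : (fn0 (0 : R) : ExtForms R V) = 0 := by
    rw [← zero_mul (0 : R), fn0_smul, zero_smul]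
  let F : R →+ ExtForms R V := ⟨⟨fn0, hz⟩, fn0_add⟩
  exact map_sum F g Finset.univ

variable [Algebra ℝ R]

theorem form1_wedge_fn0 (α : Module.Dual R V) (f : R) :
    wedge (form1 α) (fn0 f) = f • form1 α := by
  refine ext_contract ?_ fun X => ?_
  · rw [form1_wedge_zero, DirectSum.smul_apply, form1_zero, smul_zero]
  · rw [contract_form1_wedge, contract_fn0, map_zero, sub_zero, map_smul, contract_form1,
      ← fn0_smul, ← fn0_smul, mul_comm]

theorem form1_wedge_form1_apply (α β : Module.Dual R V) (X Y : V) :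
    wedge (form1 α) (form1 β) 2 ![X, Y] = α X * β Y - β X * α Y := by
  rw [apply_succ_apply]
  change contract X (wedge (form1 α) (form1 β)) 1 (Fin.tail ![X, Y]) = _
  rw [contract_form1_wedge, contract_form1, form1_wedge_fn0, DirectSum.sub_apply,
    DirectSum.smul_apply, DirectSum.smul_apply, AlternatingMap.sub_apply, AlternatingMap.smul_apply,
    AlternatingMap.smul_apply, form1_one, form1_one]
  rfl

end ExtForms

namespace AlmostLieAlgebroid

open ExtForms

variable {R B : Type*} [CommRing R] [Algebra ℝ R] [AddCommGroup B] [Module R B]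
  [Module ℝ B] [IsScalarTower ℝ R B] (A : AlmostLieAlgebroid R B)

section LowDegree

theorem lieDer_apply (X : B) (β : Module.Dual R B) (Y : B) :
    A.lieDer X β Y = A.anchor X (β Y) - β (A.bracket X Y) := rfl

theorem diffFn_apply (f : R) (X : B) : A.diffFn f X = A.anchor X f := rfl

/-- The contraction `i_X dα` of the differential of a `1`-form. -/
def dOne (α : Module.Dual R B) (X : B) : Module.Dual R B := A.lieDer X α - A.diffFn (α X)

theorem dOne_apply (α : Module.Dual R B) (X Y : B) :
    A.dOne α X Y = A.anchor X (α Y) - α (A.bracket X Y) - A.anchor Y (α X) := rfl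

theorem dOne_swap (α : Module.Dual R B) (X Y : B) : A.dOne α X Y = -A.dOne α Y X := by
  rw [dOne_apply, dOne_apply, A.bracket_swap X Y, map_neg]; ring

theorem contract_koszul_form1 (α : Module.Dual R B) (X : B) :
    contract X (A.koszul (form1 α)) = form1 (A.dOne α X) := by
  rw [contract_koszul, contract_form1, lie_form1, koszul_fn0, ← form1_sub]; rfl

theorem koszul_form1_apply (α : Module.Dual R B) (X Y : B) :
    A.koszul (form1 α) 2 ![X, Y] = A.dOne α X Y := by
  have h := contract_apply_apply X (A.koszul (form1 α)) 1 ![Y]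
  rw [contract_koszul_form1, form1_one] at h
  exact h.symm

theorem cotangent_bracket_apply (π : Bivector R B) (α β : Module.Dual R B) (X : B) :
    (A.cotangent π).bracket α β X =
      A.anchor (π.sharp α) (β X) - β (A.bracket (π.sharp α) X) -
      (A.anchor (π.sharp β) (α X) - α (A.bracket (π.sharp β) X)) -
      A.anchor X (β (π.sharp α)) := by
  rw [π.apply_sharp]; rfl

theorem cotangent_anchor_apply (π : Bivector R B) (α : Module.Dual R B) :
    (A.cotangent π).anchor α = A.anchor (π.sharp α) := rfl

theorem diff_two (η : (Fin 2 → B) → R) (X Y Z : B) :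
    A.diff η ![X, Y, Z] =
      A.anchor X (η ![Y, Z]) - η ![A.bracket X Y, Z] - η ![Y, A.bracket X Z] -
      (A.anchor Y (η ![X, Z]) - η ![X, A.bracket Y Z]) + A.anchor Z (η ![X, Y]) := by
  have h0 : Finset.Ioi (0 : Fin 3) = {1, 2} := by decide
  have h1 : Finset.Ioi (1 : Fin 3) = {2} := by decide
  have h2 : Finset.Ioi (2 : Fin 3) = ∅ := by decide
  have e0 : ∀ a b c : B, Fin.removeNth 0 ![a, b, c] = ![b, c] := fun a b c => by
    ext i; fin_cases i <;> rfl
  have e1 : ∀ a b c : B, Fin.removeNth 1 ![a, b, c] = ![a, c] := fun a b c => by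
    ext i; fin_cases i <;> rfl
  have e2 : ∀ a b c : B, Fin.removeNth 2 ![a, b, c] = ![a, b] := fun a b c => by
    ext i; fin_cases i <;> rfl
  have u1 : ∀ a b c d : B, Function.update ![a, b, c] 1 d = ![a, d, c] := fun a b c d => by
    ext i; fin_cases i <;> rfl
  have u2 : ∀ a b c d : B, Function.update ![a, b, c] 2 d = ![a, b, d] := fun a b c d => by
    ext i; fin_cases i <;> rfl
  have v1 : ![X, Y, Z] 1 = Y := rfl
  have v2 : ![X, Y, Z] 2 = Z := rfl
  rw [diff, Fin.sum_univ_three, h0, h1, h2, Finset.sum_pair (by decide), Finset.sum_singleton,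
    Finset.sum_empty]
  simp only [Matrix.cons_val_zero, v1, v2, u1, u2, e0, e1, e2]
  norm_num
  ring

theorem diff_three (η : (Fin 3 → B) → R) (X Y Z W : B) :
    A.diff η ![X, Y, Z, W] =
      A.anchor X (η ![Y, Z, W]) - η ![A.bracket X Y, Z, W] - η ![Y, A.bracket X Z, W] -
        η ![Y, Z, A.bracket X W] -
      (A.anchor Y (η ![X, Z, W]) - η ![X, A.bracket Y Z, W] - η ![X, Z, A.bracket Y W]) +
      (A.anchor Z (η ![X, Y, W]) - η ![X, Y, A.bracket Z W]) - A.anchor W (η ![X, Y, Z]) := by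
  have h0 : Finset.Ioi (0 : Fin 4) = {1, 2, 3} := by decide
  have h1 : Finset.Ioi (1 : Fin 4) = {2, 3} := by decide
  have h2 : Finset.Ioi (2 : Fin 4) = {3} := by decide
  have h3 : Finset.Ioi (3 : Fin 4) = ∅ := by decide
  have e0 : ∀ a b c d : B, Fin.removeNth 0 ![a, b, c, d] = ![b, c, d] := fun a b c d => by
    ext i; fin_cases i <;> rfl
  have e1 : ∀ a b c d : B, Fin.removeNth 1 ![a, b, c, d] = ![a, c, d] := fun a b c d => by
    ext i; fin_cases i <;> rfl
  have e2 : ∀ a b c d : B, Fin.removeNth 2 ![a, b, c, d] = ![a, b, d] := fun a b c d => by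
    ext i; fin_cases i <;> rfl
  have e3 : ∀ a b c d : B, Fin.removeNth 3 ![a, b, c, d] = ![a, b, c] := fun a b c d => by
    ext i; fin_cases i <;> rfl
  have u1 : ∀ a b c d x : B, Function.update ![a, b, c, d] 1 x = ![a, x, c, d] :=
    fun a b c d x => by ext i; fin_cases i <;> rfl
  have u2 : ∀ a b c d x : B, Function.update ![a, b, c, d] 2 x = ![a, b, x, d] :=
    fun a b c d x => by ext i; fin_cases i <;> rfl
  have u3 : ∀ a b c d x : B, Function.update ![a, b, c, d] 3 x = ![a, b, c, x] :=
    fun a b c d x => by ext i; fin_cases i <;> rfl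
  have v1 : ![X, Y, Z, W] 1 = Y := rfl
  have v2 : ![X, Y, Z, W] 2 = Z := rfl
  have v3 : ![X, Y, Z, W] 3 = W := rfl
  have w2 : ((2 : Fin 4) : ℕ) = 2 := rfl
  have w3 : ((3 : Fin 4) : ℕ) = 3 := rfl
  rw [diff, Fin.sum_univ_four, h0, h1, h2, h3, Finset.sum_insert (by decide),
    Finset.sum_pair (by decide), Finset.sum_pair (by decide), Finset.sum_singleton,
    Finset.sum_empty]
  simp only [Matrix.cons_val_zero, v1, v2, v3, u1, u2, u3, e0, e1, e2, e3, w2, w3, Fin.val_zero,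
    Fin.val_one]
  ring

end LowDegree

end AlmostLieAlgebroid

/-! ### Poisson bivectors and the Lie algebroid `A*_π`. -/

namespace Bivector

open ExtForms

variable {R B : Type*} [CommRing R] [AddCommGroup B] [Module R B] (π : Bivector R B)

theorem contract_homog_toForm (α : Module.Dual R B) :
    contract α (homog 2 π.toForm) = form1 (Module.Dual.eval R B (π.sharp α)) := by
  rw [contract_homog_succ, form1]
  congr 1
  ext v
  rw [AlternatingMap.curryLeft_apply_apply]
  change π.toForm (Matrix.vecCons α v) = v 0 (π.sharp α)
  rw [π.apply_sharp]
  congr 1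
  funext i
  fin_cases i <;> rfl

variable [Algebra ℝ R]

/-- Locally `π = ½ ∑ e_i ∧ π♯ε_i`. The axioms of a Schouten bracket can be applied to `π` only after
it is written through sections in this way. -/
theorem two_smul_homog_toForm {χ : R} {n : ℕ} {e : Fin n → B} {ε : Fin n → Module.Dual R B}
    (h : ∀ X, χ • X = ∑ i, ε i X • e i) :
    (2 * χ) • homog 2 π.toForm = ∑ i, wedge (form1 (Module.Dual.eval R B (e i)))
      (form1 (Module.Dual.eval R B (π.sharp (ε i)))) := by
  have hd : ∀ α : Module.Dual R B, χ • α = ∑ i, α (e i) • ε i := fun α => by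
    ext X
    rw [LinearMap.smul_apply, ← map_smul, h X, map_sum, LinearMap.sum_apply]
    exact Finset.sum_congr rfl fun i _ => by
      rw [map_smul, LinearMap.smul_apply, smul_eq_mul, smul_eq_mul, mul_comm]
  refine ext_contract ?_ fun α => ?_
  · rw [DirectSum.smul_apply, homog_ne two_ne_zero, smul_zero, DirectSum.sum_apply]
    exact (Finset.sum_eq_zero fun i _ => form1_wedge_zero _ _).symm
  · refine ext_contract ?_ fun β => ?_
    · rw [map_smul, contract_homog_toForm, DirectSum.smul_apply, form1_zero, smul_zero, map_sum,
        DirectSum.sum_apply]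
      refine (Finset.sum_eq_zero fun i _ => ?_).symm
      rw [contract_form1_wedge, contract_form1, DirectSum.sub_apply, DirectSum.smul_apply,
        form1_zero, form1_wedge_zero]
      simp
    · have h1 : ∀ i, contract β (contract α (wedge (form1 (Module.Dual.eval R B (e i)))
          (form1 (Module.Dual.eval R B (π.sharp (ε i)))))) =
          (fn0 (α (e i) * β (π.sharp (ε i)) - α (π.sharp (ε i)) * β (e i)) :
            ExtForms R (Module.Dual R B)) := by
        intro i
        rw [contract_form1_wedge, contract_form1, map_sub, map_smul, contract_form1,
          contract_form1_wedge, contract_fn0, map_zero, sub_zero, fn0_sub, fn0_smul,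
          mul_comm (α (π.sharp (ε i))), fn0_smul]
        rfl
      have h2 : ∑ i, (α (e i) * β (π.sharp (ε i)) - α (π.sharp (ε i)) * β (e i)) =
          2 * χ * β (π.sharp α) := by
        have ha := congrArg (fun γ => β (π.sharp γ)) (hd α)
        have hb := congrArg (fun γ => α (π.sharp γ)) (hd β)
        simp only [map_smul, map_sum, smul_eq_mul] at ha hb
        rw [Finset.sum_sub_distrib, ← ha]
        simp only [mul_comm (α (π.sharp (ε _)))]
        rw [← hb, π.apply_sharp_swap α β]
        ring
      rw [map_smul, contract_homog_toForm, map_smul, contract_form1, map_sum, map_sum]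
      simp only [h1]
      rw [← fn0_sum, h2, fn0_smul]
      rfl

end Bivector

theorem Bivector.sum_mul_sharp {R B : Type*} [CommRing R] [AddCommGroup B] [Module R B]
    (π : Bivector R B) {χ : R} {n : ℕ} {e : Fin n → B} {ε : Fin n → Module.Dual R B}
    (h : ∀ X, χ • X = ∑ i, ε i X • e i) (α β : Module.Dual R B) :
    ∑ i, α (e i) * β (π.sharp (ε i)) = χ * β (π.sharp α) := by
  have hd : χ • α = ∑ i, α (e i) • ε i := by
    ext X
    rw [LinearMap.smul_apply, ← map_smul, h X, map_sum, LinearMap.sum_apply]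
    exact Finset.sum_congr rfl fun i _ => by
      rw [map_smul, LinearMap.smul_apply, smul_eq_mul, smul_eq_mul, mul_comm]
  have ha := congrArg (fun γ => β (π.sharp γ)) hd
  simp only [map_smul, map_sum, smul_eq_mul] at ha
  exact ha.symm

namespace IsSchoutenBracket

open ExtForms

variable {R B : Type*} [CommRing R] [Algebra ℝ R] [AddCommGroup B] [Module R B]
  [Module ℝ B] [IsScalarTower ℝ R B] {A : AlmostLieAlgebroid R B}
  {br : ExtForms R (Module.Dual R B) →ₗ[ℝ] ExtForms R (Module.Dual R B) →ₗ[ℝ]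
      ExtForms R (Module.Dual R B)}

theorem smul_right (h : IsSchoutenBracket A (Module.Dual.eval R B) br)
    (p : ℕ) (P : Module.Dual R B [⋀^Fin p]→ₗ[R] R) (f : R)
    (S : ExtForms R (Module.Dual R B)) :
    br (homog p P) (f • S) = wedge (br (homog p P) (fn0 f)) S + f • br (homog p P) S := by
  have := h.leibniz p 0 P (AlternatingMap.constOfIsEmpty R (Module.Dual R B) (Fin 0) f) S
  rw [mul_zero, pow_zero, one_smul] at this
  change br (homog p P) (wedge (fn0 f) S) = wedge (br (homog p P) (fn0 f)) S +
    wedge (fn0 f) (br (homog p P) S) at this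
  rwa [fn0_wedge, fn0_wedge] at this

theorem even_wedge (h : IsSchoutenBracket A (Module.Dual.eval R B) br)
    {p : ℕ} (hp : Even p) (P : Module.Dual R B [⋀^Fin p]→ₗ[R] R)
    (α : Module.Dual R (Module.Dual R B)) (S : ExtForms R (Module.Dual R B)) :
    br (homog p P) (wedge (form1 α) S) =
      wedge (br (homog p P) (form1 α)) S - wedge (form1 α) (br (homog p P) S) := by
  have := h.leibniz p 1 P (AlternatingMap.ofSubsingleton R (Module.Dual R B) R (0 : Fin 1) α) S
  rw [neg_one_pow_real_smul, mul_one, hp.add_one.neg_one_pow, neg_one_smul_eq] at this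
  rw [sub_eq_add_neg]
  exact this

theorem odd_wedge (h : IsSchoutenBracket A (Module.Dual.eval R B) br)
    {p : ℕ} (hp : Odd p) (P : Module.Dual R B [⋀^Fin p]→ₗ[R] R)
    (α : Module.Dual R (Module.Dual R B)) (S : ExtForms R (Module.Dual R B)) :
    br (homog p P) (wedge (form1 α) S) =
      wedge (br (homog p P) (form1 α)) S + wedge (form1 α) (br (homog p P) S) := by
  have := h.leibniz p 1 P (AlternatingMap.ofSubsingleton R (Module.Dual R B) R (0 : Fin 1) α) S
  rw [mul_one, hp.add_one.neg_one_pow, one_smul] at this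
  exact this

theorem fn0_fn0 (h : IsSchoutenBracket A (Module.Dual.eval R B) br)
    (f g : R) : br (fn0 f) (fn0 g) = 0 :=
  DFinsupp.ext fun n => h.degree 0 0 _ _ n (by omega)

theorem fn0_section (h : IsSchoutenBracket A (Module.Dual.eval R B) br)
    (f : R) (X : B) :
    br (fn0 f) (form1 (Module.Dual.eval R B X)) = -fn0 (A.anchor X f) := by
  have := h.skew 0 1 (AlternatingMap.constOfIsEmpty R (Module.Dual R B) (Fin 0) f)
    (AlternatingMap.ofSubsingleton R (Module.Dual R B) R (0 : Fin 1) (Module.Dual.eval R B X))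
  rw [show (0 + 1) * (1 + 1) = 2 from rfl, even_two.neg_one_pow, one_smul] at this
  rw [← h.function]
  exact this

theorem two_fn0 (h : IsSchoutenBracket A (Module.Dual.eval R B) br)
    (P : Module.Dual R B [⋀^Fin 2]→ₗ[R] R) (f : R) :
    br (homog 2 P) (fn0 f) = br (fn0 f) (homog 2 P) := by
  have := h.skew 2 0 P (AlternatingMap.constOfIsEmpty R (Module.Dual R B) (Fin 0) f)
  rw [show (2 + 1) * (0 + 1) = 3 from rfl, neg_one_pow_real_smul,
    (show Odd 3 by decide).neg_one_pow, neg_one_smul_eq] at this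
  refine this.trans (DFinsupp.ext fun n => AlternatingMap.ext fun v => ?_)
  exact neg_neg _

theorem two_form1 (h : IsSchoutenBracket A (Module.Dual.eval R B) br)
    (P : Module.Dual R B [⋀^Fin 2]→ₗ[R] R) (α : Module.Dual R (Module.Dual R B)) :
    br (homog 2 P) (form1 α) = -br (form1 α) (homog 2 P) := by
  have := h.skew 2 1 P (AlternatingMap.ofSubsingleton R (Module.Dual R B) R (0 : Fin 1) α)
  rw [show (2 + 1) * (1 + 1) = 6 from rfl, (show Even 6 by decide).neg_one_pow, one_smul] at this
  exact this

/-- With `2χπ = ∑ e_i ∧ π♯ε_i`, the Leibniz rule reduces `[f, π]` to anchors, and the sums collapse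
by `sum_mul_sharp`. -/
theorem toForm_fn0 (h : IsSchoutenBracket A (Module.Dual.eval R B) br)
    (hV : HasLocalFrames R B) (π : Bivector R B) (f : R) :
    br (homog 2 π.toForm) (fn0 f) = (A.cotangent π).koszul (fn0 f) := by
  rw [h.two_fn0, AlmostLieAlgebroid.koszul_fn0]
  refine DFinsupp.ext fun n => ?_
  by_cases hn : n = 1
  swap
  · rw [form1, homog_ne (Ne.symm hn)]
    exact h.degree 0 2 _ _ n (by omega)
  subst hn
  ext v
  refine sub_eq_zero.1 (hV.eq_zero_of_mul _ ?_)
  rintro χ ⟨n, e, ε, he⟩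
  have h1 : (2 * χ) • br (fn0 f) (homog 2 π.toForm) = ∑ i,
      (A.anchor (π.sharp (ε i)) f • form1 (Module.Dual.eval R B (e i)) -
        A.anchor (e i) f • form1 (Module.Dual.eval R B (π.sharp (ε i)))) := by
    -- As `[f, 2χ] = 0`, the factor `2χ` comes out of the bracket without a correction term.
    have h2 := h.smul_right 0 (AlternatingMap.constOfIsEmpty R (Module.Dual R B) (Fin 0) f) (2 * χ)
      (homog 2 π.toForm)
    change br (fn0 f) _ = wedge (br (fn0 f) _) _ + _ • br (fn0 f) _ at h2
    rw [h.fn0_fn0, map_zero, LinearMap.zero_apply, zero_add] at h2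
    rw [← h2, π.two_smul_homog_toForm he, map_sum]
    refine Finset.sum_congr rfl fun i _ => ?_
    rw [fn0, h.even_wedge (by decide)]
    change wedge (br (fn0 f) _) _ - wedge _ (br (fn0 f) _) = _
    rw [h.fn0_section, h.fn0_section, wedge_neg_left, fn0_wedge, ← fn0_neg, form1_wedge_fn0]
    refine DFinsupp.ext fun n => AlternatingMap.ext fun w => ?_
    rw [DirectSum.sub_apply, DirectSum.sub_apply, DirectSum.smul_apply, DirectSum.smul_apply,
      neg_component, DirectSum.smul_apply, AlternatingMap.sub_apply, AlternatingMap.sub_apply,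
      AlternatingMap.neg_apply, AlternatingMap.smul_apply, AlternatingMap.smul_apply,
      AlternatingMap.smul_apply, smul_eq_mul, smul_eq_mul, smul_eq_mul]
    ring
  have h3 := congrArg (fun θ => θ 1 v) h1
  simp only [DirectSum.smul_apply, AlternatingMap.smul_apply, DirectSum.sum_apply,
    DirectSum.sub_apply] at h3
  have h4 : ∀ S : Fin n → (Module.Dual R B [⋀^Fin 1]→ₗ[R] R), (∑ i, S i) v = ∑ i, S i v := fun S =>
    map_sum (⟨⟨fun η => η v, rfl⟩, fun _ _ => rfl⟩ :
      (Module.Dual R B [⋀^Fin 1]→ₗ[R] R) →+ R) S Finset.univ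
  rw [h4] at h3
  simp only [AlternatingMap.sub_apply, AlternatingMap.smul_apply, form1_one, smul_eq_mul,
    Module.Dual.eval_apply, Finset.sum_sub_distrib] at h3
  have ha := π.sum_mul_sharp he (v 0) (A.diffFn f)
  have hb := π.sum_mul_sharp he (A.diffFn f) (v 0)
  simp only [AlmostLieAlgebroid.diffFn_apply] at ha hb
  simp only [mul_comm (A.anchor (π.sharp (ε _)) f)] at h3
  rw [ha, hb, π.apply_sharp_swap (v 0), AlmostLieAlgebroid.diffFn_apply] at h3
  refine natCast_mul_left_cancel (m := 2) two_ne_zero ?_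
  push_cast
  rw [form1_one, AlmostLieAlgebroid.diffFn_apply, AlmostLieAlgebroid.cotangent_anchor_apply]
  linear_combination h3

theorem toForm_section (h : IsSchoutenBracket A (Module.Dual.eval R B) br)
    (hV : HasLocalFrames R B) (π : Bivector R B) (X : B) :
    br (homog 2 π.toForm) (form1 (Module.Dual.eval R B X)) =
      (A.cotangent π).koszul (form1 (Module.Dual.eval R B X)) := by
  refine DFinsupp.ext fun n => ?_
  by_cases hn : n = 2
  swap
  · rw [form1, AlmostLieAlgebroid.koszul_homog_ne _ (by omega)]
    exact h.degree 2 1 _ _ n (by omega)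
  subst hn
  rw [h.two_form1]
  ext v
  obtain ⟨α, β, rfl⟩ : ∃ α β, v = ![α, β] := ⟨v 0, v 1, by ext i; fin_cases i <;> rfl⟩
  refine sub_eq_zero.1 (hV.eq_zero_of_mul _ ?_)
  rintro χ ⟨n, e, ε, he⟩
  have h1 : (2 * χ) • br (form1 (Module.Dual.eval R B X)) (homog 2 π.toForm) +
      A.anchor X (2 * χ) • homog 2 π.toForm = ∑ i,
      (wedge (form1 (Module.Dual.eval R B (A.bracket X (e i))))
        (form1 (Module.Dual.eval R B (π.sharp (ε i)))) +
      wedge (form1 (Module.Dual.eval R B (e i)))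
        (form1 (Module.Dual.eval R B (A.bracket X (π.sharp (ε i)))))) := by
    -- Here `X` differentiates `2χ`, which adds `X(2χ)π`; this cancels against the derivative of `χ`
    -- that appears when `ρ(X)` is applied to `∑ α(e_i) β(π♯ε_i) = χ β(π♯α)`.
    have h2 := h.smul_right 1 (AlternatingMap.ofSubsingleton R (Module.Dual R B) R (0 : Fin 1)
      (Module.Dual.eval R B X)) (2 * χ) (homog 2 π.toForm)
    change br (form1 _) _ = wedge (br (form1 _) _) _ + _ • br (form1 _) _ at h2
    rw [h.function, fn0_wedge, add_comm] at h2
    rw [← h2, π.two_smul_homog_toForm he, map_sum]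
    refine Finset.sum_congr rfl fun i _ => ?_
    rw [form1, h.odd_wedge (by decide)]
    change wedge (br (form1 _) _) _ + wedge _ (br (form1 _) _) = _
    rw [h.sections, h.sections]
  have h3 := congrArg (fun θ => θ 2 ![α, β]) h1
  simp only [DirectSum.smul_apply, AlternatingMap.smul_apply, DirectSum.sum_apply,
    DirectSum.add_apply, AlternatingMap.add_apply] at h3
  have h4 : ∀ S : Fin n → (Module.Dual R B [⋀^Fin 2]→ₗ[R] R),
      (∑ i, S i) ![α, β] = ∑ i, S i ![α, β] := fun S =>
    map_sum (⟨⟨fun η => η ![α, β], rfl⟩, fun _ _ => rfl⟩ :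
      (Module.Dual R B [⋀^Fin 2]→ₗ[R] R) →+ R) S Finset.univ
  have h5 : ∀ (γ : Module.Dual R B) (Y : B),
      γ (A.bracket X Y) = A.anchor X (γ Y) - A.lieDer X γ Y := fun γ Y => by
    rw [AlmostLieAlgebroid.lieDer_apply]; ring
  rw [h4] at h3
  simp only [AlternatingMap.add_apply, form1_wedge_form1_apply, smul_eq_mul,
    Module.Dual.eval_apply, homog_self, ← π.apply_sharp, h5] at h3
  have h6 : ∀ i, (A.anchor X (α (e i)) - A.lieDer X α (e i)) * β (π.sharp (ε i)) -
      α (π.sharp (ε i)) * (A.anchor X (β (e i)) - A.lieDer X β (e i)) +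
      (α (e i) * (A.anchor X (β (π.sharp (ε i))) - A.lieDer X β (π.sharp (ε i))) -
      (A.anchor X (α (π.sharp (ε i))) - A.lieDer X α (π.sharp (ε i))) * β (e i)) =
      A.anchor X (α (e i) * β (π.sharp (ε i))) - A.anchor X (β (e i) * α (π.sharp (ε i))) -
      A.lieDer X α (e i) * β (π.sharp (ε i)) + A.lieDer X β (e i) * α (π.sharp (ε i)) -
      α (e i) * A.lieDer X β (π.sharp (ε i)) + β (e i) * A.lieDer X α (π.sharp (ε i)) := by
    intro i
    simp only [Derivation.leibniz, smul_eq_mul]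
    ring
  rw [Finset.sum_congr rfl fun i _ => h6 i] at h3
  have h8 : ∀ g : Fin n → R, ∑ i, A.anchor X (g i) = A.anchor X (∑ i, g i) := fun g =>
    (map_sum (A.anchor X) g Finset.univ).symm
  simp only [Finset.sum_add_distrib, Finset.sum_sub_distrib, h8, π.sum_mul_sharp he] at h3
  simp only [Derivation.leibniz, smul_eq_mul] at h3
  rw [π.apply_sharp_swap α β, π.apply_sharp_swap α (A.lieDer X β),
    π.apply_sharp_swap β (A.lieDer X α), AlmostLieAlgebroid.lieDer_apply,
    AlmostLieAlgebroid.lieDer_apply, π.apply_sharp_swap α β, map_neg] at h3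
  refine natCast_mul_left_cancel (m := 2) two_ne_zero ?_
  push_cast
  rw [AlmostLieAlgebroid.koszul_form1_apply, AlmostLieAlgebroid.dOne_apply,
    AlmostLieAlgebroid.cotangent_anchor_apply, AlmostLieAlgebroid.cotangent_anchor_apply,
    neg_component, AlternatingMap.neg_apply, Module.Dual.eval_apply, Module.Dual.eval_apply,
    Module.Dual.eval_apply, AlmostLieAlgebroid.cotangent_bracket_apply]
  rw [A.bracket_swap X, A.bracket_swap X, map_neg, map_neg] at h3
  have h7 : A.anchor X 2 = 0 := by
    have := (A.anchor X).map_natCast 2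
    exact_mod_cast this
  rw [h7] at h3
  linear_combination -h3

/-- The operators `[π,·]` and `d_π`, the differential of `A*_π`, agree on functions and sections,
hence on `2χπ`. Both give `d_π(2χ) ∧ π` plus `2χ` times their value on `π`, so `[π,π] = 0` forces `χ
d_π π = 0`. -/
theorem koszul_toForm_eq_zero (h : IsSchoutenBracket A (Module.Dual.eval R B) br)
    (hV : HasLocalFrames R B) (π : Bivector R B) (h0 : br (homog 2 π.toForm) (homog 2 π.toForm) =
      0) :
    (A.cotangent π).koszul (homog 2 π.toForm) = 0 := by
  refine DFinsupp.ext fun n => AlternatingMap.ext fun v => hV.eq_zero_of_mul _ ?_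
  rintro χ ⟨m, e, ε, he⟩
  have h1 : br (homog 2 π.toForm) ((2 * χ) • homog 2 π.toForm) =
      (A.cotangent π).koszul ((2 * χ) • homog 2 π.toForm) := by
    rw [π.two_smul_homog_toForm he, map_sum, map_sum]
    refine Finset.sum_congr rfl fun i _ => ?_
    rw [h.even_wedge even_two, AlmostLieAlgebroid.koszul_wedge, parity_form1, wedge_neg_left,
      h.toForm_section hV, h.toForm_section hV, sub_eq_add_neg]
  rw [h.smul_right, h0, smul_zero, add_zero, h.toForm_fn0 hV, AlmostLieAlgebroid.koszul_smul,
    AlmostLieAlgebroid.koszul_fn0] at h1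
  have h2 : (2 * χ) • (A.cotangent π).koszul (homog 2 π.toForm) = 0 := by
    rw [← sub_eq_zero] at h1
    rw [← neg_eq_zero, ← h1]
    abel
  have h3 := congrArg (fun θ => θ n v) h2
  refine natCast_mul_left_cancel (m := 2) two_ne_zero ?_
  push_cast
  rw [mul_zero, ← mul_assoc]
  exact h3

end IsSchoutenBracket

namespace AlmostLieAlgebroid

variable {R B : Type*} [CommRing R] [Algebra ℝ R] [AddCommGroup B] [Module R B]
  [Module ℝ B] [IsScalarTower ℝ R B] {A : AlmostLieAlgebroid R B} {π : Bivector R B}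

/-- This is `d_π π = 0` evaluated on `(α, β, γ)`. It is the form in which the Poisson condition is
used from here on. -/
theorem sharp_bracket (hV : HasLocalFrames R B) (hπ : IsPoisson A π) (α β : Module.Dual R B) :
    π.sharp ((A.cotangent π).bracket α β) = A.bracket (π.sharp α) (π.sharp β) := by
  obtain ⟨br, hbr, h0⟩ := hπ
  refine hV.ext_dual fun γ => ?_
  have h := (A.cotangent π).koszul_homog_apply 2 π.toForm ![α, β, γ]
  rw [hbr.koszul_toForm_eq_zero hV π h0, diff_two] at h
  simp only [← π.apply_sharp, cotangent_anchor_apply] at h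
  rw [DirectSum.zero_apply, AlternatingMap.zero_apply,
    π.apply_sharp_swap _ β, cotangent_bracket_apply, cotangent_bracket_apply,
    π.apply_sharp_swap β γ, π.apply_sharp_swap α β,
    A.bracket_swap (π.sharp β) (π.sharp α)] at h
  have hs := π.apply_sharp_swap γ ((A.cotangent π).bracket α β)
  rw [cotangent_bracket_apply, π.apply_sharp_swap β γ, π.apply_sharp_swap α γ,
    A.bracket_swap (π.sharp α) (π.sharp γ), A.bracket_swap (π.sharp β) (π.sharp γ)] at hs
  simp only [map_neg] at h hs
  refine ExtForms.natCast_mul_left_cancel (m := 2) two_ne_zero ?_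
  push_cast
  linear_combination h + hs

/-- The cotangent structure of a Poisson bivector is a Lie algebroid. -/
theorem isLie_cotangent (hA : A.IsLie) (hV : HasLocalFrames R B) (hπ : IsPoisson A π) :
    (A.cotangent π).IsLie where
  jacobi α β γ := by
    ext X
    rw [LinearMap.add_apply]
    simp only [cotangent_bracket_apply, sharp_bracket hV hπ, map_sub, hA.anchor_bracket,
      Derivation.commutator_apply]
    have j1 := congrArg γ (hA.jacobi (π.sharp α) (π.sharp β) X)
    have j2 := congrArg β (hA.jacobi (π.sharp α) (π.sharp γ) X)
    have j3 := congrArg α (hA.jacobi (π.sharp β) (π.sharp γ) X)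
    rw [map_add] at j1 j2 j3
    -- The Jacobi identities of `A` do not account for the derivatives along `X` of functions built
    -- from `π`; these cancel by differentiating the bracket-preserving property of `π♯`, paired
    -- with `γ`.
    have j4 := congrArg (A.anchor X) (congrArg γ (sharp_bracket (A := A) hV hπ α β))
    rw [π.apply_sharp_swap γ, cotangent_bracket_apply, π.apply_sharp_swap β γ,
      π.apply_sharp_swap α γ, A.bracket_swap (π.sharp α) (π.sharp γ),
      A.bracket_swap (π.sharp β) (π.sharp γ)] at j4
    rw [A.bracket_swap (π.sharp β) (π.sharp α), π.apply_sharp_swap α β]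
    simp only [map_neg, map_sub] at j4 ⊢
    linear_combination -j1 + j2 - j3 + j4
  anchor_bracket α β := by
    rw [cotangent_anchor_apply, sharp_bracket hV hπ, hA.anchor_bracket]; rfl

end AlmostLieAlgebroid

/-! ### Trilinear notation for `3`-forms, the twisted bracket, and `1`-form identities. -/

section Tri

variable {R V : Type*} [CommRing R] [AddCommGroup V] [Module R V]

/-- A `3`-form as a trilinear map. -/
def tri (η : V [⋀^Fin 3]→ₗ[R] R) : V →ₗ[R] V →ₗ[R] Module.Dual R V :=
  have e1 : ∀ X Y Z W : V, Function.update ![X, Y, Z] 0 W = ![W, Y, Z] := fun X Y Z W => by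
    ext i; fin_cases i <;> rfl
  have e2 : ∀ X Y Z W : V, Function.update ![X, Y, Z] 1 W = ![X, W, Z] := fun X Y Z W => by
    ext i; fin_cases i <;> rfl
  LinearMap.mk₂ R (contract2 η)
    (fun X X' Y => by
      ext Z; have := η.map_update_add ![0, Y, Z] 0 X X'; rw [e1, e1, e1] at this; exact this)
    (fun c X Y => by
      ext Z; have := η.map_update_smul ![0, Y, Z] 0 c X; rw [e1, e1] at this; exact this)
    (fun X Y Y' => by
      ext Z; have := η.map_update_add ![X, 0, Z] 1 Y Y'; rw [e2, e2, e2] at this; exact this)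
    (fun c X Y => by
      ext Z; have := η.map_update_smul ![X, 0, Z] 1 c Y; rw [e2, e2] at this; exact this)

theorem tri_apply (η : V [⋀^Fin 3]→ₗ[R] R) (X Y Z : V) : tri η X Y Z = η ![X, Y, Z] := rfl

theorem contract2_eq_tri (η : V [⋀^Fin 3]→ₗ[R] R) (X Y : V) : contract2 η X Y = tri η X Y := rfl

theorem tri_swap_left (η : V [⋀^Fin 3]→ₗ[R] R) (X Y Z : V) : tri η X Y Z = -tri η Y X Z := by
  rw [tri_apply, tri_apply, ← η.map_swap ![Y, X, Z] (i := 0) (j := 1) (by decide)]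
  congr 1
  ext i; fin_cases i <;> rfl

theorem tri_swap_right (η : V [⋀^Fin 3]→ₗ[R] R) (X Y Z : V) : tri η X Y Z = -tri η X Z Y := by
  rw [tri_apply, tri_apply, ← η.map_swap ![X, Z, Y] (i := 1) (j := 2) (by decide)]
  congr 1
  ext i; fin_cases i <;> rfl

theorem tri_rotate (η : V [⋀^Fin 3]→ₗ[R] R) (X Y Z : V) : tri η X Y Z = tri η Y Z X := by
  rw [tri_swap_left, tri_swap_right, neg_neg]

theorem tri_self (η : V [⋀^Fin 3]→ₗ[R] R) (X : V) : tri η X X = 0 := by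
  ext Z
  exact η.map_eq_zero_of_eq _ (i := 0) (j := 1) rfl (by decide)

theorem tri_insertEnd (N : V →ₗ[R] V) (η : V [⋀^Fin 3]→ₗ[R] R) (X Y Z : V) :
    tri (insertEnd N η) X Y Z = tri η (N X) Y Z + tri η X (N Y) Z + tri η X Y (N Z) := by
  rw [tri_apply, insertEnd_apply, Fin.sum_univ_three, tri_apply, tri_apply, tri_apply]
  congr 1
  · congr 1
    all_goals congr 1; ext i; fin_cases i <;> rfl
  · congr 1; ext i; fin_cases i <;> rfl

theorem tri_add (η θ : V [⋀^Fin 3]→ₗ[R] R) (X Y Z : V) :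
    tri (η + θ) X Y Z = tri η X Y Z + tri θ X Y Z := rfl

end Tri

namespace AlmostLieAlgebroid

open ExtForms

variable {R B : Type*} [CommRing R] [Algebra ℝ R] [AddCommGroup B] [Module R B]
  [Module ℝ B] [IsScalarTower ℝ R B]

section Twist

variable (A : AlmostLieAlgebroid R B) (π : Bivector R B) (N : B →ₗ[R] B) (H : B [⋀^Fin 3]→ₗ[R] R)

/-- The bracket `[X, Y]_N - π♯ H(X, Y, ·)` with the anchor `ρ ∘ N`. Its Koszul differential is the
twisted differential. -/
def twist : AlmostLieAlgebroid R B where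
  bracket := LinearMap.mk₂ ℝ
    (fun X Y => (A.deform N).bracket X Y - π.sharp (tri H X Y))
    (fun X X' Y => by simp only [map_add, LinearMap.add_apply]; abel)
    (fun c X Y => by
      simp only [LinearMap.map_smul_of_tower, LinearMap.smul_apply, smul_sub])
    (fun X Y Y' => by simp only [map_add]; abel)
    (fun c X Y => by simp only [LinearMap.map_smul_of_tower, smul_sub])
  anchor := (A.deform N).anchor
  bracket_self X := by
    rw [LinearMap.mk₂_apply, bracket_self, tri_self, map_zero, sub_zero]
  leibniz X Y f := by
    simp only [LinearMap.mk₂_apply, leibniz, map_smul, smul_sub]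
    abel

theorem twist_anchor (X : B) : (A.twist π N H).anchor X = A.anchor (N X) := rfl

theorem twist_diffFn (f : R) : (A.twist π N H).diffFn f = N.dualMap (A.diffFn f) := rfl

theorem twist_bracket (X Y : B) : (A.twist π N H).bracket X Y =
    A.bracket (N X) Y + A.bracket X (N Y) - N (A.bracket X Y) - π.sharp (tri H X Y) := rfl

theorem twist_dOne (α : Module.Dual R B) (X Y : B) :
    (A.twist π N H).dOne α X Y = A.dOne α (N X) Y + A.dOne α X (N Y) - A.dOne (N.dualMap α) X Y -
      tri H (π.sharp α) X Y := by
  simp only [dOne_apply, twist_bracket, twist_anchor, map_sub, map_add, LinearMap.dualMap_apply]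
  rw [π.apply_sharp_swap α, tri_rotate H (π.sharp α)]
  ring

/-- The sign of the twist is right because `α(π♯H(X,Y,·)) = -H(π♯α,X,Y)` by skew-symmetry of `π`. -/
theorem isTwistedDifferential_koszul : IsTwistedDifferential A π N H (A.twist π N H).koszul where
  derivation := isDegreeOneDerivation_koszul _
  function f := koszul_fn0 _ _
  one_form α X Y := by
    have h := (A.deform N).koszul_homog_apply 1
      (AlternatingMap.ofSubsingleton R B R (0 : Fin 1) α) ![X, Y]
    change (A.deform N).koszul (form1 α) 2 ![X, Y] =
      (A.deform N).diff (fun Z : Fin 1 → B => α (Z 0)) ![X, Y] at h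
    rw [← h, koszul_form1_apply, koszul_form1_apply, dOne_apply, dOne_apply]
    change A.anchor (N X) _ - α ((A.deform N).bracket X Y - π.sharp (tri H X Y)) -
      A.anchor (N Y) _ = A.anchor (N X) _ - _ - A.anchor (N Y) _ - tri H (π.sharp α) X Y
    rw [map_sub, π.apply_sharp_swap α, tri_rotate H (π.sharp α)]
    ring

end Twist

section OneForms

variable {A : AlmostLieAlgebroid R B}

theorem dOne_sub (α β : Module.Dual R B) (X Y : B) :
    A.dOne (α - β) X Y = A.dOne α X Y - A.dOne β X Y := by
  simp only [dOne_apply, LinearMap.sub_apply, map_sub]; ring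

theorem dOne_diffFn (hA : A.IsLie) (f : R) (X Y : B) : A.dOne (A.diffFn f) X Y = 0 := by
  simp only [dOne_apply, diffFn_apply, hA.anchor_bracket, Derivation.commutator_apply]; ring

theorem dOne_lieDer (hA : A.IsLie) (Z : B) (β : Module.Dual R B) (X Y : B) :
    A.dOne (A.lieDer Z β) X Y =
      A.anchor Z (A.dOne β X Y) - A.dOne β (A.bracket Z X) Y - A.dOne β X (A.bracket Z Y) := by
  simp only [dOne_apply, lieDer_apply, map_sub, hA.anchor_bracket, Derivation.commutator_apply]
  rw [hA.jacobi Z X Y, map_add]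
  ring

theorem cotangent_bracket (π : Bivector R B) (α β : Module.Dual R B) :
    (A.cotangent π).bracket α β =
      A.lieDer (π.sharp α) β - A.lieDer (π.sharp β) α - A.diffFn (β (π.sharp α)) := by
  rw [π.apply_sharp]; rfl

theorem dOne_cotangent_bracket (hA : A.IsLie) (π : Bivector R B) (α β : Module.Dual R B) (X Y : B) :
    A.dOne ((A.cotangent π).bracket α β) X Y =
      A.anchor (π.sharp α) (A.dOne β X Y) - A.dOne β (A.bracket (π.sharp α) X) Y -
        A.dOne β X (A.bracket (π.sharp α) Y) -
      (A.anchor (π.sharp β) (A.dOne α X Y) - A.dOne α (A.bracket (π.sharp β) X) Y -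
        A.dOne α X (A.bracket (π.sharp β) Y)) := by
  rw [cotangent_bracket, dOne_sub, dOne_sub, dOne_diffFn hA, dOne_lieDer hA, dOne_lieDer hA,
    sub_zero]

/-- Contracting once turns the `2`-form `[α, δβ]` into a `1`-form, so that the defect on two
`1`-forms can be compared as a covector. -/
theorem contract_schouten_form1_koszul (A' : AlmostLieAlgebroid R B) (π : Bivector R B) (α β :
  Module.Dual R B)
    (X : B) : contract X (A.schouten π (form1 α) (A'.koszul (form1 β))) =
      form1 (A.lieDer (π.sharp α) (A'.dOne β X) - A'.dOne β (A.bracket (π.sharp α) X) -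
        A.dOne α (π.sharp (A'.dOne β X)) - A'.dOne β (π.sharp (A.dOne α X))) := by
  rw [schouten_form1, map_add, contract_lie, contract_koszul_form1, contract_koszul_form1,
    lie_form1, π.contract_pairing, koszul_even _ (parity_form1 α), contract_koszul_form1,
    contract_koszul_form1, π.pairing_form1, contract_koszul_form1,
    π.pairing_of_even (koszul_even _ (parity_form1 α)), parity_form1, π.pairing_neg_left,
    π.pairing_form1, contract_koszul_form1]
  simp only [form1_sub]
  abel

theorem schouten_form1_koszul_zero (A' : AlmostLieAlgebroid R B) (π : Bivector R B)
    (α β : Module.Dual R B) : A.schouten π (form1 α) (A'.koszul (form1 β)) 0 = 0 := by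
  rw [form1, form1, koszul_homog]
  exact (isSchoutenBracket_schouten A π).degree 1 2 _ _ 0 (by omega)

end OneForms

end AlmostLieAlgebroid

/-! ### The twisted differential is a derivation of the Schouten bracket. -/

namespace IsPoissonQuasiNijenhuis

open ExtForms AlmostLieAlgebroid

variable {R B : Type*} [CommRing R] [Algebra ℝ R] [AddCommGroup B] [Module R B]
  [Module ℝ B] [IsScalarTower ℝ R B] {A : AlmostLieAlgebroid R B} {π : Bivector R B}
  {N : B →ₗ[R] B} {ψ H : B [⋀^Fin 3]→ₗ[R] R}

theorem map_sharp (h : IsPoissonQuasiNijenhuis A π N ψ H)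
    (α : Module.Dual R B) : N (π.sharp α) = π.sharp (N.dualMap α) :=
  LinearMap.congr_fun h.comm α

theorem apply_map_sharp_swap (h : IsPoissonQuasiNijenhuis A π N ψ H)
    (α β : Module.Dual R B) :
    α (N (π.sharp β)) = -β (N (π.sharp α)) := by
  rw [h.map_sharp β, π.apply_sharp_swap]; rfl

/-- Expanding the two deformed brackets gives the identity multiplied by `-2`, which accounts for
the coefficient `-2` in the concomitant equation. -/
theorem concomitant_apply (h : IsPoissonQuasiNijenhuis A π N ψ H)
    (α β : Module.Dual R B) (X : B) :
    β (A.bracket (π.sharp α) (N X)) - β (N (A.bracket (π.sharp α) X)) -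
      α (A.bracket (π.sharp β) (N X)) + α (N (A.bracket (π.sharp β) X)) +
      A.anchor (N X) (β (π.sharp α)) - A.anchor X (β (N (π.sharp α))) =
    tri H (π.sharp α) (π.sharp β) X := by
  have hc := LinearMap.congr_fun (h.concomitant α β) X
  have e1 : ∀ Y Z, (A.deform N).bracket Y Z =
    A.bracket (N Y) Z + A.bracket Y (N Z) - N (A.bracket Y Z) := fun _ _ => rfl
  have e2 : ((A.cotangent π).deform N.dualMap).bracket α β =
    (A.cotangent π).bracket (N.dualMap α) β + (A.cotangent π).bracket α (N.dualMap β) -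
      N.dualMap ((A.cotangent π).bracket α β) := rfl
  have e3 : ∀ Y, (A.deform N).anchor Y = A.anchor (N Y) := fun _ => rfl
  rw [AlmostLieAlgebroid.concomitant, LinearMap.sub_apply, cotangent_bracket_apply, e2,
    LinearMap.sub_apply,
    LinearMap.add_apply, LinearMap.dualMap_apply, cotangent_bracket_apply, cotangent_bracket_apply,
    cotangent_bracket_apply, contract2_eq_tri, LinearMap.smul_apply, smul_eq_mul, e1, e1, e3, e3,
    e3, ← h.map_sharp, ← h.map_sharp] at hc
  simp only [LinearMap.dualMap_apply, map_add, map_sub] at hc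
  refine natCast_mul_left_cancel (m := 2) two_ne_zero ?_
  push_cast
  linear_combination -hc

/-- The concomitant equation as a commutation rule: it moves `N` out of `[π♯α, NX]` at the cost of
differentials of `1`-forms and a term in `H`. -/
theorem apply_bracket_sharp_map (h : IsPoissonQuasiNijenhuis A π N ψ H)
    (α β : Module.Dual R B) (X : B) :
    β (A.bracket (π.sharp α) (N X)) = β (N (A.bracket (π.sharp α) X)) -
      A.dOne α (π.sharp β) (N X) + A.dOne (N.dualMap α) (π.sharp β) X +
      tri H (π.sharp α) (π.sharp β) X := by
  have hc := h.concomitant_apply α β X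
  simp only [dOne_apply, LinearMap.dualMap_apply]
  rw [π.apply_sharp_swap α β, h.apply_map_sharp_swap α β, map_neg, map_neg]
  linear_combination hc

/-- The same equation solved for `ᵗN[α,β]_π`, a form that can be differentiated. -/
theorem dualMap_bracket (h : IsPoissonQuasiNijenhuis A π N ψ H)
    (α β : Module.Dual R B) :
    N.dualMap ((A.cotangent π).bracket α β) = A.lieDer (π.sharp α) (N.dualMap β) -
      A.lieDer (π.sharp β) (N.dualMap α) - tri H (π.sharp α) (π.sharp β) -
      A.diffFn (β (N (π.sharp α))) := by
  ext X
  have hc := h.concomitant_apply α β X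
  simp only [LinearMap.sub_apply, lieDer_apply, diffFn_apply, LinearMap.dualMap_apply,
    cotangent_bracket_apply]
  linear_combination -hc

/-- Both remaining terms are the pairing of `dg` with `Nπ♯df = π♯ᵗN df`. -/
theorem schoutenDefect_fn0_fn0 (h : IsPoissonQuasiNijenhuis A π N ψ H)
    (f g : R) :
    schoutenDefect A (A.twist π N H) π (fn0 f) (fn0 g) = 0 := by
  rw [schoutenDefect_apply, schouten_fn0, contract_fn0, map_zero, koszul_fn0, koszul_fn0,
    schouten_form1_fn0, parity_fn0, schouten_fn0, contract_form1, twist_diffFn, twist_diffFn,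
    LinearMap.dualMap_apply, cotangent_anchor_apply, ← h.map_sharp, diffFn_apply]
  abel

/-- The concomitant equation for `α` and `df`, with `df` of a bracket rewritten as a commutator of
anchors. -/
theorem schoutenDefect_form1_fn0 (h : IsPoissonQuasiNijenhuis A π N ψ H)
    (hA : A.IsLie) (α : Module.Dual R B) (f : R) :
    schoutenDefect A (A.twist π N H) π (form1 α) (fn0 f) = 0 := by
  rw [schoutenDefect_apply, schouten_form1_fn0, koszul_fn0, koszul_fn0,
    schouten_of_even A π (koszul_even _ (parity_form1 α)), parity_fn0, parity_form1,
    schouten_neg_left, schouten_fn0, contract_koszul_form1, schouten_form1_form1,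
    ← form1_sub, ← form1_neg, ← form1_add]
  have e : (A.twist π N H).diffFn ((A.cotangent π).anchor α f) -
      (A.twist π N H).dOne α (π.sharp (A.diffFn f)) +
      -(A.cotangent π).bracket α ((A.twist π N H).diffFn f) = 0 := by
    ext X
    have hc := h.apply_bracket_sharp_map α (A.diffFn f) X
    simp only [LinearMap.add_apply, LinearMap.sub_apply, LinearMap.neg_apply, twist_diffFn,
      LinearMap.dualMap_apply, twist_dOne, cotangent_bracket_apply, diffFn_apply,
      cotangent_anchor_apply, ← h.map_sharp] at hc ⊢
    rw [hA.anchor_bracket, Derivation.commutator_apply] at hc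
    rw [dOne_apply A α (N _), h.apply_map_sharp_swap α (A.diffFn f), diffFn_apply, map_neg,
      LinearMap.zero_apply]
    linear_combination -hc
  rw [e, ← zero_smul R (0 : Module.Dual R B), form1_smul, zero_smul]

/-- The derivation property on two `1`-forms, evaluated on `(X, Y)`: all its terms are values of
`dα`, `dβ`, `d(ᵗNα)`, `d(ᵗNβ)` and `H`. -/
theorem twist_dOne_bracket (h : IsPoissonQuasiNijenhuis A π N ψ H)
    (hA : A.IsLie) (hV : HasLocalFrames R B) (α β : Module.Dual R B)
    (X Y : B) :
    (A.twist π N H).dOne ((A.cotangent π).bracket α β) X Y =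
      A.anchor (π.sharp α) ((A.twist π N H).dOne β X Y) -
        (A.twist π N H).dOne β (A.bracket (π.sharp α) X) Y -
        (A.twist π N H).dOne β X (A.bracket (π.sharp α) Y) -
        (A.twist π N H).dOne β (π.sharp (A.dOne α X)) Y -
        (A.twist π N H).dOne β X (π.sharp (A.dOne α Y)) -
      (A.anchor (π.sharp β) ((A.twist π N H).dOne α X Y) -
        (A.twist π N H).dOne α (A.bracket (π.sharp β) X) Y -
        (A.twist π N H).dOne α X (A.bracket (π.sharp β) Y) -
        (A.twist π N H).dOne α (π.sharp (A.dOne β X)) Y -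
        (A.twist π N H).dOne α X (π.sharp (A.dOne β Y))) := by
  have dH := h.closed_H ![π.sharp α, π.sharp β, X, Y]
  rw [diff_three] at dH
  simp only [← tri_apply] at dH
  -- Differentiating `dualMap_bracket` brings in `d(H(π♯α,π♯β,·))`, whose terms are part of
  -- `dH(π♯α,π♯β,X,Y) = 0`.
  have n1 : A.dOne (N.dualMap ((A.cotangent π).bracket α β)) X Y =
      A.anchor (π.sharp α) (A.dOne (N.dualMap β) X Y) -
        A.dOne (N.dualMap β) (A.bracket (π.sharp α) X) Y -
        A.dOne (N.dualMap β) X (A.bracket (π.sharp α) Y) -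
      (A.anchor (π.sharp β) (A.dOne (N.dualMap α) X Y) -
        A.dOne (N.dualMap α) (A.bracket (π.sharp β) X) Y -
        A.dOne (N.dualMap α) X (A.bracket (π.sharp β) Y)) -
      (A.anchor X (tri H (π.sharp α) (π.sharp β) Y) - tri H (π.sharp α) (π.sharp β) (A.bracket X Y)
        - A.anchor Y (tri H (π.sharp α) (π.sharp β) X)) := by
    rw [h.dualMap_bracket, dOne_sub, dOne_sub, dOne_sub, dOne_diffFn hA, dOne_lieDer hA,
      dOne_lieDer hA, sub_zero, dOne_apply A (tri H _ _)]
  have q1 : ∀ (γ γ' : Module.Dual R B) (W : B), A.dOne γ (π.sharp γ') W =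
    -A.dOne γ W (π.sharp γ') := fun γ γ' W => dOne_swap _ _ _ _
  have q2 : ∀ (γ : Module.Dual R B) (U V W : B), A.dOne γ (A.bracket U V) W =
    -A.dOne γ W (A.bracket U V) := fun γ U V W => dOne_swap _ _ _ _
  have q3 : ∀ (γ γ' : Module.Dual R B) (W : B), A.dOne γ (N (π.sharp γ')) W =
    -A.dOne γ W (N (π.sharp γ')) := fun γ γ' W => dOne_swap _ _ _ _
  have q4 : ∀ (γ : Module.Dual R B) (U V W : B), A.dOne γ (N (A.bracket U V)) W =
    -A.dOne γ W (N (A.bracket U V)) := fun γ U V W => dOne_swap _ _ _ _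
  have q5 : ∀ (γ γ' : Module.Dual R B) (U W : B), tri H (π.sharp γ) (π.sharp (A.dOne γ' U)) W =
    -tri H (π.sharp γ) W (π.sharp (A.dOne γ' U)) := fun γ γ' U W => tri_swap_right _ _ _ _
  -- The brackets `[π♯α, NX]` and their analogues are inserted into `dβ` or `dα`, so the commutation
  -- rule is applied with the covectors `ι_Y dβ`, `ι_X dβ`, `ι_Y dα`, `ι_X dα`.
  have c1 := h.apply_bracket_sharp_map α (A.dOne β Y) X
  have c2 := h.apply_bracket_sharp_map α (A.dOne β X) Y
  have c3 := h.apply_bracket_sharp_map β (A.dOne α Y) X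
  have c4 := h.apply_bracket_sharp_map β (A.dOne α X) Y
  have s1 := h.apply_map_sharp_swap (A.dOne β X) (A.dOne α Y)
  have s2 := h.apply_map_sharp_swap (A.dOne β Y) (A.dOne α X)
  have hs := sharp_bracket (A := A) hV h.poisson α β
  simp only [twist_dOne, dOne_cotangent_bracket hA, n1, hs, map_sub, map_add, q1, q2, q3, q4, q5]
    at c1 c2 c3 c4 dH ⊢
  linear_combination c1 - c2 - c3 + c4 + s1 - s2 + dH

theorem schoutenDefect_form1_form1 (h : IsPoissonQuasiNijenhuis A π N ψ H)
    (hA : A.IsLie) (hV : HasLocalFrames R B)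
    (α β : Module.Dual R B) :
    schoutenDefect A (A.twist π N H) π (form1 α) (form1 β) = 0 := by
  rw [schoutenDefect_apply, schouten_form1_form1,
    schouten_of_even A π (koszul_even _ (parity_form1 α)), parity_form1, parity_form1,
    schouten_neg_left, schouten_neg_left]
  refine ext_contract ?_ fun X => ?_
  · rw [DirectSum.add_apply, DirectSum.sub_apply, neg_component, neg_component, koszul_zero,
      schouten_form1_koszul_zero, schouten_form1_koszul_zero, DirectSum.zero_apply]
    simp
  · rw [map_add, map_sub, map_neg, map_neg, contract_koszul_form1,
      contract_schouten_form1_koszul, contract_schouten_form1_koszul, ← form1_neg, ← form1_neg,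
      ← form1_sub, ← form1_add, map_zero]
    have e : (A.twist π N H).dOne ((A.cotangent π).bracket α β) X -
       -(A.lieDer (π.sharp β) ((A.twist π N H).dOne α X) -
       (A.twist π N H).dOne α (A.bracket (π.sharp β) X) -
        A.dOne β (π.sharp ((A.twist π N H).dOne α X)) -
         (A.twist π N H).dOne α (π.sharp (A.dOne β X))) +
       -(A.lieDer (π.sharp α) ((A.twist π N H).dOne β X) -
       (A.twist π N H).dOne β (A.bracket (π.sharp α) X) -
        A.dOne α (π.sharp ((A.twist π N H).dOne β X)) -
         (A.twist π N H).dOne β (π.sharp (A.dOne α X))) = 0 := by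
      ext Y
      simp only [LinearMap.add_apply, LinearMap.sub_apply, LinearMap.neg_apply, lieDer_apply,
        h.twist_dOne_bracket hA hV]
      rw [dOne_swap A α _ Y, dOne_swap A β _ Y, π.apply_sharp_swap (A.dOne α Y),
        π.apply_sharp_swap (A.dOne β Y), LinearMap.zero_apply]
      ring
    rw [e, ← zero_smul R (0 : Module.Dual R B), form1_smul, zero_smul]

end IsPoissonQuasiNijenhuis

/-! ### The square of the twisted differential. -/

namespace AlmostLieAlgebroid.IsLie

variable {R B : Type*} [CommRing R] [Algebra ℝ R] [AddCommGroup B] [Module R B]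
  [Module ℝ B] [IsScalarTower ℝ R B] {A : AlmostLieAlgebroid R B}

theorem jacobi_cyclic (hA : A.IsLie) (X Y Z : B) : A.bracket (A.bracket X Y) Z +
    A.bracket (A.bracket Y Z) X + A.bracket (A.bracket Z X) Y = 0 := by
  have h := hA.jacobi X Y Z
  rw [A.bracket_swap X (A.bracket Y Z), A.bracket_swap Y (A.bracket X Z), A.bracket_swap X Z,
    map_neg, LinearMap.neg_apply, neg_neg] at h
  rw [← sub_eq_zero] at h
  rw [← neg_eq_zero, ← h]
  abel

end AlmostLieAlgebroid.IsLie

namespace IsPoissonQuasiNijenhuis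

open ExtForms AlmostLieAlgebroid

variable {R B : Type*} [CommRing R] [Algebra ℝ R] [AddCommGroup B] [Module R B]
  [Module ℝ B] [IsScalarTower ℝ R B] {A : AlmostLieAlgebroid R B} {π : Bivector R B}
  {N : B →ₗ[R] B} {ψ H : B [⋀^Fin 3]→ₗ[R] R}

/-- The torsion equation rewritten: the covector in the torsion plus `ᵗN H(X,Y,·)` is `φ(X,Y,·)`,
and `π♯ᵗN = Nπ♯` absorbs the added summand into `N` of the twist. This is where `ψ + i_N H` comes
from. -/
theorem map_twist_bracket (h : IsPoissonQuasiNijenhuis A π N ψ H)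
    (X Y : B) : N ((A.twist π N H).bracket X Y) =
    A.bracket (N X) (N Y) - π.sharp (tri (ψ + insertEnd N H) X Y) := by
  have ht := h.torsion X Y
  have e : tri (ψ + insertEnd N H) X Y = contract2 H (N X) Y - contract2 H (N Y) X +
      contract2 ψ X Y + N.dualMap (tri H X Y) := by
    ext Z
    simp only [tri_add, tri_insertEnd, LinearMap.add_apply, LinearMap.sub_apply, contract2_eq_tri,
      LinearMap.dualMap_apply]
    rw [tri_swap_left H (N Y) X]
    ring
  rw [e, map_add π.sharp _ (N.dualMap _), ← ht, ← h.map_sharp, twist_bracket,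
    AlmostLieAlgebroid.torsion, map_sub]
  abel

/-- The iterated bracket is arranged by the number of `N`s, so that the terms free of `H` and `φ`
have cyclic sums governed by the Jacobi identity of `A`. -/
theorem twist_bracket_twist_bracket (h : IsPoissonQuasiNijenhuis A π N ψ H)
    (X Y Z : B) :
    (A.twist π N H).bracket ((A.twist π N H).bracket X Y) Z =
      (A.bracket (A.bracket (N X) (N Y)) Z + A.bracket (A.bracket (N X) Y) (N Z) +
        A.bracket (A.bracket X (N Y)) (N Z)) -
      N (A.bracket (A.bracket X Y) (N Z) + A.bracket (A.bracket (N X) Y) Z +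
        A.bracket (A.bracket X (N Y)) Z) + N (N (A.bracket (A.bracket X Y) Z)) -
      A.bracket (π.sharp (tri (ψ + insertEnd N H) X Y)) Z -
      π.sharp (tri (ψ + insertEnd N H) (A.bracket X Y) Z) +
      N (π.sharp (tri H (A.bracket X Y) Z)) -
      (A.bracket (π.sharp (tri H X Y)) (N Z) - N (A.bracket (π.sharp (tri H X Y)) Z)) -
      π.sharp (tri H ((A.twist π N H).bracket X Y) Z) := by
  have h1 := h.map_twist_bracket (A.bracket X Y) Z
  rw [twist_bracket, map_sub, map_sub, map_add, eq_sub_iff_add_eq] at h1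
  rw [twist_bracket A π N H ((A.twist π N H).bracket X Y) Z, h.map_twist_bracket, twist_bracket]
  simp only [map_add, map_sub, LinearMap.add_apply, LinearMap.sub_apply, ← h1]
  abel

theorem twist_jacobi (h : IsPoissonQuasiNijenhuis A π N ψ H)
    (hA : A.IsLie) (X Y Z : B) :
    (A.twist π N H).bracket ((A.twist π N H).bracket X Y) Z +
      (A.twist π N H).bracket ((A.twist π N H).bracket Y Z) X +
      (A.twist π N H).bracket ((A.twist π N H).bracket Z X) Y =
    - A.bracket (π.sharp (tri (ψ + insertEnd N H) X Y)) Z -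
      π.sharp (tri (ψ + insertEnd N H) (A.bracket X Y) Z) +
      N (π.sharp (tri H (A.bracket X Y) Z)) -
      (A.bracket (π.sharp (tri H X Y)) (N Z) - N (A.bracket (π.sharp (tri H X Y)) Z)) -
      π.sharp (tri H ((A.twist π N H).bracket X Y) Z) +
    (- A.bracket (π.sharp (tri (ψ + insertEnd N H) Y Z)) X -
      π.sharp (tri (ψ + insertEnd N H) (A.bracket Y Z) X) +
      N (π.sharp (tri H (A.bracket Y Z) X)) -
      (A.bracket (π.sharp (tri H Y Z)) (N X) - N (A.bracket (π.sharp (tri H Y Z)) X)) -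
      π.sharp (tri H ((A.twist π N H).bracket Y Z) X)) +
    (- A.bracket (π.sharp (tri (ψ + insertEnd N H) Z X)) Y -
      π.sharp (tri (ψ + insertEnd N H) (A.bracket Z X) Y) +
      N (π.sharp (tri H (A.bracket Z X) Y)) -
      (A.bracket (π.sharp (tri H Z X)) (N Y) - N (A.bracket (π.sharp (tri H Z X)) Y)) -
      π.sharp (tri H ((A.twist π N H).bracket Z X) Y)) := by
  -- Jacobi identities with `N` on two arguments, then `N` of those with `N` on one argument, then
  -- `N²` of the one without `N`.
  have j1 := hA.jacobi_cyclic (N X) (N Y) Z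
  have j2 := hA.jacobi_cyclic (N Y) (N Z) X
  have j3 := hA.jacobi_cyclic (N Z) (N X) Y
  have j4 := congrArg N (hA.jacobi_cyclic (N X) Y Z)
  have j5 := congrArg N (hA.jacobi_cyclic X (N Y) Z)
  have j6 := congrArg N (hA.jacobi_cyclic X Y (N Z))
  have j7 := congrArg (fun U => N (N U)) (hA.jacobi_cyclic X Y Z)
  simp only [map_add, map_zero] at j4 j5 j6 j7
  simp only [h.twist_bracket_twist_bracket, map_add]
  linear_combination (norm := abel) j1 + j2 + j3 - j4 - j5 - j6 + j7

/-- The value of `δ²f` is the failure of `ρ ∘ N` to preserve brackets, which by `map_twist_bracket`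
is `ρ(π♯φ(X,Y,·))f`. -/
theorem koszul_koszul_fn0 (h : IsPoissonQuasiNijenhuis A π N ψ H)
    (hA : A.IsLie) (f : R) :
    (A.twist π N H).koszul ((A.twist π N H).koszul (fn0 f)) =
      A.schouten π (homog 3 (ψ + insertEnd N H)) (fn0 f) := by
  have e : parity (homog 3 (ψ + insertEnd N H)) = -homog 3 (ψ + insertEnd N H) := by
    rw [parity_homog, ← neg_one_smul_eq]; norm_num
  rw [schouten_of_odd A π e, schouten_fn0, koszul_fn0, contract_homog_succ]
  refine DFinsupp.ext fun n => ?_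
  rw [neg_component]
  by_cases hn : n = 2
  swap
  · rw [form1, koszul_homog_ne _ (by omega), homog_ne (Ne.symm hn)]; simp
  subst hn
  ext v
  obtain ⟨X, Y, rfl⟩ : ∃ X Y, v = ![X, Y] := ⟨v 0, v 1, by ext i; fin_cases i <;> rfl⟩
  rw [koszul_form1_apply, AlternatingMap.neg_apply, homog_self]
  change _ = -tri (ψ + insertEnd N H) (π.sharp (A.diffFn f)) X Y
  rw [tri_rotate, π.apply_sharp_swap (tri _ X Y), neg_neg, dOne_apply, twist_diffFn,
    LinearMap.dualMap_apply, LinearMap.dualMap_apply, LinearMap.dualMap_apply,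
    h.map_twist_bracket, map_sub, diffFn_apply A f (N Y), diffFn_apply A f (N X),
    diffFn_apply A f (A.bracket _ _), hA.anchor_bracket, Derivation.commutator_apply,
      twist_anchor, twist_anchor]
  ring

/-- For a skew bracket, `δ²α` consists of the anchor defect applied to values of `α` and of `α` on
the Jacobiator. The anchor defect is replaced by `ρ(π♯φ)`. -/
theorem twist_diff_two (h : IsPoissonQuasiNijenhuis A π N ψ H)
    (hA : A.IsLie) (α : Module.Dual R B) (X Y Z : B) :
    A.anchor (N X) ((A.twist π N H).dOne α Y Z) -
      (A.twist π N H).dOne α ((A.twist π N H).bracket X Y) Z -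
      (A.twist π N H).dOne α Y ((A.twist π N H).bracket X Z) -
      (A.anchor (N Y) ((A.twist π N H).dOne α X Z) -
        (A.twist π N H).dOne α X ((A.twist π N H).bracket Y Z)) +
      A.anchor (N Z) ((A.twist π N H).dOne α X Y) =
    A.anchor (π.sharp (tri (ψ + insertEnd N H) X Y)) (α Z) +
    A.anchor (π.sharp (tri (ψ + insertEnd N H) Y Z)) (α X) +
    A.anchor (π.sharp (tri (ψ + insertEnd N H) Z X)) (α Y) +
    α ((A.twist π N H).bracket ((A.twist π N H).bracket X Y) Z +
      (A.twist π N H).bracket ((A.twist π N H).bracket Y Z) X +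
      (A.twist π N H).bracket ((A.twist π N H).bracket Z X) Y) := by
  have e : ∀ U W, A.anchor (π.sharp (tri (ψ + insertEnd N H) U W)) =
      ⁅A.anchor (N U), A.anchor (N W)⁆ - A.anchor (N ((A.twist π N H).bracket U W)) :=
    fun U W => by rw [h.map_twist_bracket, map_sub, hA.anchor_bracket]; abel
  simp only [e, dOne_apply, twist_anchor, map_add, map_sub, Derivation.sub_apply,
    Derivation.commutator_apply]
  rw [bracket_swap _ Y ((A.twist π N H).bracket X Z), bracket_swap _ X Z,
    bracket_swap _ X ((A.twist π N H).bracket Y Z)]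
  simp only [map_neg, LinearMap.neg_apply, Derivation.neg_apply]
  ring

/-- The `H`-terms in one summand of the cyclic Jacobiator. The commutation rule, applied to the
covector `H(X,Y,·)`, removes the brackets with `π♯H(X,Y,·)`. -/
theorem cyclic_insertEnd (h : IsPoissonQuasiNijenhuis A π N ψ H)
    (α : Module.Dual R B) (X Y Z : B) :
    α (N (π.sharp (tri H (A.bracket X Y) Z)) -
      (A.bracket (π.sharp (tri H X Y)) (N Z) - N (A.bracket (π.sharp (tri H X Y)) Z)) -
      π.sharp (tri H ((A.twist π N H).bracket X Y) Z)) =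
    - tri H (A.bracket X Y) Z (N (π.sharp α)) - tri H X Y (A.bracket (π.sharp α) (N Z)) +
      tri H X Y (N (A.bracket (π.sharp α) Z)) - A.anchor (N Z) (tri H X Y (π.sharp α)) +
      A.anchor Z (tri H X Y (N (π.sharp α))) +
      tri H (A.bracket (N X) Y + A.bracket X (N Y) - N (A.bracket X Y)) Z (π.sharp α) := by
  have hc := h.apply_bracket_sharp_map (tri H X Y) α Z
  simp only [dOne_apply, LinearMap.dualMap_apply] at hc
  simp only [map_sub α]
  rw [hc, h.apply_map_sharp_swap α, π.apply_sharp_swap α, twist_bracket A π N H X Y]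
  simp only [map_sub, LinearMap.sub_apply]
  rw [tri_swap_right H (π.sharp (tri H X Y))]
  ring

/-- The Jacobiator is determined by the closedness of `ψ` and `H`: the terms `φ([X,Y],Z,π♯α)`
missing from a full differential of `φ` are those produced by `twist_jacobi`. -/
theorem apply_twist_jacobi (h : IsPoissonQuasiNijenhuis A π N ψ H)
    (hA : A.IsLie) (α : Module.Dual R B) (X Y Z : B) :
    α ((A.twist π N H).bracket ((A.twist π N H).bracket X Y) Z +
      (A.twist π N H).bracket ((A.twist π N H).bracket Y Z) X +
      (A.twist π N H).bracket ((A.twist π N H).bracket Z X) Y) +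
    α (A.bracket (π.sharp (tri (ψ + insertEnd N H) X Y)) Z) +
    α (A.bracket (π.sharp (tri (ψ + insertEnd N H) Y Z)) X) +
    α (A.bracket (π.sharp (tri (ψ + insertEnd N H) Z X)) Y) =
    A.anchor X (tri (ψ + insertEnd N H) Y Z (π.sharp α)) +
    A.anchor Y (tri (ψ + insertEnd N H) Z X (π.sharp α)) +
    A.anchor Z (tri (ψ + insertEnd N H) X Y (π.sharp α)) -
    A.anchor (π.sharp α) (tri (ψ + insertEnd N H) X Y Z) +
    tri (ψ + insertEnd N H) (A.bracket (π.sharp α) X) Y Z +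
    tri (ψ + insertEnd N H) X (A.bracket (π.sharp α) Y) Z +
    tri (ψ + insertEnd N H) X Y (A.bracket (π.sharp α) Z) := by
  -- `N` is inserted only at `X`, `Y` or `Z`; the terms with `N(π♯α)` come from `cyclic_insertEnd`.
  have d0 := h.closed_psi ![X, Y, Z, π.sharp α]
  have d1 := h.closed_H ![N X, Y, Z, π.sharp α]
  have d2 := h.closed_H ![X, N Y, Z, π.sharp α]
  have d3 := h.closed_H ![X, Y, N Z, π.sharp α]
  simp only [diff_three, ← tri_apply] at d0 d1 d2 d3
  have c1 := h.cyclic_insertEnd α X Y Z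
  have c2 := h.cyclic_insertEnd α Y Z X
  have c3 := h.cyclic_insertEnd α Z X Y
  have j := congrArg α (h.twist_jacobi hA X Y Z)
  have p : ∀ U W : B, α (π.sharp (tri (ψ + insertEnd N H) U W)) =
    -tri (ψ + insertEnd N H) U W (π.sharp α) := fun U W => π.apply_sharp_swap _ _
  simp only [map_add α, map_sub α, map_neg α, p] at j c1 c2 c3 ⊢
  have m1 : ∀ (η : B [⋀^Fin 3]→ₗ[R] R) (U V W T : B), tri η U (A.bracket V W) T =
    -tri η (A.bracket V W) U T := fun η U V W T => tri_swap_left _ _ _ _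
  have m3 : ∀ (η : B [⋀^Fin 3]→ₗ[R] R) (U V W T : B), tri η U T (A.bracket V W) =
    tri η (A.bracket V W) U T := fun η U V W T => (tri_rotate _ _ _ _).symm
  have m4 : ∀ (η : B [⋀^Fin 3]→ₗ[R] R) (U V W T : B), tri η U T (N (A.bracket V W)) =
    tri η (N (A.bracket V W)) U T := fun η U V W T => (tri_rotate _ _ _ _).symm
  have b0 : ∀ U, A.bracket U (π.sharp α) = -A.bracket (π.sharp α) U := fun U => A.bracket_swap _ _
  have b1 := A.bracket_swap Z X
  have b2 := A.bracket_swap (N Z) X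
  have b3 := A.bracket_swap Z (N X)
  have z1 := fun (η : B [⋀^Fin 3]→ₗ[R] R) => tri_swap_left η Z X
  have w1 := fun (η : B [⋀^Fin 3]→ₗ[R] R) U => tri_swap_right η U Z X
  simp only [tri_add, tri_insertEnd, map_add, map_sub, map_neg, LinearMap.add_apply,
    LinearMap.sub_apply, LinearMap.neg_apply, m1, m3, m4, b0, b1, b2, b3, z1,
    w1] at j c1 c2 c3 d0 d1 d2 d3 ⊢
  linear_combination (norm := abel) j + c1 + c2 + c3 - d0 - d1 - d2 - d3

end IsPoissonQuasiNijenhuis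

namespace ExtForms

variable {R V : Type*} [CommRing R] [AddCommGroup V] [Module R V]

theorem apply_three (θ : ExtForms R V) (X Y Z : V) :
    θ 3 ![X, Y, Z] = contract Z (contract Y (contract X θ)) 0 ![] := by
  rw [contract_apply_apply, contract_apply_apply, contract_apply_apply]

theorem contract_homog_three (η : V [⋀^Fin 3]→ₗ[R] R) (X Y Z : V) :
    contract Z (contract Y (contract X (homog 3 η))) = fn0 (tri η X Y Z) := by
  rw [contract_homog_succ, contract_homog_succ, contract_homog_succ, fn0]
  congr 1
  ext v
  rw [Subsingleton.elim v ![]]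
  rfl

end ExtForms

namespace IsPoissonQuasiNijenhuis

open ExtForms AlmostLieAlgebroid

variable {R B : Type*} [CommRing R] [Algebra ℝ R] [AddCommGroup B] [Module R B]
  [Module ℝ B] [IsScalarTower ℝ R B] {A : AlmostLieAlgebroid R B} {π : Bivector R B}
  {N : B →ₗ[R] B} {ψ H : B [⋀^Fin 3]→ₗ[R] R}

theorem schouten_form1_three (α : Module.Dual R B) (η : B [⋀^Fin 3]→ₗ[R] R) (X Y Z : B) :
    A.schouten π (form1 α) (homog 3 η) 3 ![X, Y, Z] =
      A.anchor (π.sharp α) (tri η X Y Z) - tri η (A.bracket (π.sharp α) X) Y Z -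
      tri η X (A.bracket (π.sharp α) Y) Z - tri η X Y (A.bracket (π.sharp α) Z) -
      tri η (π.sharp (A.dOne α X)) Y Z - tri η X (π.sharp (A.dOne α Y)) Z -
      tri η X Y (π.sharp (A.dOne α Z)) := by
  have e := A.koszul_even (parity_form1 α)
  have e' : ∀ f : R, π.pairing (A.koszul (form1 α)) (fn0 f) = 0 := fun f => by
    rw [π.pairing_of_even e, parity_fn0, π.pairing_fn0]
  have hp : ∀ (W : B) (Q : ExtForms R B), contract W (π.pairing (A.koszul (form1 α)) Q) =
      π.pairing (A.koszul (form1 α)) (contract W Q) - contract (π.sharp (A.dOne α W)) Q :=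
    fun W Q => by rw [π.contract_pairing, e, contract_koszul_form1, π.pairing_form1]
  rw [apply_three, schouten_form1]
  simp only [map_add, map_sub, contract_lie, hp, contract_homog_three, e', lie_fn0,
    DirectSum.add_apply, DirectSum.sub_apply, AlternatingMap.add_apply, AlternatingMap.sub_apply,
    fn0_zero, DirectSum.zero_apply, AlternatingMap.zero_apply]
  ring

theorem koszul_koszul_form1 (h : IsPoissonQuasiNijenhuis A π N ψ H)
    (hA : A.IsLie) (α : Module.Dual R B) :
    (A.twist π N H).koszul ((A.twist π N H).koszul (form1 α)) =
      A.schouten π (homog 3 (ψ + insertEnd N H)) (form1 α) := by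
  have hk := (A.twist π N H).koszul_homog 1 (AlternatingMap.ofSubsingleton R B R (0 : Fin 1) α)
  change (A.twist π N H).koszul (form1 α) = homog 2 ((A.twist π N H).koszul (form1 α) 2) at hk
  refine DFinsupp.ext fun n => ?_
  by_cases hn : n = 3
  swap
  · rw [hk, koszul_homog_ne _ (by omega)]
    exact ((isSchoutenBracket_schouten A π).degree 3 1 _ _ n (by omega)).symm
  subst hn
  ext v
  obtain ⟨X, Y, Z, rfl⟩ : ∃ X Y Z, v = ![X, Y, Z] :=
    ⟨v 0, v 1, v 2, by ext i; fin_cases i <;> rfl⟩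
  have e : parity (homog 3 (ψ + insertEnd N H)) = -homog 3 (ψ + insertEnd N H) := by
    rw [parity_homog, ← neg_one_smul_eq]; norm_num
  rw [hk, koszul_homog_apply, diff_two, schouten_of_odd A π e, neg_component,
    AlternatingMap.neg_apply, schouten_form1_three]
  simp only [koszul_form1_apply, twist_anchor]
  -- Skew-symmetry of `π` turns `φ(U,V,π♯ι_W dα)` into values of `dα`, which match the anchor and
  -- bracket terms of `δ²α`.
  have p : ∀ U V W : B, tri (ψ + insertEnd N H) U V (π.sharp (A.dOne α W)) =
      A.anchor (π.sharp (tri (ψ + insertEnd N H) U V)) (α W) -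
      α (A.bracket (π.sharp (tri (ψ + insertEnd N H) U V)) W) +
      A.anchor W (tri (ψ + insertEnd N H) U V (π.sharp α)) := fun U V W => by
    rw [π.apply_sharp_swap, dOne_swap, dOne_apply, π.apply_sharp_swap α, map_neg]
    ring
  rw [h.twist_diff_two hA, tri_rotate _ (π.sharp (A.dOne α X)),
    ← tri_rotate _ Z X (π.sharp (A.dOne α Y)), p, p, p]
  linear_combination h.apply_twist_jacobi hA α X Y Z

/-! ### Closedness of `ψ + i_N H` under the twisted differential. -/

/-- The part of `δφ` quadratic in the `3`-forms, for one splitting of four arguments into two pairs.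
Moving `π♯` across the pairing cancels everything except terms containing `Nπ♯`, and these cancel
because `Nπ♯` is skew too. -/
theorem sharp_tri_add (h : IsPoissonQuasiNijenhuis A π N ψ H)
    (U V S T : B) :
      tri ψ (π.sharp (tri H U V)) S T + tri H (π.sharp (tri H U V)) (N S) T +
      tri H (π.sharp (tri H U V)) S (N T) + tri H (π.sharp (tri (ψ + insertEnd N H) U V)) S T +
      (tri ψ (π.sharp (tri H S T)) U V + tri H (π.sharp (tri H S T)) (N U) V +
      tri H (π.sharp (tri H S T)) U (N V) + tri H (π.sharp (tri (ψ + insertEnd N H) S T)) U V) = 0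
        := by
  have a1 : ∀ U V S T : B, tri H (π.sharp (tri (ψ + insertEnd N H) U V)) S T =
      - tri ψ (π.sharp (tri H S T)) U V - tri H (N (π.sharp (tri H S T))) U V -
      tri H (π.sharp (tri H S T)) (N U) V - tri H (π.sharp (tri H S T)) U (N V) := by
    intro U V S T
    rw [tri_rotate, π.apply_sharp_swap, ← tri_rotate (ψ + insertEnd N H), tri_add, tri_insertEnd]
    ring
  have a2 : tri H (N (π.sharp (tri H S T))) U V = - tri H (N (π.sharp (tri H U V))) S T := by
    rw [tri_rotate, h.apply_map_sharp_swap, ← tri_rotate]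
  linear_combination a1 U V S T + a1 S T U V - a2

theorem twist_diff_eq_zero (h : IsPoissonQuasiNijenhuis A π N ψ H)
    (X Y Z W : B) :
    (A.twist π N H).diff (ψ + insertEnd N H) ![X, Y, Z, W] = 0 := by
  have e : (fun Y : Fin 3 → B =>
      H ![N (Y 0), N (Y 1), Y 2] + H ![N (Y 1), N (Y 2), Y 0] + H ![N (Y 2), N (Y 0), Y 1]) =
      fun Y => tri H (N (Y 0)) (N (Y 1)) (Y 2) + tri H (Y 0) (N (Y 1)) (N (Y 2)) +
        tri H (N (Y 0)) (Y 1) (N (Y 2)) := by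
    funext Y
    rw [tri_rotate H (Y 0), ← tri_rotate H (N (Y 2))]
    rfl
  have e0 : ∀ U V T : B, ![U, V, T] 0 = U := fun _ _ _ => rfl
  have e1 : ∀ U V T : B, ![U, V, T] 1 = V := fun _ _ _ => rfl
  have e2 : ∀ U V T : B, ![U, V, T] 2 = T := fun _ _ _ => rfl
  have e3 : ∀ Y Z, (A.deform N).bracket Y Z =
    A.bracket (N Y) Z + A.bracket Y (N Z) - N (A.bracket Y Z) := fun _ _ => rfl
  have e4 : ∀ Y, (A.deform N).anchor Y = A.anchor (N Y) := fun _ => rfl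
  have d0 := h.diff_psi ![X, Y, Z, W]
  rw [e, diff_three, diff_three] at d0
  simp only [e0, e1, e2, e3, e4, ← tri_apply] at d0
  -- `N` is placed on each of the six pairs of arguments, matching the terms of `dℋ` and of `d_N(i_N
  -- H)`.
  have d1 := h.closed_H ![N X, N Y, Z, W]
  have d2 := h.closed_H ![N X, Y, N Z, W]
  have d3 := h.closed_H ![N X, Y, Z, N W]
  have d4 := h.closed_H ![X, N Y, N Z, W]
  have d5 := h.closed_H ![X, N Y, Z, N W]
  have d6 := h.closed_H ![X, Y, N Z, N W]
  simp only [diff_three, ← tri_apply] at d1 d2 d3 d4 d5 d6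
  have m1 : ∀ (η : B [⋀^Fin 3]→ₗ[R] R) (γ : Module.Dual R B) (U T : B),
    tri η U (π.sharp γ) T = -tri η (π.sharp γ) U T := fun η γ U T => tri_swap_left _ _ _ _
  have m3 : ∀ (η : B [⋀^Fin 3]→ₗ[R] R) (γ : Module.Dual R B) (U T : B), tri η U T (π.sharp γ) =
    tri η (π.sharp γ) U T := fun η γ U T => (tri_rotate _ _ _ _).symm
  -- The three splittings of four arguments into pairs; the middle one enters with a minus sign.
  have k1 := h.sharp_tri_add X Y Z W
  have k2 := h.sharp_tri_add X Z Y W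
  have k3 := h.sharp_tri_add X W Y Z
  rw [diff_three]
  simp only [← tri_apply, tri_add, tri_insertEnd, h.map_twist_bracket, twist_anchor]
  simp only [twist_bracket]
  simp only [map_add, map_sub, LinearMap.add_apply, LinearMap.sub_apply, m1, m3] at d0 ⊢
  linear_combination (norm := abel) d0 + d1 + d2 + d3 + d4 + d5 + d6 + k1 - k2 + k3

end IsPoissonQuasiNijenhuis

/-! ### Assembly of the Lie quasi-bialgebroid. -/

namespace IsPoissonQuasiNijenhuis

open ExtForms AlmostLieAlgebroid

variable {R B : Type*} [CommRing R] [Algebra ℝ R] [AddCommGroup B] [Module R B]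
  [Module ℝ B] [IsScalarTower ℝ R B] {A : AlmostLieAlgebroid R B} {π : Bivector R B}
  {N : B →ₗ[R] B} {ψ H : B [⋀^Fin 3]→ₗ[R] R}

theorem isLieQuasiBialgebroid (h : IsPoissonQuasiNijenhuis A π N ψ H) (hA : A.IsLie)
    (hV : HasLocalFrames R B) :
    IsLieQuasiBialgebroid (A.cotangent π) LinearMap.id (A.twist π N H).koszul
      (ψ + insertEnd N H) where
  isLie := isLie_cotangent hA hV h.poisson
  derivation := isDegreeOneDerivation_koszul _
  bracket := by
    refine ⟨A.schouten π, isSchoutenBracket_schouten A π, fun p P S => ?_,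
      koszul_koszul_eq_schouten hV _ (h.koszul_koszul_fn0 hA) (h.koszul_koszul_form1 hA)⟩
    have hd := schoutenDefect_eq_zero hV h.schoutenDefect_fn0_fn0
      (h.schoutenDefect_form1_fn0 hA) (h.schoutenDefect_form1_form1 hA hV) (homog p P) S
    rw [schoutenDefect_apply, parity_homog] at hd
    rw [neg_one_pow_real_smul]
    rcases Nat.even_or_odd p with hp | hp
    · rw [hp.neg_one_pow, one_smul] at hd
      rw [hp.add_one.neg_one_pow, neg_one_smul_eq, ← sub_eq_zero, ← hd]
      abel
    · rw [hp.neg_one_pow, neg_one_smul_eq, schouten_neg_left] at hd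
      rw [hp.add_one.neg_one_pow, one_smul, ← sub_eq_zero, ← hd]
      abel
  closed := by
    refine DFinsupp.ext fun n => ?_
    by_cases hn : n = 4
    · subst hn
      ext v
      obtain ⟨X, Y, Z, W, rfl⟩ : ∃ X Y Z W, v = ![X, Y, Z, W] :=
        ⟨v 0, v 1, v 2, v 3, by ext i; fin_cases i <;> rfl⟩
      rw [koszul_homog_apply, h.twist_diff_eq_zero]
      rfl
    · rw [koszul_homog_ne _ (by omega)]; rfl

end IsPoissonQuasiNijenhuis

/-! ### Local frames for sections of a smooth vector bundle. -/

section Manifold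

variable {EM : Type*} [NormedAddCommGroup EM] [NormedSpace ℝ EM]
  {M : Type*} [TopologicalSpace M] [ChartedSpace EM M]
  {F : Type*} [NormedAddCommGroup F] [NormedSpace ℝ F]
  {E : M → Type*} [TopologicalSpace (Bundle.TotalSpace F E)]
  [∀ x, AddCommGroup (E x)] [∀ x, Module ℝ (E x)] [∀ x, TopologicalSpace (E x)]
  [FiberBundle F E] [VectorBundle ℝ F E]

/-- A bump function `f` supported in a trivialising set is used twice, once to extend the frame
sections by zero and once to extend the coefficient functionals. Hence `χ = f²`. -/
theorem exists_isFrameFunction [FiniteDimensional ℝ EM] [FiniteDimensional ℝ F]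
    [IsManifold 𝓘(ℝ, EM) ∞ M] [T2Space M] [ContMDiffVectorBundle ∞ F E 𝓘(ℝ, EM)] (x : M) :
    ∃ χ : C^∞⟮𝓘(ℝ, EM), M; 𝓘(ℝ), ℝ⟯,
      IsFrameFunction C^∞⟮𝓘(ℝ, EM), M; 𝓘(ℝ), ℝ⟯ Cₛ^∞⟮𝓘(ℝ, EM); F, E⟯ χ ∧ χ x = 1 := by
  have : ContMDiffVectorBundle 1 F E 𝓘(ℝ, EM) := .of_le (n := ∞) (by norm_cast)
  let e := trivializationAt F E x
  let b := Module.finBasis ℝ F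
  obtain ⟨f, -, hf⟩ := (SmoothBumpFunction.nhds_basis_tsupport (I := 𝓘(ℝ, EM)) x).mem_iff.1
    (e.open_baseSet.mem_nhds (FiberBundle.mem_baseSet_trivializationAt F E x))
  have hfs : ContMDiff 𝓘(ℝ, EM) 𝓘(ℝ) ∞ f := f.contMDiff
  let g : C^∞⟮𝓘(ℝ, EM), M; 𝓘(ℝ), ℝ⟯ := ⟨f, hfs⟩
  have hsec : ∀ i, ContMDiff 𝓘(ℝ, EM) (𝓘(ℝ, EM).prod 𝓘(ℝ, F)) ∞
      (fun y => Bundle.TotalSpace.mk' F y (f y • e.localFrame b i y)) := fun i =>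
    ContMDiffOn.smul_section_of_tsupport hfs.contMDiffOn e.open_baseSet hf
      (e.contMDiffOn_localFrame_baseSet ∞ b i)
  have hcoeff : ∀ i (s : Cₛ^∞⟮𝓘(ℝ, EM); F, E⟯), ContMDiff 𝓘(ℝ, EM) 𝓘(ℝ) ∞
      (fun y => f y * e.localFrameCoeff 𝓘(ℝ, EM) b i y (s y)) := fun i s =>
    contMDiff_of_tsupport fun y hy => (hfs y).mul
      (contMDiffAt_localFrameCoeff b (hf (tsupport_mul_subset_left hy)) (s.contMDiff y) i)
  let ε : Fin (Module.finrank ℝ F) →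
      Module.Dual C^∞⟮𝓘(ℝ, EM), M; 𝓘(ℝ), ℝ⟯ Cₛ^∞⟮𝓘(ℝ, EM); F, E⟯ := fun i =>
    { toFun := fun s => ⟨_, hcoeff i s⟩
      map_add' := fun s t => by
        ext y
        change f y * e.localFrameCoeff 𝓘(ℝ, EM) b i y (s y + t y) =
          f y * e.localFrameCoeff 𝓘(ℝ, EM) b i y (s y) + f y * e.localFrameCoeff 𝓘(ℝ, EM) b i y (t
            y)
        rw [map_add, mul_add]
      map_smul' := fun c s => by
        ext y
        change f y * e.localFrameCoeff 𝓘(ℝ, EM) b i y (c y • s y) =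
          c y * (f y * e.localFrameCoeff 𝓘(ℝ, EM) b i y (s y))
        rw [map_smul, smul_eq_mul]
        ring }
  refine ⟨g * g, ⟨_, fun i => ⟨_, hsec i⟩, ε, fun s => ?_⟩, ?_⟩
  · ext y
    have hsum : ∀ (t : Fin (Module.finrank ℝ F) → Cₛ^∞⟮𝓘(ℝ, EM); F, E⟯),
        (∑ i, t i) y = ∑ i, t i y := fun t =>
      map_sum (⟨⟨fun s => s y, rfl⟩, fun _ _ => rfl⟩ : Cₛ^∞⟮𝓘(ℝ, EM); F, E⟯ →+ E y) t Finset.univ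
    rw [hsum]
    change (f y * f y) • s y =
      ∑ i, (f y * e.localFrameCoeff 𝓘(ℝ, EM) b i y (s y)) • f y • e.localFrame b i y
    by_cases hy : y ∈ e.baseSet
    · conv_lhs => rw [e.eq_sum_localFrameCoeff_smul (I := 𝓘(ℝ, EM)) (b := b) hy (s := s)]
      rw [Finset.smul_sum]
      refine Finset.sum_congr rfl fun i _ => ?_
      rw [smul_smul, smul_smul]
      congr 1
      ring
    · have h0 : f y = 0 := by
        by_contra hne
        exact hy (hf (subset_tsupport _ hne))
      simp [h0]
  · change f x * f x = 1
    rw [f.eq_one, one_mul]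

theorem hasLocalFrames [FiniteDimensional ℝ EM] [FiniteDimensional ℝ F]
    [IsManifold 𝓘(ℝ, EM) ∞ M] [T2Space M] [ContMDiffVectorBundle ∞ F E 𝓘(ℝ, EM)] :
    HasLocalFrames C^∞⟮𝓘(ℝ, EM), M; 𝓘(ℝ), ℝ⟯ Cₛ^∞⟮𝓘(ℝ, EM); F, E⟯ where
  eq_zero_of_mul r h := by
    ext x
    obtain ⟨χ, hχ, h1⟩ := exists_isFrameFunction (EM := EM) (F := F) (E := E) x
    have := DFunLike.congr_fun (h χ hχ) x
    change χ x * r x = 0 at this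
    rwa [h1, one_mul] at this
  eq_zero_of_smul X h := by
    ext x
    obtain ⟨χ, hχ, h1⟩ := exists_isFrameFunction (EM := EM) (F := F) (E := E) x
    have := DFunLike.congr_fun (h χ hχ) x
    change χ x • X x = 0 at this
    rwa [h1, one_smul] at this

end Manifold

theorem mainTheorem1
    {EM : Type*} [NormedAddCommGroup EM] [NormedSpace ℝ EM] [FiniteDimensional ℝ EM]
    {M : Type*} [TopologicalSpace M] [ChartedSpace EM M] [IsManifold 𝓘(ℝ, EM) ∞ M]
    [T2Space M] [SigmaCompactSpace M]
    {F : Type*} [NormedAddCommGroup F] [NormedSpace ℝ F] [FiniteDimensional ℝ F]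
    {E : M → Type*} [TopologicalSpace (Bundle.TotalSpace F E)]
    [∀ x, AddCommGroup (E x)] [∀ x, Module ℝ (E x)] [∀ x, TopologicalSpace (E x)]
    [FiberBundle F E] [VectorBundle ℝ F E] [ContMDiffVectorBundle ∞ F E 𝓘(ℝ, EM)]
    (A : AlmostLieAlgebroid C^∞⟮𝓘(ℝ, EM), M; 𝓘(ℝ), ℝ⟯ Cₛ^∞⟮𝓘(ℝ, EM); F, E⟯)
    (hA : A.IsLie)
    (π : Bivector C^∞⟮𝓘(ℝ, EM), M; 𝓘(ℝ), ℝ⟯ Cₛ^∞⟮𝓘(ℝ, EM); F, E⟯)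
    (N : Cₛ^∞⟮𝓘(ℝ, EM); F, E⟯ →ₗ[C^∞⟮𝓘(ℝ, EM), M; 𝓘(ℝ), ℝ⟯] Cₛ^∞⟮𝓘(ℝ, EM); F, E⟯)
    (ψ H : Cₛ^∞⟮𝓘(ℝ, EM); F, E⟯ [⋀^Fin 3]→ₗ[C^∞⟮𝓘(ℝ, EM), M; 𝓘(ℝ), ℝ⟯]
      C^∞⟮𝓘(ℝ, EM), M; 𝓘(ℝ), ℝ⟯)
    (h : IsPoissonQuasiNijenhuis A π N ψ H) :
    ∃ δ : ExtForms C^∞⟮𝓘(ℝ, EM), M; 𝓘(ℝ), ℝ⟯ Cₛ^∞⟮𝓘(ℝ, EM); F, E⟯ →ₗ[ℝ]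
        ExtForms C^∞⟮𝓘(ℝ, EM), M; 𝓘(ℝ), ℝ⟯ Cₛ^∞⟮𝓘(ℝ, EM); F, E⟯,
      IsTwistedDifferential A π N H δ ∧
      IsLieQuasiBialgebroid (A.cotangent π) LinearMap.id δ (ψ + insertEnd N H) :=
  ⟨(A.twist π N H).koszul, A.isTwistedDifferential_koszul π N H,
    h.isLieQuasiBialgebroid hA hasLocalFrames⟩

end
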